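/- A \emph{p.m.p. groupoid} is a groupoid $\mathscr G$ that is a standard Borel space, whose unit space $\mathscr G^0$ is Borel, whose source, range, multiplication and inversion maps $\mathfrak s,\mathfrak r,\cdot,{}^{-1}$ are Borel and for which $\mathfrak s^{-1}(x)$ is countable for every $x\in\mathscr G^0$, together with a Borel probability measure $\mu$ on $\mathscr G^0$ such that $\int_{\mathscr G^0}|\mathfrak s^{-1}(x)\cap B|\,d\mu(x)=\int_{\mathscr G^0}|\mathfrak r^{-1}(x)\cap B|\,d\mu(x)$ for every Borel $B\subseteq\mathscr G$; this common value defines a measure on $\mathscr G$, also written $\mu$. Let $I_{\mathscr G}$ be the inverse semigroup of partial isometries of $\mathscr G$, i.e. of (characteristic functions of) Borel sets $B\subseteq\mathscr G$ on which $\mathfrak s$ and $\mathfrak r$ are injective, identified modulo $\mu$-null sets, with product $BC=\{xy: x\in B,\ y\in C,\ \mathfrak s(x)=\mathfrak r(y)\}$, adjoint $B^*=B^{-1}$ and identity $1=\mathscr G^0$. Write $[I_{\mathscr G}]$ for its complex linear span, $\tau(a)=\int_{\mathscr G^0}a\,d\mu$ for the trace and $\|a\|_2=\tau(a^*a)^{1/2}$,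 which is the norm of $a$ in $L^2(\mathscr G,\mu)$. For $\Omega\subseteq I_{\mathscr G}$ write $\Omega^*=\{s^*:s\in\Omega\}$, $\Omega^k$ for the set of products of $k$ elements of $\Omega$, $\Omega^{\le n}=\bigcup_{k=1}^n\Omega^k$, and $I(\Omega)$ for the set of elements of $I_{\mathscr G}$ that are finite (possibly empty) sums of elements of $\Omega$. The set $\Omega$ is \emph{generating} if $I(\bigcup_{n\ge1}(\Omega\cup\Omega^*)^n)$ is $\|\cdot\|_2$-dense in $I_{\mathscr G}$ and contains $1-p$ for each projection $p$ in it. Let $I_d\subseteq M_d=M_d(\mathbb C)$ be the set of partial permutation matrices, $\mathrm{tr}$ the normalized trace on $M_d$, and $\|A\|_2=\mathrm{tr}(A^*A)^{1/2}$. For a finite $F\subseteq I_{\mathscr G}$, $n,d\in\mathbb N$ and $\delta>0$ let $\mathrm{SA}(F,n,\delta,d)$ be the set of linear maps $\varphi:[I_{\mathscr G}]\to M_d$ such that $\|\varphi(s_1\cdots s_k)-\varphi(s_1)\cdots\varphi(s_k)\|_2<\delta$ for all $1\le k\le n$ and $s_1,\dots,s_k\in F\cup F^*$, and such that $\varphi(s)\in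 I_d$ and $|\mathrm{tr}(\varphi(s))-\tau(s)|<\delta$ for all $s\in(F\cup F^*)^{\le n}$. For a finite $E\subseteq I_{\mathscr G}$ let $|\mathrm{SA}(F,n,\delta,d)|_E$ be the number of distinct restrictions $\varphi|_E$ with $\varphi\in\mathrm{SA}(F,n,\delta,d)$. For $\Omega\subseteq I_{\mathscr G}$ set $$s(\Omega)=\sup_{E}\ \inf_{F}\ \inf_{n\ge1}\ \inf_{\delta>0}\ \limsup_{d\to\infty}\frac{\log|\mathrm{SA}(F,n,\delta,d)|_E}{d\log d}\in[-\infty,\infty],$$ where $E$ and $F$ range over the finite subsets of $\Omega$, $\log 0=-\infty$ and $\log\infty=\infty$, and let $\underline s(\Omega)$ be defined in the same way with $\liminf$ in place of $\limsup$. The \emph{sofic dimension} and the \emph{lower sofic dimension} of $\mathscr G$ are $s(\mathscr G)=s(I_{\mathscr G})$ and $\underline s(\mathscr G)=\underline s(I_{\mathscr G})$. \textbf{Theorem.} Let $\mathscr G$ be a p.m.p. groupoid and let $\Omega$ be a generating subset of $I_{\mathscr G}$. Then $s(\mathscr G)=s(\Omega)$ and $\underline s(\mathscr G)=\underline s(\Omega)$.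 -/

import Mathlib

open MeasureTheory Filter Set
open scoped ENNReal Pointwise

/-- A discrete measurable groupoid, given as the standard Borel space `G` of its arrows. The units
are arrows, `src` and `rng` take values in the units, and `mul x y` is meaningful only when
`src x = rng y`: no condition is imposed on the other values of `mul`. -/
structure DiscreteMeasurableGroupoid (G : Type*) [MeasurableSpace G] where
  src : G → G
  rng : G → G
  mul : G → G → G
  inv : G → G
  src_src : ∀ x, src (src x) = src x
  rng_src : ∀ x, rng (src x) = src x
  src_rng : ∀ x, src (rng x) = rng x
  rng_rng : ∀ x, rng (rng x) = rng x
  src_mul : ∀ x y, src x = rng y → src (mul x y) = src y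
  rng_mul : ∀ x y, src x = rng y → rng (mul x y) = rng x
  mul_assoc : ∀ x y z, src x = rng y → src y = rng z → mul (mul x y) z = mul x (mul y z)
  mul_src : ∀ x, mul x (src x) = x
  rng_mul_self : ∀ x, mul (rng x) x = x
  src_inv : ∀ x, src (inv x) = rng x
  rng_inv : ∀ x, rng (inv x) = src x
  mul_inv : ∀ x, mul x (inv x) = rng x
  inv_mul : ∀ x, mul (inv x) x = src x
  measurable_src : Measurable src
  measurable_rng : Measurable rng
  measurable_inv : Measurable inv
  measurable_mul :
    Measurable fun p : {p : G × G // src p.1 = rng p.2} => mul p.1.1 p.1.2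
  measurableSet_units : MeasurableSet {x | src x = x}
  countable_src_fiber : ∀ x, src x = x → (src ⁻¹' {x}).Countable

/-- A probability-measure-preserving groupoid. The Borel probability measure on the unit space is
given as a Borel probability measure on `G` that is carried by the units. -/
structure PMPGroupoid (G : Type*) [MeasurableSpace G] extends DiscreteMeasurableGroupoid G where
  μ : Measure G
  isProbabilityMeasure : IsProbabilityMeasure μ
  μ_compl_units : μ {x | src x = x}ᶜ = 0
  measure_preserving : ∀ B : Set G, MeasurableSet B →
    ∫⁻ x, ((src ⁻¹' {x} ∩ B).encard : ℝ≥0∞) ∂μ = ∫⁻ x, ((rng ⁻¹' {x} ∩ B).encard : ℝ≥0∞) ∂μ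

namespace PMPGroupoid

variable {G : Type*} [MeasurableSpace G] (𝒢 : PMPGroupoid G)

/-- The unit space. -/
def units : Set G := {x | 𝒢.src x = x}

/-- The filter of subsets of `G` that are conull for the measure
`B ↦ ∫ |src⁻¹ {x} ∩ B| dμ(x)` on `G`: a set is null for it exactly when the fibre of `src` over `x`
misses the set, for `μ`-almost every unit `x`. -/
def aeArrows : Filter G := (ae 𝒢.μ).comap 𝒢.src

/-- Complex functions on `G`, identified when they agree almost everywhere. -/
abbrev Fun : Type _ := Germ 𝒢.aeArrows ℂ

/-- Borel subsets of `G` on which source and range are injective. -/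
structure Bisection where
  carrier : Set G
  measurableSet : MeasurableSet carrier
  injOn_src : InjOn 𝒢.src carrier
  injOn_rng : InjOn 𝒢.rng carrier

/-- Equality almost everywhere of bisections. -/
instance bisectionSetoid : Setoid 𝒢.Bisection where
  r B C := B.carrier =ᶠ[𝒢.aeArrows] C.carrier
  iseqv := ⟨fun _ => EventuallyEq.rfl, fun h => h.symm, fun h h' => h.trans h'⟩

/-- The inverse semigroup `I_𝒢` of partial isometries: the partial isometry `s_B` of a bisection `B`
is recorded as the class of `B` (or of its characteristic function) modulo null sets. -/
def PartialIsom : Type _ := Quotient 𝒢.bisectionSetoid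

variable {𝒢}

theorem src_mem_units (x : G) : 𝒢.src x ∈ 𝒢.units := 𝒢.src_src x

theorem ae_units : ∀ᵐ x ∂𝒢.μ, x ∈ 𝒢.units := 𝒢.μ_compl_units

theorem mul_inv_cancel_right (x y : G) (h : 𝒢.src x = 𝒢.rng y) :
    𝒢.mul (𝒢.mul x y) (𝒢.inv y) = x := by
  rw [𝒢.mul_assoc x y _ h (𝒢.rng_inv y).symm, 𝒢.mul_inv, ← h, 𝒢.mul_src]

theorem mul_inv_cancel_left (x y : G) (h : 𝒢.src x = 𝒢.rng y) :
    𝒢.mul (𝒢.inv x) (𝒢.mul x y) = y := by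
  rw [← 𝒢.mul_assoc _ x y (𝒢.src_inv x) h, 𝒢.inv_mul, h, 𝒢.rng_mul_self]

theorem inv_inv (x : G) : 𝒢.inv (𝒢.inv x) = x := by
  have h : 𝒢.src x = 𝒢.rng (𝒢.inv x) := (𝒢.rng_inv x).symm
  have := mul_inv_cancel_right x (𝒢.inv x) h
  rwa [𝒢.mul_inv, ← 𝒢.src_inv, ← 𝒢.rng_inv (𝒢.inv x), 𝒢.rng_mul_self] at this

theorem src_unit {x : G} (hx : x ∈ 𝒢.units) : 𝒢.src x = x := hx

theorem rng_unit {x : G} (hx : x ∈ 𝒢.units) : 𝒢.rng x = x := by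
  rw [← src_unit hx, 𝒢.rng_src, src_unit hx]

theorem Bisection.equiv_iff {B C : 𝒢.Bisection} :
    B ≈ C ↔ ∀ᶠ z in 𝒢.aeArrows, (z ∈ B.carrier ↔ z ∈ C.carrier) :=
  eventuallyEq_set

theorem exists_ae_of_eventually {P : G → Prop} (h : ∀ᶠ z in 𝒢.aeArrows, P z) :
    ∀ᵐ x ∂𝒢.μ, ∀ z, 𝒢.src z = x → P z := by
  obtain ⟨T, hT, hTP⟩ := h
  filter_upwards [hT] with x hx z hz
  exact hTP (show 𝒢.src z ∈ T from hz ▸ hx)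

theorem ae_eq_of_eventuallyEq {a b : G → ℂ} (h : a =ᶠ[𝒢.aeArrows] b) : a =ᵐ[𝒢.μ] b := by
  filter_upwards [exists_ae_of_eventually h, ae_units (𝒢 := 𝒢)] with x hx hu
  exact hx x hu

variable [StandardBorelSpace G]

theorem lintegral_encard_fiber {f : G → G} (hf : Measurable f) {B : Set G} (hB : MeasurableSet B)
    (hinj : InjOn f B) :
    ∫⁻ x, ((f ⁻¹' {x} ∩ B).encard : ℝ≥0∞) ∂𝒢.μ = 𝒢.μ (f '' B) := by
  rw [← lintegral_indicator_one (hB.image_of_measurable_injOn hf hinj)]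
  refine lintegral_congr fun x => ?_
  by_cases hx : x ∈ f '' B
  · obtain ⟨y, hy, rfl⟩ := hx
    have : f ⁻¹' {f y} ∩ B = {y} := by
      ext z
      simp only [mem_inter_iff, mem_preimage, mem_singleton_iff]
      exact ⟨fun h => hinj h.2 hy h.1, fun h => by subst h; exact ⟨rfl, hy⟩⟩
    rw [this, indicator_of_mem (mem_image_of_mem f hy)]
    simp
  · have : f ⁻¹' {x} ∩ B = ∅ := by
      ext z
      simp only [mem_inter_iff, mem_preimage, mem_singleton_iff, mem_empty_iff_false, iff_false]
      exact fun h => hx ⟨z, h.2, h.1⟩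
    rw [this, indicator_of_notMem hx]
    simp

theorem Bisection.measure_src_eq_rng (B : 𝒢.Bisection) :
    𝒢.μ (𝒢.src '' B.carrier) = 𝒢.μ (𝒢.rng '' B.carrier) := by
  rw [← lintegral_encard_fiber 𝒢.measurable_src B.measurableSet B.injOn_src,
    ← lintegral_encard_fiber 𝒢.measurable_rng B.measurableSet B.injOn_rng]
  exact 𝒢.measure_preserving _ B.measurableSet

/-- A property that holds at almost every unit holds at the range of almost every arrow of a
bisection. -/
theorem Bisection.eventually_rng (B : 𝒢.Bisection) {P : G → Prop} (hP : ∀ᵐ x ∂𝒢.μ, P x) :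
    ∀ᶠ z in 𝒢.aeArrows, z ∈ B.carrier → P (𝒢.rng z) := by
  obtain ⟨N, hN, hNm, hN0⟩ := exists_measurable_superset_of_null (ae_iff.1 hP)
  let C : 𝒢.Bisection :=
    ⟨B.carrier ∩ 𝒢.rng ⁻¹' N, B.measurableSet.inter (𝒢.measurable_rng hNm),
      B.injOn_src.mono inter_subset_left, B.injOn_rng.mono inter_subset_left⟩
  have hC : 𝒢.μ (𝒢.src '' C.carrier) = 0 := by
    rw [C.measure_src_eq_rng]
    refine measure_mono_null ?_ hN0
    rintro _ ⟨z, hz, rfl⟩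
    exact hz.2
  have hae : ∀ᵐ x ∂𝒢.μ, x ∉ 𝒢.src '' C.carrier := measure_eq_zero_iff_ae_notMem.1 hC
  filter_upwards [tendsto_comap.eventually hae] with z hz hzB
  by_contra hPz
  exact hz ⟨z, ⟨hzB, hN hPz⟩, rfl⟩

/-- The bisection `{x y : x ∈ B, y ∈ C, src x = rng y}`, so that `s_B s_C = s_{BC}`. -/
def Bisection.mul (B C : 𝒢.Bisection) : 𝒢.Bisection where
  carrier := {z | ∃ x ∈ B.carrier, ∃ y ∈ C.carrier, 𝒢.src x = 𝒢.rng y ∧ 𝒢.mul x y = z}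
  measurableSet := by
    have hc : MeasurableSet {p : G × G | 𝒢.src p.1 = 𝒢.rng p.2} :=
      measurableSet_eq_fun (𝒢.measurable_src.comp measurable_fst)
        (𝒢.measurable_rng.comp measurable_snd)
    have : StandardBorelSpace {p : G × G // 𝒢.src p.1 = 𝒢.rng p.2} := hc.standardBorel
    have hS : MeasurableSet {p : {p : G × G // 𝒢.src p.1 = 𝒢.rng p.2} |
        p.1.1 ∈ B.carrier ∧ p.1.2 ∈ C.carrier} :=
      ((measurable_fst.comp measurable_subtype_coe) B.measurableSet).inter
        ((measurable_snd.comp measurable_subtype_coe) C.measurableSet)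
    convert hS.image_of_measurable_injOn 𝒢.measurable_mul ?_ using 1
    · ext z
      constructor
      · rintro ⟨x, hx, y, hy, h, rfl⟩
        exact ⟨⟨(x, y), h⟩, ⟨hx, hy⟩, rfl⟩
      · rintro ⟨⟨⟨x, y⟩, h⟩, ⟨hx, hy⟩, rfl⟩
        exact ⟨x, hx, y, hy, h, rfl⟩
    · rintro ⟨⟨x, y⟩, h⟩ ⟨hx, hy⟩ ⟨⟨x', y'⟩, h'⟩ ⟨hx', hy'⟩ heq
      simp only at h h' hx hy hx' hy' heq
      have h1 : x = x' := B.injOn_rng hx hx' (by rw [← 𝒢.rng_mul x y h, heq, 𝒢.rng_mul x' y' h'])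
      have h2 : y = y' := C.injOn_src hy hy' (by rw [← 𝒢.src_mul x y h, heq, 𝒢.src_mul x' y' h'])
      subst h1; subst h2; rfl
  injOn_src := by
    rintro _ ⟨x, hx, y, hy, h, rfl⟩ _ ⟨x', hx', y', hy', h', rfl⟩ heq
    rw [𝒢.src_mul x y h, 𝒢.src_mul x' y' h'] at heq
    obtain rfl := C.injOn_src hy hy' heq
    obtain rfl := B.injOn_src hx hx' (h.trans h'.symm)
    rfl
  injOn_rng := by
    rintro _ ⟨x, hx, y, hy, h, rfl⟩ _ ⟨x', hx', y', hy', h', rfl⟩ heq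
    rw [𝒢.rng_mul x y h, 𝒢.rng_mul x' y' h'] at heq
    obtain rfl := B.injOn_rng hx hx' heq
    obtain rfl := C.injOn_rng hy hy' (h.symm.trans h')
    rfl

/-- The bisection of the inverses of the elements of `B`, so that `s_B^*` is its partial
isometry. -/
def Bisection.inv (B : 𝒢.Bisection) : 𝒢.Bisection where
  carrier := 𝒢.inv ⁻¹' B.carrier
  measurableSet := 𝒢.measurable_inv B.measurableSet
  injOn_src := by
    intro x hx y hy h
    rw [← inv_inv (𝒢 := 𝒢) x, ← inv_inv (𝒢 := 𝒢) y,
      B.injOn_rng hx hy (by rw [𝒢.rng_inv, 𝒢.rng_inv, h])]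
  injOn_rng := by
    intro x hx y hy h
    rw [← inv_inv (𝒢 := 𝒢) x, ← inv_inv (𝒢 := 𝒢) y,
      B.injOn_src hx hy (by rw [𝒢.src_inv, 𝒢.src_inv, h])]

/-- The unit space as a bisection. -/
def Bisection.one : 𝒢.Bisection where
  carrier := 𝒢.units
  measurableSet := 𝒢.measurableSet_units
  injOn_src := fun x hx y hy h => by rwa [src_unit hx, src_unit hy] at h
  injOn_rng := fun x hx y hy h => by rwa [rng_unit hx, rng_unit hy] at h

theorem Bisection.mul_mem_of_equiv {B B' C C' : 𝒢.Bisection} (hB : B ≈ B') (hC : C ≈ C') :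
    ∀ᶠ z in 𝒢.aeArrows, z ∈ (B.mul C).carrier → z ∈ (B'.mul C').carrier := by
  have h1 := exists_ae_of_eventually (Bisection.equiv_iff.1 hB)
  have h2 := exists_ae_of_eventually (Bisection.equiv_iff.1 hC)
  have h3 := exists_ae_of_eventually (C.eventually_rng h1)
  filter_upwards [tendsto_comap.eventually h2, tendsto_comap.eventually h3] with z hz2 hz3
  rintro ⟨x, hx, y, hy, h, rfl⟩
  have hs := 𝒢.src_mul x y h
  exact ⟨x, (hz3 y hs.symm hy x h).1 hx, y, (hz2 y hs.symm).1 hy, h, rfl⟩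

theorem Bisection.mul_congr {B B' C C' : 𝒢.Bisection} (hB : B ≈ B') (hC : C ≈ C') :
    B.mul C ≈ B'.mul C' := by
  rw [Bisection.equiv_iff]
  filter_upwards [mul_mem_of_equiv hB hC, mul_mem_of_equiv (Setoid.symm hB) (Setoid.symm hC)]
    with z h1 h2
  exact ⟨h1, h2⟩

theorem Bisection.inv_congr {B C : 𝒢.Bisection} (h : B ≈ C) : B.inv ≈ C.inv := by
  have h1 := exists_ae_of_eventually (Bisection.equiv_iff.1 h)
  rw [Bisection.equiv_iff]
  filter_upwards [B.inv.eventually_rng h1, C.inv.eventually_rng h1] with z hB hC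
  exact ⟨fun hz => (hB hz _ (𝒢.src_inv z)).1 hz, fun hz => (hC hz _ (𝒢.src_inv z)).2 hz⟩

theorem Bisection.mul_assoc' (B C D : 𝒢.Bisection) : (B.mul C).mul D = B.mul (C.mul D) := by
  have : ((B.mul C).mul D).carrier = (B.mul (C.mul D)).carrier := by
    ext w
    constructor
    · rintro ⟨_, ⟨x, hx, y, hy, h, rfl⟩, z, hz, h', rfl⟩
      rw [𝒢.src_mul x y h] at h'
      exact ⟨x, hx, _, ⟨y, hy, z, hz, h', rfl⟩, by rw [𝒢.rng_mul y z h', h],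
        (𝒢.mul_assoc x y z h h').symm⟩
    · rintro ⟨x, hx, _, ⟨y, hy, z, hz, h', rfl⟩, h, rfl⟩
      rw [𝒢.rng_mul y z h'] at h
      exact ⟨_, ⟨x, hx, y, hy, h, rfl⟩, z, hz, by rw [𝒢.src_mul x y h, h'],
        𝒢.mul_assoc x y z h h'⟩
  cases h1 : (B.mul C).mul D
  cases h2 : B.mul (C.mul D)
  simp_all

theorem Bisection.one_mul' (B : 𝒢.Bisection) : Bisection.one.mul B ≈ B := by
  rw [Bisection.equiv_iff]
  refine Eventually.of_forall fun z => ⟨?_, fun hz => ?_⟩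
  · rintro ⟨x, hx, y, hy, h, rfl⟩
    rw [src_unit hx] at h
    rwa [h, 𝒢.rng_mul_self]
  · exact ⟨𝒢.rng z, 𝒢.src_rng z, z, hz, 𝒢.src_rng z, 𝒢.rng_mul_self z⟩

theorem Bisection.mul_one' (B : 𝒢.Bisection) : B.mul Bisection.one ≈ B := by
  rw [Bisection.equiv_iff]
  refine Eventually.of_forall fun z => ⟨?_, fun hz => ?_⟩
  · rintro ⟨x, hx, y, hy, h, rfl⟩
    rw [rng_unit hy] at h
    rwa [← h, 𝒢.mul_src]
  · exact ⟨z, hz, 𝒢.src z, 𝒢.src_src z, (𝒢.rng_src z).symm, 𝒢.mul_src z⟩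

/-- `I_𝒢` is a monoid, with the unit space as the identity. -/
instance : Monoid 𝒢.PartialIsom where
  mul := Quotient.map₂ Bisection.mul fun _ _ hB _ _ hC => Bisection.mul_congr hB hC
  one := Quotient.mk _ Bisection.one
  mul_assoc := by
    rintro ⟨B⟩ ⟨C⟩ ⟨D⟩
    exact congrArg (Quotient.mk _) (Bisection.mul_assoc' B C D)
  one_mul := by
    rintro ⟨B⟩
    exact Quotient.sound (Bisection.one_mul' B)
  mul_one := by
    rintro ⟨B⟩
    exact Quotient.sound (Bisection.mul_one' B)

/-- The adjoint on `I_𝒢`. -/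
instance : InvolutiveStar 𝒢.PartialIsom where
  star := Quotient.map Bisection.inv fun _ _ h => Bisection.inv_congr h
  star_involutive := by
    rintro ⟨B⟩
    refine Quotient.sound (Bisection.equiv_iff.2 (Eventually.of_forall fun z => ?_))
    change 𝒢.inv (𝒢.inv z) ∈ B.carrier ↔ z ∈ B.carrier
    rw [inv_inv]


/-- The characteristic function of an element of `I_𝒢`. -/
noncomputable def PartialIsom.ind : 𝒢.PartialIsom → 𝒢.Fun :=
  Quotient.lift (fun B : 𝒢.Bisection => ((B.carrier.indicator 1 : G → ℂ) : 𝒢.Fun)) fun B C h =>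
    Germ.coe_eq.2 <| (Bisection.equiv_iff.1 h).mono fun z hz => by
      by_cases hB : z ∈ B.carrier
      · simp [hB, hz.1 hB]
      · simp [hB, show z ∉ C.carrier from fun hC => hB (hz.2 hC)]

/-- The trace `τ(a) = ∫ a dμ` over the unit space. -/
noncomputable def trace (a : 𝒢.Fun) : ℂ :=
  a.liftOn (fun a => ∫ x, a x ∂𝒢.μ) fun _ _ h => integral_congr_ae (ae_eq_of_eventuallyEq h)

/-- The `2`-norm `τ(a^* a)^{1/2}`, which is the norm of the function `a` in `L^2(𝒢, μ)`. -/
noncomputable def twoNorm (a : 𝒢.Fun) : ℝ≥0∞ :=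
  a.liftOn (fun a => (∫⁻ x, ∑' y : 𝒢.src ⁻¹' {x}, ‖a y‖ₑ ^ 2 ∂𝒢.μ) ^ (1 / 2 : ℝ)) fun a b h => by
    refine congrArg (· ^ (1 / 2 : ℝ)) (lintegral_congr_ae ?_)
    filter_upwards [exists_ae_of_eventually h] with x hx
    exact tsum_congr fun y => by rw [hx y y.2]

variable (𝒢) in
/-- `[I_𝒢]`, the linear span of `I_𝒢`. -/
abbrev Span : Submodule ℂ 𝒢.Fun := Submodule.span ℂ (range (PartialIsom.ind (𝒢 := 𝒢)))

/-- An element of `I_𝒢` as an element of its linear span. -/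
noncomputable def PartialIsom.toSpan (s : 𝒢.PartialIsom) : 𝒢.Span :=
  ⟨s.ind, Submodule.subset_span (mem_range_self s)⟩

/-- `I(Ω)`: the elements of `I_𝒢` that are finite sums of elements of `Ω`. -/
def finiteSums (Ω : Set 𝒢.PartialIsom) : Set 𝒢.PartialIsom :=
  {s | s.ind ∈ AddSubmonoid.closure (PartialIsom.ind '' Ω)}

/-- `Ω` is generating if the set `I` of finite sums of products of elements of `Ω ∪ Ω^*` is dense in
`I_𝒢` for the `2`-norm and contains `1 - p` for every projection `p` in `I`. -/
def IsGenerating (Ω : Set 𝒢.PartialIsom) : Prop :=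
  (∀ s : 𝒢.PartialIsom, ∀ ε : ℝ≥0∞, 0 < ε →
    ∃ t ∈ finiteSums (⋃ n ≥ 1, (Ω ∪ star Ω) ^ n), twoNorm (s.ind - t.ind) < ε) ∧
  ∀ p ∈ finiteSums (⋃ n ≥ 1, (Ω ∪ star Ω) ^ n), IsStarProjection p →
    ∃ q ∈ finiteSums (⋃ n ≥ 1, (Ω ∪ star Ω) ^ n), q.ind = (1 : 𝒢.PartialIsom).ind - p.ind

end PMPGroupoid

/-- The partial permutation matrices in `M_d`. -/
def partialPermMatrices (d : ℕ) : Set (Matrix (Fin d) (Fin d) ℂ) :=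
  range fun f : Fin d ≃. Fin d => f.toMatrix

/-- The tracial state on `M_d`. -/
noncomputable def normalizedTrace {d : ℕ} (A : Matrix (Fin d) (Fin d) ℂ) : ℂ := A.trace / d

/-- The `2`-norm `tr(A^* A)^{1/2}` on `M_d`. -/
noncomputable def matrixTwoNorm {d : ℕ} (A : Matrix (Fin d) (Fin d) ℂ) : ℝ :=
  √(normalizedTrace (A.conjTranspose * A)).re

namespace PMPGroupoid

variable {G : Type*} [MeasurableSpace G] [StandardBorelSpace G] {𝒢 : PMPGroupoid G}

/-- `(F, n, δ)`-approximately multiplicative linear maps `[I_𝒢] → M_d`. -/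
def IsApproxMultiplicative (F : Set 𝒢.PartialIsom) (n : ℕ) (δ : ℝ) {d : ℕ}
    (φ : 𝒢.Span →ₗ[ℂ] Matrix (Fin d) (Fin d) ℂ) : Prop :=
  ∀ k, 1 ≤ k → k ≤ n → ∀ s : Fin k → 𝒢.PartialIsom, (∀ i, s i ∈ F) →
    matrixTwoNorm (φ (List.ofFn s).prod.toSpan - (List.ofFn fun i => φ (s i).toSpan).prod) < δ

/-- The set `SA(F, n, δ, d)` of approximate models of `𝒢` on `d` points. -/
def SA (F : Set 𝒢.PartialIsom) (n : ℕ) (δ : ℝ) (d : ℕ) :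
    Set (𝒢.Span →ₗ[ℂ] Matrix (Fin d) (Fin d) ℂ) :=
  {φ | IsApproxMultiplicative (F ∪ star F) n δ φ ∧
    ∀ k, 1 ≤ k → k ≤ n → ∀ s ∈ (F ∪ star F) ^ k,
      φ s.toSpan ∈ partialPermMatrices d ∧ ‖normalizedTrace (φ s.toSpan) - trace s.ind‖ < δ}

/-- `|SA(F, n, δ, d)|_E`: the number of restrictions to `E` of elements of `SA(F, n, δ, d)`. -/
noncomputable def cardSA (E F : Set 𝒢.PartialIsom) (n : ℕ) (δ : ℝ) (d : ℕ) : ℕ∞ :=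
  ((fun φ (s : E) => φ s.1.toSpan) '' SA F n δ d).encard

/-- `log |SA(F, n, δ, d)|_E / (d log d)`, which is `-∞` when `SA(F, n, δ, d)` is empty. -/
noncomputable def rate (E F : Set 𝒢.PartialIsom) (n : ℕ) (δ : ℝ) (d : ℕ) : EReal :=
  ENNReal.log (cardSA E F n δ d) / ((d * Real.log d : ℝ) : EReal)

/-- `s(Ω)`. -/
noncomputable def soficDimOn (Ω : Set 𝒢.PartialIsom) : EReal :=
  ⨆ (E : Set 𝒢.PartialIsom) (_ : E.Finite ∧ E ⊆ Ω),
    ⨅ (F : Set 𝒢.PartialIsom) (_ : F.Finite ∧ F ⊆ Ω),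
      ⨅ (n : ℕ) (_ : 1 ≤ n), ⨅ (δ : ℝ) (_ : 0 < δ), limsup (rate E F n δ) atTop

/-- The lower variant of `s(Ω)`. -/
noncomputable def lowerSoficDimOn (Ω : Set 𝒢.PartialIsom) : EReal :=
  ⨆ (E : Set 𝒢.PartialIsom) (_ : E.Finite ∧ E ⊆ Ω),
    ⨅ (F : Set 𝒢.PartialIsom) (_ : F.Finite ∧ F ⊆ Ω),
      ⨅ (n : ℕ) (_ : 1 ≤ n), ⨅ (δ : ℝ) (_ : 0 < δ), liminf (rate E F n δ) atTop

variable (𝒢)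

/-- The sofic dimension `s(𝒢) = s(I_𝒢)`. -/
noncomputable def soficDim : EReal := soficDimOn (univ : Set 𝒢.PartialIsom)

/-- The lower sofic dimension of `𝒢`. -/
noncomputable def lowerSoficDim : EReal := lowerSoficDimOn (univ : Set 𝒢.PartialIsom)

end PMPGroupoid

/-! Two partial permutation matrices of size d at 2-distance at most ε differ in at most ε²d
entries. Hence a family of partial permutations of diameter ε has at most (d²+1)^(ε²d) members, and
on the scale d log d such a factor costs at most 3ε² (`encard_le_of_matrixTwoNorm_sub_le`,
`eventually_rate_le`). Restrictions of models therefore need to be compared only up to small 2-norm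
errors. `ModelsLift` records such a comparison, and `iSup_iInf_le_of_modelsLift` turns it into an
inequality of dimensions, for limsup and liminf alike.

For s(𝒢) ≤ s(Ω) (`modelsLift_univ_left`), each s in E is 2-norm close to a finite sum t of words in
Ω ∪ Ω*. A good model φ of 𝒢 asymptotically does not increase 2-norms, so φ(s) is close to φ(t). By
approximate multiplicativity φ(t) is nearly determined by the values of φ at the finitely many
letters of t.

For s(Ω) ≤ s(𝒢) (`eventually_exists_mem_SA`, `modelsLift_univ_right`), a good model on Ω has to be
replaced by a model on an arbitrary finite F, nearly unchanged on E. The words of length at most n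
in F ∪ F* are cut into finitely many disjoint non-null atoms A_i (`exists_atoms`), and each A_i is
approximated by a sum t_i of words in Ω ∪ Ω*. The given model sends t_i close to a partial
permutation. Deleting a few rows and columns makes these matrices exactly orthogonal whenever their
atoms lie in a common word (`exists_orthogonal_rounding`). The atoms are linearly independent, so
the resulting matrices P_i are the values at A_i of a linear map, which sends every word considered
to a partial permutation.

Both halves rest on asymptotic facts along `modelFilter`, which absorbs the quantifiers over F, n
and δ. Models respect adjoints, because s s* s = s forces φ(s*) to be close to φ(s)*
(`matrixTwoNorm_sub_conjTranspose_sq_le`). They preserve the inner products τ(s*t), hence 2-norms of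
linear combinations (`AsymptoticModel.eventually_matrixTwoNorm_lt`). -/

open scoped Matrix

set_option linter.unusedSectionVars false

/-! ### The normalized trace and 2-norm on matrices. -/

section MatrixTwoNorm

variable {d : ℕ}

theorem matrixTwoNorm_sq (A : Matrix (Fin d) (Fin d) ℂ) :
    matrixTwoNorm A ^ 2 = (∑ i, ∑ j, ‖A i j‖ ^ 2) / d := by
  have h : (normalizedTrace (A.conjTranspose * A)).re = (∑ i, ∑ j, ‖A i j‖ ^ 2) / d := by
    rw [normalizedTrace, Complex.div_natCast_re, Matrix.trace, Complex.re_sum, Finset.sum_comm]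
    congr 1
    refine Finset.sum_congr rfl fun j _ => ?_
    rw [Matrix.diag_apply, Matrix.mul_apply, Complex.re_sum]
    refine Finset.sum_congr rfl fun i _ => ?_
    rw [Matrix.conjTranspose_apply, RCLike.star_def, Complex.conj_mul', ← Complex.ofReal_pow,
      Complex.ofReal_re]
  rw [matrixTwoNorm, Real.sq_sqrt (by rw [h]; positivity), h]

theorem matrixTwoNorm_nonneg (A : Matrix (Fin d) (Fin d) ℂ) : 0 ≤ matrixTwoNorm A :=
  Real.sqrt_nonneg _

section Frobenius

open scoped Matrix.Norms.Frobenius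

/-- This imports the triangle inequality and the invariance under adjoints from the Frobenius norm.
For d = 0 both sides vanish. -/
theorem matrixTwoNorm_eq_frobenius (A : Matrix (Fin d) (Fin d) ℂ) :
    matrixTwoNorm A = ‖A‖ / √d := by
  have h : ‖A‖ ^ 2 = ∑ i, ∑ j, ‖A i j‖ ^ 2 := by
    rw [Matrix.frobenius_norm_def, ← Real.sqrt_eq_rpow, Real.sq_sqrt (by positivity)]
    simp
  rw [← Real.sqrt_sq (matrixTwoNorm_nonneg A), matrixTwoNorm_sq, ← h,
    Real.sqrt_div' _ (Nat.cast_nonneg d), Real.sqrt_sq (norm_nonneg A)]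

theorem matrixTwoNorm_zero : matrixTwoNorm (0 : Matrix (Fin d) (Fin d) ℂ) = 0 := by
  simp [matrixTwoNorm_eq_frobenius]

theorem matrixTwoNorm_neg (A : Matrix (Fin d) (Fin d) ℂ) :
    matrixTwoNorm (-A) = matrixTwoNorm A := by
  simp [matrixTwoNorm_eq_frobenius]

theorem matrixTwoNorm_sub_comm (A B : Matrix (Fin d) (Fin d) ℂ) :
    matrixTwoNorm (A - B) = matrixTwoNorm (B - A) := by
  rw [← matrixTwoNorm_neg, neg_sub]

theorem matrixTwoNorm_conjTranspose (A : Matrix (Fin d) (Fin d) ℂ) :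
    matrixTwoNorm Aᴴ = matrixTwoNorm A := by
  simp [matrixTwoNorm_eq_frobenius]

theorem matrixTwoNorm_add_le (A B : Matrix (Fin d) (Fin d) ℂ) :
    matrixTwoNorm (A + B) ≤ matrixTwoNorm A + matrixTwoNorm B := by
  simp only [matrixTwoNorm_eq_frobenius, ← add_div]
  gcongr
  exact norm_add_le A B

theorem matrixTwoNorm_sub_le (A B C : Matrix (Fin d) (Fin d) ℂ) :
    matrixTwoNorm (A - C) ≤ matrixTwoNorm (A - B) + matrixTwoNorm (B - C) := by
  simpa using matrixTwoNorm_add_le (A - B) (B - C)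

theorem matrixTwoNorm_le_add_sub (A B : Matrix (Fin d) (Fin d) ℂ) :
    matrixTwoNorm A ≤ matrixTwoNorm B + matrixTwoNorm (A - B) := by
  simpa using matrixTwoNorm_add_le B (A - B)

theorem matrixTwoNorm_sum_le {ι : Type*} (s : Finset ι) (A : ι → Matrix (Fin d) (Fin d) ℂ) :
    matrixTwoNorm (∑ i ∈ s, A i) ≤ ∑ i ∈ s, matrixTwoNorm (A i) := by
  simp only [matrixTwoNorm_eq_frobenius, ← Finset.sum_div]
  gcongr
  exact norm_sum_le s A

end Frobenius

theorem norm_normalizedTrace_le (A : Matrix (Fin d) (Fin d) ℂ) :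
    ‖normalizedTrace A‖ ≤ matrixTwoNorm A := by
  refine le_of_sq_le_sq ?_ (matrixTwoNorm_nonneg A)
  rcases Nat.eq_zero_or_pos d with rfl | hd
  · simp [normalizedTrace, matrixTwoNorm_nonneg]
  have hd' : (0 : ℝ) < d := Nat.cast_pos.2 hd
  rw [matrixTwoNorm_sq, normalizedTrace, norm_div, div_pow, Complex.norm_natCast,
    div_le_div_iff₀ (by positivity) hd']
  have h1 : ‖A.trace‖ ≤ ∑ i, ‖A i i‖ := norm_sum_le _ _
  have h2 : (∑ i, ‖A i i‖) ^ 2 ≤ d * ∑ i, ‖A i i‖ ^ 2 := by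
    simpa using sq_sum_le_card_mul_sum_sq (s := Finset.univ) (f := fun i => ‖A i i‖)
  have h3 : ∑ i, ‖A i i‖ ^ 2 ≤ ∑ i, ∑ j, ‖A i j‖ ^ 2 :=
    Finset.sum_le_sum fun i _ =>
      Finset.single_le_sum (f := fun j => ‖A i j‖ ^ 2) (fun j _ => by positivity)
        (Finset.mem_univ i)
  have h4 : ‖A.trace‖ ^ 2 ≤ d * ∑ i, ∑ j, ‖A i j‖ ^ 2 :=
    (pow_le_pow_left₀ (norm_nonneg _) h1 2).trans
      (h2.trans (mul_le_mul_of_nonneg_left h3 hd'.le))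
  nlinarith

theorem normalizedTrace_add (A B : Matrix (Fin d) (Fin d) ℂ) :
    normalizedTrace (A + B) = normalizedTrace A + normalizedTrace B := by
  simp [normalizedTrace, add_div]

theorem normalizedTrace_sub (A B : Matrix (Fin d) (Fin d) ℂ) :
    normalizedTrace (A - B) = normalizedTrace A - normalizedTrace B := by
  simp [normalizedTrace, sub_div]

theorem normalizedTrace_sum {ι : Type*} (s : Finset ι) (A : ι → Matrix (Fin d) (Fin d) ℂ) :
    normalizedTrace (∑ i ∈ s, A i) = ∑ i ∈ s, normalizedTrace (A i) := by
  simp [normalizedTrace, Finset.sum_div]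

theorem normalizedTrace_smul (c : ℂ) (A : Matrix (Fin d) (Fin d) ℂ) :
    normalizedTrace (c • A) = c * normalizedTrace A := by
  simp [normalizedTrace, mul_div_assoc]

theorem normalizedTrace_mul_comm (A B : Matrix (Fin d) (Fin d) ℂ) :
    normalizedTrace (A * B) = normalizedTrace (B * A) := by
  rw [normalizedTrace, Matrix.trace_mul_comm, normalizedTrace]

theorem normalizedTrace_conjTranspose (A : Matrix (Fin d) (Fin d) ℂ) :
    normalizedTrace Aᴴ = star (normalizedTrace A) := by
  simp [normalizedTrace]

theorem matrixTwoNorm_sq_eq_trace (A : Matrix (Fin d) (Fin d) ℂ) :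
    matrixTwoNorm A ^ 2 = (normalizedTrace (Aᴴ * A)).re := by
  have h : 0 ≤ (normalizedTrace (Aᴴ * A)).re := by
    -- A negative value would make the square root in `matrixTwoNorm` zero. The entrywise formula
    -- then forces A = 0, a contradiction.
    by_contra! h
    have h0 : matrixTwoNorm A = 0 := Real.sqrt_eq_zero_of_nonpos h.le
    have h1 := matrixTwoNorm_sq A
    rw [h0] at h1
    rcases Nat.eq_zero_or_pos d with rfl | hd
    · simp [normalizedTrace] at h
    have hd' : (0 : ℝ) < d := Nat.cast_pos.2 hd
    have h2 : ∑ i, ∑ j, ‖A i j‖ ^ 2 = 0 := by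
      field_simp at h1
      linarith
    have h3 : A = 0 := by
      ext i j
      have := (Finset.sum_eq_zero_iff_of_nonneg
        (fun i _ => Finset.sum_nonneg fun j _ => by positivity)).1 h2 i (Finset.mem_univ i)
      have := (Finset.sum_eq_zero_iff_of_nonneg (fun j _ => by positivity)).1 this j
        (Finset.mem_univ j)
      simpa using this
    simp [h3, normalizedTrace] at h
  rw [matrixTwoNorm, Real.sq_sqrt h]

end MatrixTwoNorm

/-! ### Partial permutation matrices. -/

section PartialPerm

variable {d : ℕ}

/-- The entrywise form is the convenient one for deleting rows and columns and for adding matrices.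
-/
theorem mem_partialPermMatrices_iff {A : Matrix (Fin d) (Fin d) ℂ} :
    A ∈ partialPermMatrices d ↔ (∀ i j, A i j = 0 ∨ A i j = 1) ∧
      (∀ i j j', A i j = 1 → A i j' = 1 → j = j') ∧
      (∀ i i' j, A i j = 1 → A i' j = 1 → i = i') := by
  classical
  constructor
  · rintro ⟨f, rfl⟩
    refine ⟨fun i j => ?_, fun i j j' h h' => ?_, fun i i' j h h' => ?_⟩
    · change f.toMatrix i j = 0 ∨ f.toMatrix i j = 1
      rw [PEquiv.toMatrix_apply]
      split_ifs <;> simp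
    · simp only [PEquiv.toMatrix_apply, ite_eq_left_iff, zero_ne_one, imp_false, not_not] at h h'
      exact Option.mem_unique h h'
    · simp only [PEquiv.toMatrix_apply, ite_eq_left_iff, zero_ne_one, imp_false, not_not] at h h'
      exact f.inj h h'
  · rintro ⟨h01, hr, hc⟩
    let f : Fin d ≃. Fin d :=
      { toFun := fun i => if h : ∃ j, A i j = 1 then some h.choose else none
        invFun := fun j => if h : ∃ i, A i j = 1 then some h.choose else none
        inv := fun i j => by
          simp only [Option.mem_def, Option.dite_none_right_eq_some, Option.some.injEq]
          constructor
          · rintro ⟨h, hi⟩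
            have h1 : A i j = 1 := hi ▸ h.choose_spec
            exact ⟨⟨j, h1⟩, hr _ _ _ (Exists.choose_spec (⟨j, h1⟩ : ∃ j', A i j' = 1)) h1⟩
          · rintro ⟨h, hj⟩
            have h1 : A i j = 1 := hj ▸ h.choose_spec
            exact ⟨⟨i, h1⟩, hc _ _ _ (Exists.choose_spec (⟨i, h1⟩ : ∃ i', A i' j = 1)) h1⟩ }
    refine ⟨f, ?_⟩
    ext i j
    have hf : j ∈ f i ↔ A i j = 1 := by
      change j ∈ (if h : ∃ j, A i j = 1 then some h.choose else none) ↔ _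
      simp only [Option.mem_def, Option.dite_none_right_eq_some, Option.some.injEq]
      constructor
      · rintro ⟨h, rfl⟩
        exact h.choose_spec
      · intro h
        exact ⟨⟨j, h⟩, hr _ _ _ (Exists.choose_spec (⟨j, h⟩ : ∃ j', A i j' = 1)) h⟩
    change f.toMatrix i j = A i j
    rw [PEquiv.toMatrix_apply]
    rcases h01 i j with h | h
    · rw [if_neg (by rw [hf, h]; exact zero_ne_one), h]
    · rw [if_pos (hf.2 h), h]

theorem zero_mem_partialPermMatrices : (0 : Matrix (Fin d) (Fin d) ℂ) ∈ partialPermMatrices d :=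
  ⟨⊥, PEquiv.toMatrix_bot⟩

theorem mul_mem_partialPermMatrices {A B : Matrix (Fin d) (Fin d) ℂ}
    (hA : A ∈ partialPermMatrices d) (hB : B ∈ partialPermMatrices d) :
    A * B ∈ partialPermMatrices d := by
  obtain ⟨f, rfl⟩ := hA
  obtain ⟨g, rfl⟩ := hB
  exact ⟨f.trans g, PEquiv.toMatrix_trans f g⟩

theorem conjTranspose_toMatrix (f : Fin d ≃. Fin d) :
    (f.toMatrix : Matrix (Fin d) (Fin d) ℂ)ᴴ = f.symm.toMatrix := by
  rw [PEquiv.toMatrix_symm]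
  ext i j
  simp only [Matrix.conjTranspose_apply, Matrix.transpose_apply, PEquiv.toMatrix_apply]
  split_ifs <;> simp

theorem conjTranspose_mem_partialPermMatrices {A : Matrix (Fin d) (Fin d) ℂ}
    (hA : A ∈ partialPermMatrices d) : Aᴴ ∈ partialPermMatrices d := by
  obtain ⟨f, rfl⟩ := hA
  exact ⟨f.symm, (conjTranspose_toMatrix f).symm⟩

theorem list_prod_mem_partialPermMatrices {l : List (Matrix (Fin d) (Fin d) ℂ)}
    (hl : ∀ A ∈ l, A ∈ partialPermMatrices d) : l.prod ∈ partialPermMatrices d := by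
  induction l with
  | nil => exact ⟨PEquiv.refl _, PEquiv.toMatrix_refl⟩
  | cons A l ih =>
    rw [List.prod_cons]
    exact mul_mem_partialPermMatrices (hl A (by simp)) (ih fun B hB => hl B (by simp [hB]))

/-- Each row of P A is zero or a row of A, and no row of A is used twice. -/
theorem matrixTwoNorm_mul_le_right {P : Matrix (Fin d) (Fin d) ℂ} (hP : P ∈ partialPermMatrices d)
    (A : Matrix (Fin d) (Fin d) ℂ) : matrixTwoNorm (P * A) ≤ matrixTwoNorm A := by
  classical
  refine le_of_sq_le_sq ?_ (matrixTwoNorm_nonneg A)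
  obtain ⟨f, rfl⟩ := hP
  rw [matrixTwoNorm_sq, matrixTwoNorm_sq]
  refine div_le_div_of_nonneg_right ?_ (Nat.cast_nonneg d)
  have h1 : ∀ i, ∑ j, ‖(f.toMatrix * A : Matrix (Fin d) (Fin d) ℂ) i j‖ ^ 2 =
      ∑ k, if k ∈ f i then ∑ j, ‖A k j‖ ^ 2 else 0 := by
    intro i
    simp only [PEquiv.toMatrix_mul_apply]
    cases h : f i <;> simp
  simp only [h1]
  rw [Finset.sum_comm]
  refine Finset.sum_le_sum fun k _ => ?_
  cases h : f.symm k with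
  | none =>
    have : ∀ i, k ∉ f i := fun i hi => by
      rw [← PEquiv.mem_iff_mem, h] at hi
      simp at hi
    simp only [this, if_false, Finset.sum_const_zero]
    positivity
  | some i' =>
    have : ∀ i, k ∈ f i ↔ i' = i := fun i => by
      rw [← PEquiv.mem_iff_mem, h]
      simp
    simp [this]

theorem matrixTwoNorm_mul_le_left {P : Matrix (Fin d) (Fin d) ℂ} (hP : P ∈ partialPermMatrices d)
    (A : Matrix (Fin d) (Fin d) ℂ) : matrixTwoNorm (A * P) ≤ matrixTwoNorm A := by
  rw [← matrixTwoNorm_conjTranspose, Matrix.conjTranspose_mul, ← matrixTwoNorm_conjTranspose A]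
  exact matrixTwoNorm_mul_le_right (conjTranspose_mem_partialPermMatrices hP) _

/-- In (P - P')Q' + P(Q - Q') only P and Q' act as multipliers, so only these two have to be
contractions. -/
theorem matrixTwoNorm_mul_sub_mul_le {P Q P' Q' : Matrix (Fin d) (Fin d) ℂ}
    (hP : P ∈ partialPermMatrices d) (hQ' : Q' ∈ partialPermMatrices d) :
    matrixTwoNorm (P * Q - P' * Q') ≤ matrixTwoNorm (P - P') + matrixTwoNorm (Q - Q') := by
  have h : P * Q - P' * Q' = (P - P') * Q' + P * (Q - Q') := by noncomm_ring
  rw [h]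
  exact (matrixTwoNorm_add_le _ _).trans
    (add_le_add (matrixTwoNorm_mul_le_left hQ' _) (matrixTwoNorm_mul_le_right hP _))

/-- P Pᴴ is a diagonal 0-1 matrix, so multiplying by it discards some diagonal entries of X, all of
which are nonnegative. -/
theorem re_normalizedTrace_mul_le {X P : Matrix (Fin d) (Fin d) ℂ}
    (hX : X ∈ partialPermMatrices d) (hP : P ∈ partialPermMatrices d) :
    (normalizedTrace (X * (P * Pᴴ))).re ≤ (normalizedTrace X).re := by
  classical
  obtain ⟨f, rfl⟩ := hP
  obtain ⟨hX, -⟩ := mem_partialPermMatrices_iff.1 hX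
  rw [conjTranspose_toMatrix, ← PEquiv.toMatrix_trans, PEquiv.self_trans_symm, normalizedTrace,
    normalizedTrace, Complex.div_natCast_re, Complex.div_natCast_re]
  refine div_le_div_of_nonneg_right ?_ (Nat.cast_nonneg d)
  rw [Matrix.trace, Matrix.trace, Complex.re_sum, Complex.re_sum]
  refine Finset.sum_le_sum fun i _ => ?_
  rw [Matrix.diag_apply, Matrix.diag_apply, PEquiv.mul_toMatrix_apply]
  have : 0 ≤ (X i i).re := by rcases hX i i with h | h <;> simp [h]
  cases h : (PEquiv.ofSet {a | (f a).isSome}).symm i with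
  | none => simpa using this
  | some k =>
    rw [PEquiv.ofSet_symm, ← Option.mem_def, PEquiv.mem_ofSet_iff] at h
    obtain ⟨rfl, -⟩ := h
    exact le_rfl

/-- An approximate form of the uniqueness of inverses in an inverse semigroup. Compressing the trace
of A B by A Aᴴ gives ‖A‖² ≤ Re tr(AB) + ‖ABA - A‖, and likewise for B. These are inserted into ‖B -
Aᴴ‖² = ‖A‖² + ‖B‖² - 2 Re tr(AB). -/
theorem matrixTwoNorm_sub_conjTranspose_sq_le {A B : Matrix (Fin d) (Fin d) ℂ}
    (hA : A ∈ partialPermMatrices d) (hB : B ∈ partialPermMatrices d) :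
    matrixTwoNorm (B - Aᴴ) ^ 2 ≤
      matrixTwoNorm (A * B * A - A) + matrixTwoNorm (B * A * B - B) := by
  have key : ∀ {A B : Matrix (Fin d) (Fin d) ℂ}, A ∈ partialPermMatrices d →
      B ∈ partialPermMatrices d →
      matrixTwoNorm A ^ 2 ≤ (normalizedTrace (A * B)).re + matrixTwoNorm (A * B * A - A) := by
    intro A B hA hB
    have h1 : matrixTwoNorm A ^ 2 = (normalizedTrace (A * B * (A * Aᴴ))).re -
        (normalizedTrace ((A * B * A - A) * Aᴴ)).re := by
      rw [matrixTwoNorm_sq_eq_trace, normalizedTrace_mul_comm, Matrix.sub_mul,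
        normalizedTrace_sub, Complex.sub_re, Matrix.mul_assoc (A * B)]
      ring
    have h2 : |(normalizedTrace ((A * B * A - A) * Aᴴ)).re| ≤ matrixTwoNorm (A * B * A - A) :=
      (Complex.abs_re_le_norm _).trans ((norm_normalizedTrace_le _).trans
        (matrixTwoNorm_mul_le_left (conjTranspose_mem_partialPermMatrices hA) _))
    have h3 := re_normalizedTrace_mul_le (mul_mem_partialPermMatrices hA hB) hA
    have := (abs_le.1 h2).1
    linarith
  have hAB := key hA hB
  have hBA := key hB hA
  rw [normalizedTrace_mul_comm B A] at hBA
  have h : matrixTwoNorm (B - Aᴴ) ^ 2 =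
      matrixTwoNorm B ^ 2 + matrixTwoNorm A ^ 2 - 2 * (normalizedTrace (A * B)).re := by
    have e : (B - Aᴴ)ᴴ * (B - Aᴴ) = Bᴴ * B + A * Aᴴ - A * B - (A * B)ᴴ := by
      rw [Matrix.conjTranspose_sub, Matrix.conjTranspose_conjTranspose, Matrix.conjTranspose_mul]
      noncomm_ring
    rw [matrixTwoNorm_sq_eq_trace, e, normalizedTrace_sub, normalizedTrace_sub,
      normalizedTrace_add, normalizedTrace_conjTranspose, matrixTwoNorm_sq_eq_trace B,
      matrixTwoNorm_sq_eq_trace A, normalizedTrace_mul_comm A Aᴴ]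
    simp
    ring
  linarith

end PartialPerm

/-! ### Making nearly orthogonal partial permutations orthogonal. -/

section Rounding

variable {d : ℕ}

/-- Two partial permutation matrices are orthogonal if no row and no column is nonzero in both. -/
def PartialPermOrthogonal (A B : Matrix (Fin d) (Fin d) ℂ) : Prop :=
  (∀ i j j', A i j = 1 → B i j' ≠ 1) ∧ ∀ i i' j, A i j = 1 → B i' j ≠ 1

theorem sum_mem_partialPermMatrices {ι : Type*} {s : Finset ι}
    {P : ι → Matrix (Fin d) (Fin d) ℂ} (hP : ∀ a ∈ s, P a ∈ partialPermMatrices d)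
    (hs : ∀ a ∈ s, ∀ b ∈ s, a ≠ b → PartialPermOrthogonal (P a) (P b)) :
    ∑ a ∈ s, P a ∈ partialPermMatrices d := by
  have h01 : ∀ a ∈ s, ∀ i j, P a i j = 0 ∨ P a i j = 1 := fun a ha =>
    (mem_partialPermMatrices_iff.1 (hP a ha)).1
  have hone : ∀ a ∈ s, ∀ i j, P a i j = 1 → (∑ b ∈ s, P b) i j = 1 := by
    intro a ha i j h
    rw [Matrix.sum_apply, Finset.sum_eq_single_of_mem a ha, h]
    intro b hb hba
    exact (h01 b hb i j).resolve_right ((hs a ha b hb hba.symm).1 i j j h)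
  have hex : ∀ i j, (∑ b ∈ s, P b) i j ≠ 0 → ∃ a ∈ s, P a i j = 1 := by
    intro i j h
    by_contra! h'
    refine h ?_
    rw [Matrix.sum_apply]
    exact Finset.sum_eq_zero fun a ha => (h01 a ha i j).resolve_right (h' a ha)
  refine mem_partialPermMatrices_iff.2 ⟨fun i j => ?_, fun i j j' h h' => ?_,
    fun i i' j h h' => ?_⟩
  · by_cases h : (∑ b ∈ s, P b) i j = 0
    · exact Or.inl h
    · obtain ⟨a, ha, h1⟩ := hex i j h
      exact Or.inr (hone a ha i j h1)
  · obtain ⟨a, ha, h1⟩ := hex i j (by rw [h]; exact one_ne_zero)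
    obtain ⟨b, hb, h2⟩ := hex i j' (by rw [h']; exact one_ne_zero)
    by_cases hab : a = b
    · subst hab
      exact (mem_partialPermMatrices_iff.1 (hP a ha)).2.1 _ _ _ h1 h2
    · exact absurd h2 ((hs a ha b hb hab).1 _ _ _ h1)
  · obtain ⟨a, ha, h1⟩ := hex i j (by rw [h]; exact one_ne_zero)
    obtain ⟨b, hb, h2⟩ := hex i' j (by rw [h']; exact one_ne_zero)
    by_cases hab : a = b
    · subst hab
      exact (mem_partialPermMatrices_iff.1 (hP a ha)).2.2 _ _ _ h1 h2
    · exact absurd h2 ((hs a ha b hb hab).2 _ _ _ h1)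

theorem sum_row_norm_sq_le_one {A : Matrix (Fin d) (Fin d) ℂ} (hA : A ∈ partialPermMatrices d)
    (i : Fin d) : ∑ j, ‖A i j‖ ^ 2 ≤ 1 := by
  obtain ⟨h01, hr, -⟩ := mem_partialPermMatrices_iff.1 hA
  by_cases h : ∃ j, A i j = 1
  · obtain ⟨j, hj⟩ := h
    rw [Finset.sum_eq_single j]
    · simp [hj]
    · intro j' _ hj'
      have : A i j' = 0 := (h01 i j').resolve_right fun h => hj' (hr _ _ _ h hj)
      simp [this]
    · simp
  · push Not at h
    rw [Finset.sum_eq_zero fun j _ => by simp [(h01 i j).resolve_right (h j)]]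
    exact zero_le_one

open Classical in
-- The (j, j') entry of Aᴴ B is the number of rows in which A has its 1 in column j and B in column
-- j'. It is a natural number, hence at most its square.
theorem card_common_rows_le {A B : Matrix (Fin d) (Fin d) ℂ} (hA : A ∈ partialPermMatrices d)
    (hB : B ∈ partialPermMatrices d) :
    ((Finset.univ.filter fun i => ∃ j j', A i j = 1 ∧ B i j' = 1).card : ℝ) ≤
      d * matrixTwoNorm (Aᴴ * B) ^ 2 := by
  rcases Nat.eq_zero_or_pos d with rfl | hd
  · simp
  have hd' : (d : ℝ) ≠ 0 := (Nat.cast_pos.2 hd).ne'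
  obtain ⟨hA01, -, -⟩ := mem_partialPermMatrices_iff.1 hA
  obtain ⟨hB01, -, -⟩ := mem_partialPermMatrices_iff.1 hB
  rw [matrixTwoNorm_sq, mul_div_cancel₀ _ hd']
  have hentry : ∀ j j', (Aᴴ * B) j j' =
      ((Finset.univ.filter fun i => A i j = 1 ∧ B i j' = 1).card : ℂ) := by
    intro j j'
    rw [Matrix.mul_apply, Finset.card_filter, Nat.cast_sum]
    refine Finset.sum_congr rfl fun i _ => ?_
    rw [Matrix.conjTranspose_apply]
    rcases hA01 i j with h | h <;> rcases hB01 i j' with h' | h' <;> simp [h, h']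
  have h1 : ∀ j j', ((Finset.univ.filter fun i => A i j = 1 ∧ B i j' = 1).card : ℝ) ≤
      ‖(Aᴴ * B) j j'‖ ^ 2 := by
    intro j j'
    rw [hentry, Complex.norm_natCast]
    exact_mod_cast Nat.le_self_pow two_ne_zero _
  refine le_trans ?_ (Finset.sum_le_sum fun j _ => Finset.sum_le_sum fun j' _ => h1 j j')
  have h2 : (Finset.univ.filter fun i => ∃ j j', A i j = 1 ∧ B i j' = 1) ⊆
      Finset.univ.biUnion fun j => Finset.univ.biUnion fun j' =>
        Finset.univ.filter fun i => A i j = 1 ∧ B i j' = 1 := by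
    intro i
    simp
  refine le_trans (Nat.cast_le.2 (Finset.card_le_card h2)) ?_
  exact_mod_cast Finset.card_biUnion_le.trans
    (Finset.sum_le_sum fun j _ => Finset.card_biUnion_le)

open Classical in
theorem card_common_cols_le {A B : Matrix (Fin d) (Fin d) ℂ} (hA : A ∈ partialPermMatrices d)
    (hB : B ∈ partialPermMatrices d) :
    ((Finset.univ.filter fun j => ∃ i i', A i j = 1 ∧ B i' j = 1).card : ℝ) ≤
      d * matrixTwoNorm (A * Bᴴ) ^ 2 := by
  have := card_common_rows_le (conjTranspose_mem_partialPermMatrices hA)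
    (conjTranspose_mem_partialPermMatrices hB)
  rw [Matrix.conjTranspose_conjTranspose] at this
  refine le_trans (le_of_eq ?_) this
  congr 2
  ext j
  simp [map_eq_one_iff _ (starRingEnd ℂ).injective]

/-- Delete from every Q a all rows and columns shared by some R-related pair. There are at most
|ι|²dγ such rows and as many such columns, and each carries at most one unit of squared mass in Q a.
Orthogonality is asked only along R because atoms without a common word may share sources or ranges.
-/
theorem exists_orthogonal_rounding {ι : Type*} [Fintype ι] (R : ι → ι → Prop)
    {Q : ι → Matrix (Fin d) (Fin d) ℂ} (hQ : ∀ a, Q a ∈ partialPermMatrices d) {γ : ℝ}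
    (hrow : ∀ a b, R a b → matrixTwoNorm ((Q a)ᴴ * Q b) ^ 2 ≤ γ)
    (hcol : ∀ a b, R a b → matrixTwoNorm (Q a * (Q b)ᴴ) ^ 2 ≤ γ) (hγ : 0 ≤ γ) :
    ∃ P : ι → Matrix (Fin d) (Fin d) ℂ, (∀ a, P a ∈ partialPermMatrices d) ∧
      (∀ a b, R a b → PartialPermOrthogonal (P a) (P b)) ∧
      ∀ a, matrixTwoNorm (Q a - P a) ^ 2 ≤ 2 * (Fintype.card ι) ^ 2 * γ := by
  classical
  let br : Finset (Fin d) := Finset.univ.filter fun i =>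
    ∃ a b, R a b ∧ ∃ j j', Q a i j = 1 ∧ Q b i j' = 1
  let bc : Finset (Fin d) := Finset.univ.filter fun j =>
    ∃ a b, R a b ∧ ∃ i i', Q a i j = 1 ∧ Q b i' j = 1
  have hbr : (br.card : ℝ) ≤ d * ((Fintype.card ι) ^ 2 * γ) := by
    have h1 : br ⊆ Finset.univ.biUnion fun p : ι × ι => if R p.1 p.2 then
        Finset.univ.filter fun i => ∃ j j', Q p.1 i j = 1 ∧ Q p.2 i j' = 1 else ∅ := by
      intro i hi
      obtain ⟨a, b, hR, h⟩ := (Finset.mem_filter.1 hi).2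
      refine Finset.mem_biUnion.2 ⟨(a, b), Finset.mem_univ _, ?_⟩
      rw [if_pos hR]
      exact Finset.mem_filter.2 ⟨Finset.mem_univ _, h⟩
    calc (br.card : ℝ) ≤ ∑ p : ι × ι, (((if R p.1 p.2 then Finset.univ.filter fun i =>
          ∃ j j', Q p.1 i j = 1 ∧ Q p.2 i j' = 1 else ∅ : Finset (Fin d))).card : ℝ) := by
            exact_mod_cast (Finset.card_le_card h1).trans Finset.card_biUnion_le
      _ ≤ ∑ p : ι × ι, d * γ := by
        refine Finset.sum_le_sum fun p _ => ?_
        split_ifs with hR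
        · exact (card_common_rows_le (hQ _) (hQ _)).trans
            (mul_le_mul_of_nonneg_left (hrow _ _ hR) (Nat.cast_nonneg d))
        · simp only [Finset.card_empty, Nat.cast_zero]
          positivity
      _ = d * ((Fintype.card ι) ^ 2 * γ) := by
        rw [Finset.sum_const, Finset.card_univ, Fintype.card_prod, nsmul_eq_mul]
        push_cast
        ring
  have hbc : (bc.card : ℝ) ≤ d * ((Fintype.card ι) ^ 2 * γ) := by
    have h1 : bc ⊆ Finset.univ.biUnion fun p : ι × ι => if R p.1 p.2 then
        Finset.univ.filter fun j => ∃ i i', Q p.1 i j = 1 ∧ Q p.2 i' j = 1 else ∅ := by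
      intro j hj
      obtain ⟨a, b, hR, h⟩ := (Finset.mem_filter.1 hj).2
      refine Finset.mem_biUnion.2 ⟨(a, b), Finset.mem_univ _, ?_⟩
      rw [if_pos hR]
      exact Finset.mem_filter.2 ⟨Finset.mem_univ _, h⟩
    calc (bc.card : ℝ) ≤ ∑ p : ι × ι, (((if R p.1 p.2 then Finset.univ.filter fun j =>
          ∃ i i', Q p.1 i j = 1 ∧ Q p.2 i' j = 1 else ∅ : Finset (Fin d))).card : ℝ) := by
            exact_mod_cast (Finset.card_le_card h1).trans Finset.card_biUnion_le
      _ ≤ ∑ p : ι × ι, d * γ := by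
        refine Finset.sum_le_sum fun p _ => ?_
        split_ifs with hR
        · exact (card_common_cols_le (hQ _) (hQ _)).trans
            (mul_le_mul_of_nonneg_left (hcol _ _ hR) (Nat.cast_nonneg d))
        · simp only [Finset.card_empty, Nat.cast_zero]
          positivity
      _ = d * ((Fintype.card ι) ^ 2 * γ) := by
        rw [Finset.sum_const, Finset.card_univ, Fintype.card_prod, nsmul_eq_mul]
        push_cast
        ring
  let P : ι → Matrix (Fin d) (Fin d) ℂ := fun a => Matrix.of fun i j =>
    if i ∈ br ∨ j ∈ bc then 0 else Q a i j
  have hP : ∀ a i j, P a i j = if i ∈ br ∨ j ∈ bc then 0 else Q a i j := fun _ _ _ => rfl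
  have hP1 : ∀ a i j, P a i j = 1 → i ∉ br ∧ j ∉ bc ∧ Q a i j = 1 := by
    intro a i j h
    rw [hP] at h
    split_ifs at h with h'
    · exact absurd h zero_ne_one
    · push Not at h'
      exact ⟨h'.1, h'.2, h⟩
  refine ⟨P, fun a => ?_, fun a b hR => ⟨fun i j j' h h' => ?_, fun i i' j h h' => ?_⟩,
    fun a => ?_⟩
  · obtain ⟨h01, hr, hc⟩ := mem_partialPermMatrices_iff.1 (hQ a)
    refine mem_partialPermMatrices_iff.2 ⟨fun i j => ?_,
      fun i j j' h h' => hr _ _ _ (hP1 _ _ _ h).2.2 (hP1 _ _ _ h').2.2,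
      fun i i' j h h' => hc _ _ _ (hP1 _ _ _ h).2.2 (hP1 _ _ _ h').2.2⟩
    rw [hP]
    split_ifs
    · exact Or.inl rfl
    · exact h01 i j
  · exact (hP1 _ _ _ h).1 (Finset.mem_filter.2 ⟨Finset.mem_univ _, a, b, hR, j, j',
      (hP1 _ _ _ h).2.2, (hP1 _ _ _ h').2.2⟩)
  · exact (hP1 _ _ _ h).2.1 (Finset.mem_filter.2 ⟨Finset.mem_univ _, a, b, hR, i, i',
      (hP1 _ _ _ h).2.2, (hP1 _ _ _ h').2.2⟩)
  · rw [matrixTwoNorm_sq]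
    have hle : ∀ i j, ‖(Q a - P a) i j‖ ^ 2 ≤
        (if i ∈ br then ‖Q a i j‖ ^ 2 else 0) + (if j ∈ bc then ‖Q a i j‖ ^ 2 else 0) := by
      intro i j
      rw [Matrix.sub_apply, hP]
      by_cases h1 : i ∈ br <;> by_cases h2 : j ∈ bc <;> simp [h1, h2]
    have hsum : ∑ i, ∑ j, ‖(Q a - P a) i j‖ ^ 2 ≤ br.card + bc.card := by
      refine (Finset.sum_le_sum fun i _ => Finset.sum_le_sum fun j _ => hle i j).trans ?_
      simp only [Finset.sum_add_distrib]
      refine add_le_add ?_ ?_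
      · calc ∑ i, ∑ j, (if i ∈ br then ‖Q a i j‖ ^ 2 else 0)
            ≤ ∑ i, if i ∈ br then (1 : ℝ) else 0 := by
              refine Finset.sum_le_sum fun i _ => ?_
              split_ifs
              · exact sum_row_norm_sq_le_one (hQ a) i
              · simp
          _ = br.card := by simp
      · rw [Finset.sum_comm]
        calc ∑ j, ∑ i, (if j ∈ bc then ‖Q a i j‖ ^ 2 else 0)
            ≤ ∑ j, if j ∈ bc then (1 : ℝ) else 0 := by
              refine Finset.sum_le_sum fun j _ => ?_
              split_ifs
              · simpa using
                  sum_row_norm_sq_le_one (conjTranspose_mem_partialPermMatrices (hQ a)) j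
              · simp
          _ = bc.card := by simp
    refine div_le_of_le_mul₀ (Nat.cast_nonneg d) (by positivity) (hsum.trans ?_)
    linarith

end Rounding

/-! ### Counting partial permutations in a small 2-norm ball. -/

section Count

/-- A nonempty set of at most r + 1 points arises by inserting one point into a set of at most r
points; the extra option accounts for the empty set. -/
theorem card_filter_card_le_le_pow (α : Type*) [Fintype α] [DecidableEq α] (r : ℕ) :
    (Finset.univ.filter fun s : Finset α => s.card ≤ r).card ≤ (Fintype.card α + 1) ^ r := by
  induction r with
  | zero => simp [Finset.filter_eq']
  | succ r ih =>
    have hsub : (Finset.univ.filter fun s : Finset α => s.card ≤ r + 1) ⊆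
        ((Finset.univ.filter fun s : Finset α => s.card ≤ r) ×ˢ
          (Finset.univ : Finset (Option α))).image fun p => p.2.elim p.1 fun a => insert a p.1 := by
      intro s hs
      rw [Finset.mem_filter] at hs
      rw [Finset.mem_image]
      rcases s.eq_empty_or_nonempty with rfl | ⟨a, ha⟩
      · exact ⟨(∅, none), by simp, rfl⟩
      · refine ⟨(s.erase a, some a), ?_, Finset.insert_erase ha⟩
        rw [Finset.mem_product, Finset.mem_filter, Finset.card_erase_of_mem ha]
        exact ⟨⟨Finset.mem_univ _, by omega⟩, Finset.mem_univ _⟩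
    calc _ ≤ _ := Finset.card_le_card hsub
      _ ≤ _ := Finset.card_image_le
      _ = (Finset.univ.filter fun s : Finset α => s.card ≤ r).card * (Fintype.card α + 1) := by
        rw [Finset.card_product, Finset.card_univ, Fintype.card_option]
      _ ≤ _ := by
        rw [pow_succ]
        exact Nat.mul_le_mul_right _ ih

/-- Relative to a fixed x₀ in X, a 0-1 matrix is recovered from the set of positions where it
differs from x₀. The size of that set is d times the squared distance, hence at most ε²d, among d²
positions. -/
theorem encard_le_of_matrixTwoNorm_sub_le {ι : Type*} [Fintype ι] {d : ℕ}
    {X : Set (ι → Matrix (Fin d) (Fin d) ℂ)} {ε : ℝ}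
    (hX : ∀ x ∈ X, ∀ a, x a ∈ partialPermMatrices d)
    (hXε : ∀ x ∈ X, ∀ y ∈ X, ∀ a, matrixTwoNorm (x a - y a) ≤ ε) :
    X.encard ≤ (((d ^ 2 + 1) ^ (⌊ε ^ 2 * d⌋₊ * Fintype.card ι) : ℕ) : ℕ∞) := by
  classical
  rcases X.eq_empty_or_nonempty with rfl | ⟨x₀, hx₀⟩
  · simp
  let g : (ι → Matrix (Fin d) (Fin d) ℂ) → ι → Finset (Fin d × Fin d) := fun x a =>
    Finset.univ.filter fun p => x a p.1 p.2 ≠ x₀ a p.1 p.2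
  let T : Finset (ι → Finset (Fin d × Fin d)) :=
    Fintype.piFinset fun _ => Finset.univ.filter fun s => s.card ≤ ⌊ε ^ 2 * d⌋₊
  have h01 : ∀ x ∈ X, ∀ a i j, x a i j = 0 ∨ x a i j = 1 := fun x hx a =>
    (mem_partialPermMatrices_iff.1 (hX x hx a)).1
  have hmaps : MapsTo g X T := by
    intro x hx
    rw [Finset.mem_coe, Fintype.mem_piFinset]
    intro a
    rw [Finset.mem_filter]
    refine ⟨Finset.mem_univ _, Nat.le_floor ?_⟩
    rcases Nat.eq_zero_or_pos d with rfl | hd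
    · rw [Finset.card_eq_zero.2 (Finset.eq_empty_of_isEmpty _)]
      simp
    have hd' : (0 : ℝ) < d := Nat.cast_pos.2 hd
    have h1 : matrixTwoNorm (x a - x₀ a) ^ 2 ≤ ε ^ 2 :=
      pow_le_pow_left₀ (matrixTwoNorm_nonneg _) (hXε x hx x₀ hx₀ a) 2
    rw [matrixTwoNorm_sq, div_le_iff₀ hd'] at h1
    refine le_trans (le_of_eq ?_) h1
    rw [Finset.card_filter, Nat.cast_sum, ← Finset.univ_product_univ, Finset.sum_product]
    refine Finset.sum_congr rfl fun i _ => Finset.sum_congr rfl fun j _ => ?_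
    rw [Matrix.sub_apply]
    rcases h01 x hx a i j with h | h <;> rcases h01 x₀ hx₀ a i j with h' | h' <;>
      simp [h, h']
  have hinj : InjOn g X := by
    intro x hx y hy hxy
    funext a
    ext i j
    have := congrFun hxy a
    have hp : ((i, j) ∈ g x a) ↔ ((i, j) ∈ g y a) := by rw [this]
    simp only [g, Finset.mem_filter, Finset.mem_univ, true_and] at hp
    rcases h01 x hx a i j with h | h <;> rcases h01 y hy a i j with h' | h' <;>
      rcases h01 x₀ hx₀ a i j with h'' | h'' <;> simp_all
  have hT : T.card ≤ (d ^ 2 + 1) ^ (⌊ε ^ 2 * d⌋₊ * Fintype.card ι) := by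
    rw [Fintype.card_piFinset, Finset.prod_const, Finset.card_univ, pow_mul]
    refine Nat.pow_le_pow_left ((card_filter_card_le_le_pow _ _).trans (le_of_eq ?_)) _
    rw [Fintype.card_prod, Fintype.card_fin, sq d]
  calc X.encard = (g '' X).encard := hinj.encard_image.symm
    _ ≤ (T : Set _).encard := encard_le_encard hmaps.image_subset
    _ = T.card := encard_coe_eq_coe_finsetCard T
    _ ≤ _ := by exact_mod_cast hT

end Count

/-! ### Sums, products and adjoints in the inverse semigroup of partial isometries. -/

namespace PMPGroupoid

variable {G : Type*} [MeasurableSpace G] {𝒢 : PMPGroupoid G}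

theorem eventually_aeArrows_iff {P : G → Prop} :
    (∀ᶠ z in 𝒢.aeArrows, P z) ↔ ∀ᵐ u ∂𝒢.μ, ∀ z, 𝒢.src z = u → P z :=
  eventually_comap

theorem inv_mul_rev (x y : G) (h : 𝒢.src x = 𝒢.rng y) :
    𝒢.inv (𝒢.mul x y) = 𝒢.mul (𝒢.inv y) (𝒢.inv x) := by
  have h1 : 𝒢.src (𝒢.inv y) = 𝒢.rng (𝒢.inv x) := by rw [𝒢.src_inv, 𝒢.rng_inv, h]
  have h2 : 𝒢.src (𝒢.mul x y) = 𝒢.rng (𝒢.mul (𝒢.inv y) (𝒢.inv x)) := by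
    rw [𝒢.src_mul x y h, 𝒢.rng_mul _ _ h1, 𝒢.rng_inv]
  have h3 : 𝒢.mul (𝒢.mul x y) (𝒢.mul (𝒢.inv y) (𝒢.inv x)) = 𝒢.rng x := by
    rw [← 𝒢.mul_assoc _ _ _ (by rw [𝒢.src_mul x y h, 𝒢.rng_inv]) h1,
      mul_inv_cancel_right x y h, 𝒢.mul_inv]
  have h4 := mul_inv_cancel_left _ _ h2
  rw [h3, ← 𝒢.rng_mul x y h, ← 𝒢.src_inv, 𝒢.mul_src] at h4
  exact h4

/-- The partial isometry of a bisection. -/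
def PartialIsom.mk (B : 𝒢.Bisection) : 𝒢.PartialIsom := Quotient.mk _ B

theorem PartialIsom.ind_mk (B : 𝒢.Bisection) :
    PartialIsom.ind (PartialIsom.mk B) = ((B.carrier.indicator 1 : G → ℂ) : 𝒢.Fun) :=
  rfl

theorem PartialIsom.exists_rep (s : 𝒢.PartialIsom) : ∃ B : 𝒢.Bisection, PartialIsom.mk B = s :=
  Quotient.exists_rep s

theorem coe_sum_fun {ι : Type*} (I : Finset ι) (f : ι → G → ℂ) :
    (((∑ i ∈ I, f i : G → ℂ)) : 𝒢.Fun) = ∑ i ∈ I, ((f i : G → ℂ) : 𝒢.Fun) :=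
  map_sum (Germ.coeAddHom 𝒢.aeArrows) f I

theorem PartialIsom.sum_smul_ind {ι : Type*} (I : Finset ι) (c : ι → ℂ) (B : ι → 𝒢.Bisection) :
    ∑ i ∈ I, c i • PartialIsom.ind (PartialIsom.mk (B i)) =
      ((fun z => ∑ i ∈ I, c i * (B i).carrier.indicator 1 z : G → ℂ) : 𝒢.Fun) := by
  have : (fun z => ∑ i ∈ I, c i * (B i).carrier.indicator 1 z : G → ℂ) =
      ∑ i ∈ I, c i • (B i).carrier.indicator 1 := by
    ext z
    simp
  rw [this, coe_sum_fun]
  rfl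

theorem PartialIsom.ind_eq_sum_iff {ι : Type*} (I : Finset ι) (C : 𝒢.Bisection)
    (B : ι → 𝒢.Bisection) :
    PartialIsom.ind (PartialIsom.mk C) = ∑ i ∈ I, PartialIsom.ind (PartialIsom.mk (B i)) ↔
      ∀ᶠ z in 𝒢.aeArrows, C.carrier.indicator (1 : G → ℂ) z =
        ∑ i ∈ I, (B i).carrier.indicator (1 : G → ℂ) z := by
  have := PartialIsom.sum_smul_ind I (fun _ => 1) B
  simp only [one_smul, one_mul] at this
  rw [this, PartialIsom.ind_mk, Germ.coe_eq]
  rfl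

theorem PartialIsom.ind_eq_zero_iff (C : 𝒢.Bisection) :
    PartialIsom.ind (PartialIsom.mk C) = 0 ↔ ∀ᶠ z in 𝒢.aeArrows, z ∉ C.carrier := by
  have := PartialIsom.ind_eq_sum_iff (∅ : Finset Empty) C (fun _ => C)
  simp only [Finset.sum_empty] at this
  rw [this]
  refine eventually_congr (Eventually.of_forall fun z => ?_)
  by_cases hz : z ∈ C.carrier <;> simp [hz]

variable [StandardBorelSpace G]

theorem Bisection.mem_inv {B : 𝒢.Bisection} {z : G} :
    z ∈ B.inv.carrier ↔ 𝒢.inv z ∈ B.carrier :=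
  Iff.rfl

/-- Left multiplication by B is, near z, translation by the only arrow x of B with the range of z.
-/
theorem Bisection.mem_mul_iff {B C : 𝒢.Bisection} {x z : G} (hx : x ∈ B.carrier)
    (h : 𝒢.rng x = 𝒢.rng z) : z ∈ (B.mul C).carrier ↔ 𝒢.mul (𝒢.inv x) z ∈ C.carrier := by
  have h' : 𝒢.src (𝒢.inv x) = 𝒢.rng z := by rw [𝒢.src_inv, h]
  constructor
  · rintro ⟨x', hx', y, hy, hxy, rfl⟩
    rw [𝒢.rng_mul x' y hxy] at h
    obtain rfl := B.injOn_rng hx hx' h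
    rwa [mul_inv_cancel_left x y hxy]
  · intro hz
    refine ⟨x, hx, _, hz, by rw [𝒢.rng_mul _ _ h', 𝒢.rng_inv], ?_⟩
    have := mul_inv_cancel_left (𝒢.inv x) z h'
    rwa [inv_inv] at this

theorem Bisection.exists_of_mem_mul {B C : 𝒢.Bisection} {z : G} (hz : z ∈ (B.mul C).carrier) :
    ∃ x ∈ B.carrier, 𝒢.rng x = 𝒢.rng z := by
  obtain ⟨x, hx, y, hy, h, rfl⟩ := hz
  exact ⟨x, hx, (𝒢.rng_mul x y h).symm⟩

theorem PartialIsom.mk_mul_mk (B C : 𝒢.Bisection) :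
    PartialIsom.mk B * PartialIsom.mk C = PartialIsom.mk (B.mul C) :=
  rfl

theorem PartialIsom.star_mk (B : 𝒢.Bisection) :
    star (PartialIsom.mk B) = PartialIsom.mk B.inv :=
  rfl

instance : StarMul 𝒢.PartialIsom where
  star_mul := by
    rintro ⟨B⟩ ⟨C⟩
    refine Quotient.sound (Bisection.equiv_iff.2 (Eventually.of_forall fun z => ?_))
    rw [Bisection.mem_inv]
    constructor
    · rintro ⟨x, hx, y, hy, h, hz⟩
      refine ⟨𝒢.inv y, ?_, 𝒢.inv x, ?_, by rw [𝒢.src_inv, 𝒢.rng_inv, h], ?_⟩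
      · rwa [Bisection.mem_inv, inv_inv]
      · rwa [Bisection.mem_inv, inv_inv]
      · rw [← inv_mul_rev x y h, hz, inv_inv]
    · rintro ⟨y, hy, x, hx, h, rfl⟩
      exact ⟨𝒢.inv x, hx, 𝒢.inv y, hy, by rw [𝒢.src_inv, 𝒢.rng_inv, h],
        (inv_mul_rev y x h).symm⟩

theorem PartialIsom.mul_star_mul (s : 𝒢.PartialIsom) : s * star s * s = s := by
  obtain ⟨B, rfl⟩ := s.exists_rep
  refine Quotient.sound (Bisection.equiv_iff.2 (Eventually.of_forall fun z => ?_))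
  constructor
  · rintro ⟨_, ⟨x, hx, y, hy, h, rfl⟩, w, hw, h', rfl⟩
    have hyx : 𝒢.inv y = x := B.injOn_src hy hx (by rw [𝒢.src_inv, h])
    subst hyx
    rw [𝒢.inv_mul, 𝒢.src_src] at h'
    rwa [𝒢.inv_mul, h', 𝒢.rng_mul_self]
  · intro hz
    refine ⟨𝒢.rng z, ⟨z, hz, 𝒢.inv z, ?_, (𝒢.rng_inv z).symm, 𝒢.mul_inv z⟩, z, hz,
      𝒢.src_rng z, 𝒢.rng_mul_self z⟩
    rwa [Bisection.mem_inv, inv_inv]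

/-- Left multiplication is additive. -/
theorem PartialIsom.ind_mul_eq_sum {ι : Type*} {I : Finset ι} {s t : 𝒢.PartialIsom}
    {w : ι → 𝒢.PartialIsom} (h : t.ind = ∑ i ∈ I, (w i).ind) :
    (s * t).ind = ∑ i ∈ I, (s * w i).ind := by
  obtain ⟨B, rfl⟩ := s.exists_rep
  obtain ⟨C, rfl⟩ := t.exists_rep
  choose D hD using fun i => (w i).exists_rep
  obtain rfl : w = fun i => PartialIsom.mk (D i) := funext fun i => (hD i).symm
  simp only [PartialIsom.mk_mul_mk]
  rw [PartialIsom.ind_eq_sum_iff, eventually_aeArrows_iff] at h ⊢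
  filter_upwards [h] with u hu z hz
  by_cases hx : ∃ x ∈ B.carrier, 𝒢.rng x = 𝒢.rng z
  · obtain ⟨x, hx, hxz⟩ := hx
    have key : ∀ E : 𝒢.Bisection, (B.mul E).carrier.indicator (1 : G → ℂ) z =
        E.carrier.indicator (1 : G → ℂ) (𝒢.mul (𝒢.inv x) z) := fun E => by
      by_cases hE : z ∈ (B.mul E).carrier
      · rw [indicator_of_mem hE, indicator_of_mem ((Bisection.mem_mul_iff hx hxz).1 hE)]
        rfl
      · rw [indicator_of_notMem hE,
          indicator_of_notMem fun h => hE ((Bisection.mem_mul_iff hx hxz).2 h)]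
    simp only [key]
    -- Left translation keeps the source, so the null set of bad sources is the same for z and its
    -- translate.
    exact hu _ (by rw [𝒢.src_mul _ _ (by rw [𝒢.src_inv, hxz]), hz])
  · have key : ∀ E : 𝒢.Bisection, (B.mul E).carrier.indicator (1 : G → ℂ) z = 0 := fun E =>
      indicator_of_notMem (fun h => hx (Bisection.exists_of_mem_mul h)) _
    simp [key]

/-- Inversion turns sources into ranges, so the exceptional null set must be moved from sources to
ranges. `Bisection.eventually_rng` does this along a bisection, and only finitely many bisections
matter. -/
theorem PartialIsom.ind_star_eq_sum {ι : Type*} {I : Finset ι} {t : 𝒢.PartialIsom}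
    {w : ι → 𝒢.PartialIsom} (h : t.ind = ∑ i ∈ I, (w i).ind) :
    (star t).ind = ∑ i ∈ I, (star (w i)).ind := by
  obtain ⟨C, rfl⟩ := t.exists_rep
  choose D hD using fun i => (w i).exists_rep
  obtain rfl : w = fun i => PartialIsom.mk (D i) := funext fun i => (hD i).symm
  simp only [PartialIsom.star_mk]
  rw [PartialIsom.ind_eq_sum_iff] at h ⊢
  have h' := exists_ae_of_eventually h
  have h1 := C.inv.eventually_rng h'
  have h2 : ∀ᶠ z in 𝒢.aeArrows, ∀ i ∈ I, z ∈ (D i).inv.carrier → _ :=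
    (eventually_all_finset I).2 fun i _ => (D i).inv.eventually_rng h'
  have key : ∀ (E : 𝒢.Bisection) (z : G), E.inv.carrier.indicator (1 : G → ℂ) z =
      E.carrier.indicator (1 : G → ℂ) (𝒢.inv z) := fun E z => by
    by_cases hE : z ∈ E.inv.carrier
    · rw [indicator_of_mem hE, indicator_of_mem (Bisection.mem_inv.1 hE)]
      rfl
    · rw [indicator_of_notMem hE, indicator_of_notMem fun h => hE (Bisection.mem_inv.2 h)]
  filter_upwards [h1, h2] with z h1 h2
  by_cases hz : z ∈ C.inv.carrier ∨ ∃ i ∈ I, z ∈ (D i).inv.carrier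
  · simp only [key]
    rcases hz with hz | ⟨i, hi, hz⟩
    · exact h1 hz _ (𝒢.src_inv z)
    · exact h2 i hi hz _ (𝒢.src_inv z)
  -- Outside the finitely many bisections both sides are zero.
  · push Not at hz
    rw [indicator_of_notMem hz.1, Finset.sum_eq_zero fun i hi => indicator_of_notMem (hz.2 i hi) _]

/-- Right multiplication is additive. -/
theorem PartialIsom.ind_mul_eq_sum' {ι : Type*} {I : Finset ι} {s t : 𝒢.PartialIsom}
    {w : ι → 𝒢.PartialIsom} (h : s.ind = ∑ i ∈ I, (w i).ind) :
    (s * t).ind = ∑ i ∈ I, (w i * t).ind := by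
  have := PartialIsom.ind_star_eq_sum
    (PartialIsom.ind_mul_eq_sum (s := star t) (PartialIsom.ind_star_eq_sum h))
  simpa only [star_mul, star_star] using this

theorem PartialIsom.ind_mul_eq_sum_sum {ι κ : Type*} {I : Finset ι} {J : Finset κ}
    {s t : 𝒢.PartialIsom} {v : ι → 𝒢.PartialIsom} {w : κ → 𝒢.PartialIsom}
    (hs : s.ind = ∑ i ∈ I, (v i).ind) (ht : t.ind = ∑ j ∈ J, (w j).ind) :
    (s * t).ind = ∑ i ∈ I, ∑ j ∈ J, (v i * w j).ind := by
  rw [PartialIsom.ind_mul_eq_sum' hs]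
  exact Finset.sum_congr rfl fun i _ => PartialIsom.ind_mul_eq_sum ht

/-- The sum is a 0-1 function, so the summands are almost everywhere disjoint subsets of one
bisection C. Arrows of two summands with a common range coincide by injectivity of the range on C,
which disjointness excludes. -/
theorem PartialIsom.ind_star_mul_eq_zero {ι : Type*} {I : Finset ι} {t : 𝒢.PartialIsom}
    {w : ι → 𝒢.PartialIsom} (h : t.ind = ∑ i ∈ I, (w i).ind) {i k : ι} (hi : i ∈ I) (hk : k ∈ I)
    (hik : i ≠ k) : (star (w i) * w k).ind = 0 := by
  classical
  obtain ⟨C, rfl⟩ := t.exists_rep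
  choose D hD using fun i => (w i).exists_rep
  obtain rfl : w = fun i => PartialIsom.mk (D i) := funext fun i => (hD i).symm
  simp only [PartialIsom.star_mk, PartialIsom.mk_mul_mk]
  rw [PartialIsom.ind_eq_sum_iff] at h
  rw [PartialIsom.ind_eq_zero_iff]
  have h' := exists_ae_of_eventually h
  have h1 := ((D i).inv.mul (D k)).eventually_rng h'
  filter_upwards [h1, tendsto_comap.eventually h'] with z hr hs hz
  have hr := hr hz
  have hcard : ∀ y, C.carrier.indicator (1 : G → ℂ) y =
      ∑ j ∈ I, (D j).carrier.indicator (1 : G → ℂ) y →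
      (I.filter fun j => y ∈ (D j).carrier).card = if y ∈ C.carrier then 1 else 0 := by
    intro y hy
    have : ((I.filter fun j => y ∈ (D j).carrier).card : ℂ) =
        ((if y ∈ C.carrier then 1 else 0 : ℕ) : ℂ) := by
      rw [Finset.card_filter]
      push_cast
      have e : ∀ E : 𝒢.Bisection, E.carrier.indicator (1 : G → ℂ) y =
          if y ∈ E.carrier then 1 else 0 := fun E => indicator_apply _ _ _
      simp only [e] at hy
      exact hy.symm
    exact_mod_cast this
  have hmem : ∀ y, C.carrier.indicator (1 : G → ℂ) y =
      ∑ j ∈ I, (D j).carrier.indicator (1 : G → ℂ) y → ∀ j ∈ I, y ∈ (D j).carrier →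
      y ∈ C.carrier := by
    intro y hy j hj hyj
    by_contra hyC
    have := hcard y hy
    rw [if_neg hyC, Finset.card_eq_zero] at this
    exact Finset.notMem_empty j (this ▸ Finset.mem_filter.2 ⟨hj, hyj⟩)
  obtain ⟨x, hx, y, hy, hxy, rfl⟩ := hz
  have hy' := hs y (𝒢.src_mul x y hxy).symm
  have hx' := hr (𝒢.inv x) (by rw [𝒢.src_inv, 𝒢.rng_mul x y hxy])
  have hxy' : 𝒢.inv x = y := C.injOn_rng (hmem _ hx' i hi hx) (hmem _ hy' k hk hy)
    (by rw [𝒢.rng_inv, hxy])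
  have h2 := hcard y hy'
  rw [if_pos (hmem _ hy' k hk hy)] at h2
  refine hik (Finset.card_le_one.1 h2.le i (Finset.mem_filter.2 ⟨hi, ?_⟩) k
    (Finset.mem_filter.2 ⟨hk, hy⟩))
  rw [← hxy']
  exact hx

theorem PartialIsom.ind_mul_star_eq_zero {ι : Type*} {I : Finset ι} {t : 𝒢.PartialIsom}
    {w : ι → 𝒢.PartialIsom} (h : t.ind = ∑ i ∈ I, (w i).ind) {i k : ι} (hi : i ∈ I) (hk : k ∈ I)
    (hik : i ≠ k) : (w i * star (w k)).ind = 0 := by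
  have := PartialIsom.ind_star_mul_eq_zero (PartialIsom.ind_star_eq_sum h) hi hk hik
  rwa [star_star] at this

/-! ### Atoms of a finite family of bisections. -/

open Classical in
/-- The bisection of the arrows that lie in exactly those members of the finite family `B` whose
indices are in `T`, where at least one index occurs. -/
def Bisection.atom {ι : Type*} (B : ι → 𝒢.Bisection) (W T : Finset ι) : 𝒢.Bisection where
  carrier := {z | (∃ s ∈ W, z ∈ (B s).carrier) ∧ ∀ s ∈ W, z ∈ (B s).carrier ↔ s ∈ T}
  measurableSet := by
    have h1 : {z | ∃ s ∈ W, z ∈ (B s).carrier} = ⋃ s ∈ W, (B s).carrier := by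
      ext z
      simp
    have h2 : {z | ∀ s ∈ W, z ∈ (B s).carrier ↔ s ∈ T} =
        ⋂ s ∈ W, {z | z ∈ (B s).carrier ↔ s ∈ T} := by
      ext z
      simp
    rw [ofPred_and, h1, h2]
    refine (Finset.measurableSet_biUnion _ fun s _ => (B s).measurableSet).inter
      (Finset.measurableSet_biInter _ fun s _ => ?_)
    by_cases hs : s ∈ T
    · simpa [hs] using (B s).measurableSet
    · have : {z | z ∈ (B s).carrier ↔ s ∈ T} = (B s).carrierᶜ := by
        ext z
        simp [hs]
      rw [this]
      exact (B s).measurableSet.compl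
  injOn_src := by
    rintro x ⟨⟨s, hs, hxs⟩, hx⟩ y ⟨-, hy⟩ h
    exact (B s).injOn_src hxs ((hy s hs).2 ((hx s hs).1 hxs)) h
  injOn_rng := by
    rintro x ⟨⟨s, hs, hxs⟩, hx⟩ y ⟨-, hy⟩ h
    exact (B s).injOn_rng hxs ((hy s hs).2 ((hx s hs).1 hxs)) h

end PMPGroupoid

open Classical in
/-- Finitely many elements of `I_𝒢` are sums over subfamilies of one finite, linearly independent
family in `I_𝒢`. -/
theorem PMPGroupoid.exists_atoms.{u} {G : Type u} [MeasurableSpace G] [StandardBorelSpace G]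
    {𝒢 : PMPGroupoid G} (W : Finset 𝒢.PartialIsom) :
    ∃ (ι : Type u) (_ : Fintype ι) (A : ι → 𝒢.PartialIsom) (inc : 𝒢.PartialIsom → Finset ι),
      LinearIndependent ℂ (fun i => (A i).toSpan) ∧
        ∀ s ∈ W, s.ind = ∑ i ∈ inc s, (A i).ind := by
  choose B hB using fun s : 𝒢.PartialIsom => s.exists_rep
  let a : Finset 𝒢.PartialIsom → 𝒢.Bisection := Bisection.atom B W
  -- Null atoms are discarded: their characteristic functions are zero and would destroy linear
  -- independence.
  let K : Finset (Finset 𝒢.PartialIsom) :=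
    W.powerset.filter fun T => PartialIsom.ind (PartialIsom.mk (a T)) ≠ 0
  have hdisj : ∀ T ∈ W.powerset, ∀ T' ∈ W.powerset, ∀ z, z ∈ (a T).carrier →
      z ∈ (a T').carrier → T = T' := by
    intro T hT T' hT' z hz hz'
    ext s
    constructor
    · intro hs
      have hsW := Finset.mem_powerset.1 hT hs
      exact (hz'.2 s hsW).1 ((hz.2 s hsW).2 hs)
    · intro hs
      have hsW := Finset.mem_powerset.1 hT' hs
      exact (hz.2 s hsW).1 ((hz'.2 s hsW).2 hs)
  refine ⟨K, inferInstance, fun T => PartialIsom.mk (a T.1),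
    fun s => Finset.univ.filter fun T => s ∈ T.1, ?_, fun s hs => ?_⟩
  · rw [linearIndependent_iff']
    intro J g hg T hT
    have h1 : ∑ i ∈ J, g i • PartialIsom.ind (PartialIsom.mk (a i.1)) = 0 := by
      have := congrArg (Submodule.subtype 𝒢.Span) hg
      simpa [PartialIsom.toSpan] using this
    rw [PartialIsom.sum_smul_ind, ← Germ.coe_zero, Germ.coe_eq] at h1
    have h2 : ¬ ∀ᶠ z in 𝒢.aeArrows, z ∉ (a T.1).carrier := fun h =>
      (Finset.mem_filter.1 T.2).2 ((PartialIsom.ind_eq_zero_iff _).2 h)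
    -- A non-null atom contains an arrow at which the almost everywhere relation holds. There, by
    -- disjointness, all coefficients but that of T drop out.
    obtain ⟨z, hz, h0⟩ := (not_eventually.1 h2).and_eventually h1 |>.exists
    rw [not_not] at hz
    change ∑ i ∈ J, g i * (a i.1).carrier.indicator 1 z = 0 at h0
    rw [Finset.sum_eq_single T] at h0
    · simpa [indicator_of_mem hz] using h0
    · intro T' _ hT'
      rw [indicator_of_notMem, mul_zero]
      exact fun hz' => hT' (Subtype.ext (hdisj _ (Finset.mem_filter.1 T'.2).1 _
        (Finset.mem_filter.1 T.2).1 z hz' hz))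
    · exact fun h => absurd hT h
  · have h1 : ∑ T ∈ Finset.univ.filter (fun T : K => s ∈ T.1),
        PartialIsom.ind (PartialIsom.mk (a T.1)) =
        ∑ T ∈ W.powerset.filter (fun T => s ∈ T), PartialIsom.ind (PartialIsom.mk (a T)) := by
      rw [Finset.sum_filter, Finset.sum_filter,
        Finset.sum_coe_sort K fun T => if s ∈ T then PartialIsom.ind (PartialIsom.mk (a T)) else 0,
        Finset.sum_filter]
      refine Finset.sum_congr rfl fun T _ => ?_
      split_ifs with h1 h2 h2
      · rfl
      · rfl
      · exact (not_not.1 h1).symm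
      · rfl
    rw [h1]
    conv_lhs => rw [← hB s]
    rw [PartialIsom.ind_eq_sum_iff]
    refine Eventually.of_forall fun z => ?_
    by_cases hz : z ∈ (B s).carrier
    -- The only atom through z is indexed by the set of all members of W that contain z.
    · rw [indicator_of_mem hz, Finset.sum_eq_single (W.filter fun t => z ∈ (B t).carrier)]
      · refine (indicator_of_mem ?_ _).symm
        exact ⟨⟨s, hs, hz⟩, fun t ht => by simp [ht]⟩
      · intro T hT hne
        refine indicator_of_notMem (fun hzT => hne ?_) _
        refine hdisj T (Finset.mem_filter.1 hT).1 _ (by simp) z hzT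
          ⟨⟨s, hs, hz⟩, fun t ht => by simp [ht]⟩
      · intro h
        exact absurd (Finset.mem_filter.2 ⟨by simp, by simp [hs, hz]⟩) h
    · rw [indicator_of_notMem hz, Finset.sum_eq_zero]
      intro T hT
      refine indicator_of_notMem (fun hzT => hz ?_) _
      exact (hzT.2 s hs).2 (Finset.mem_filter.1 hT).2

/-! ### The trace, the inner product and the 2-norm on the groupoid. -/

namespace PMPGroupoid

variable {G : Type*} [MeasurableSpace G] [StandardBorelSpace G] {𝒢 : PMPGroupoid G}

instance : IsProbabilityMeasure 𝒢.μ := 𝒢.isProbabilityMeasure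

theorem trace_ind_mk (B : 𝒢.Bisection) :
    trace (PartialIsom.mk B).ind = (𝒢.μ.real (B.carrier ∩ 𝒢.units) : ℂ) := by
  change ∫ x, B.carrier.indicator (1 : G → ℂ) x ∂𝒢.μ = _
  have h : ∀ x, B.carrier.indicator (1 : G → ℂ) x =
      ((B.carrier.indicator (1 : G → ℝ) x : ℝ) : ℂ) := fun x => by
    by_cases hx : x ∈ B.carrier <;> simp [hx]
  simp only [h]
  rw [integral_complex_ofReal, integral_indicator_one B.measurableSet, measureReal_def, measureReal_def]
  congr 2
  refine measure_congr ?_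
  filter_upwards [ae_units (𝒢 := 𝒢)] with x hx
  exact propext ⟨fun h => ⟨h, hx⟩, fun h => h.1⟩

/-- The inner product `τ(s^* t)`. -/
noncomputable def gram (s t : 𝒢.PartialIsom) : ℝ := (trace (star s * t).ind).re

/-- A product x y is a unit only when y is the inverse of x. This makes τ(s*t) the mass of the
sources of an intersection. -/
theorem Bisection.inv_mul_inter_units (B C : 𝒢.Bisection) :
    (B.inv.mul C).carrier ∩ 𝒢.units = 𝒢.src '' (B.carrier ∩ C.carrier) := by
  ext u
  constructor
  · rintro ⟨⟨x, hx, y, hy, h, rfl⟩, hu⟩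
    have h1 : 𝒢.mul x y = 𝒢.src y := by rw [← 𝒢.src_mul x y h, src_unit hu]
    have h2 : 𝒢.mul x y = 𝒢.rng x := by rw [← 𝒢.rng_mul x y h, rng_unit hu]
    have h3 : y = 𝒢.inv x := by
      rw [← mul_inv_cancel_left x y h, h2, ← 𝒢.src_inv, 𝒢.mul_src]
    refine ⟨y, ⟨?_, hy⟩, h1.symm⟩
    rw [h3]
    exact hx
  · rintro ⟨y, ⟨hyB, hyC⟩, rfl⟩
    refine ⟨⟨𝒢.inv y, ?_, y, hyC, 𝒢.src_inv y, 𝒢.inv_mul y⟩, src_mem_units y⟩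
    change 𝒢.inv (𝒢.inv y) ∈ B.carrier
    rwa [inv_inv]

theorem gram_mk (B C : 𝒢.Bisection) :
    gram (PartialIsom.mk B) (PartialIsom.mk C) = 𝒢.μ.real (𝒢.src '' (B.carrier ∩ C.carrier)) := by
  rw [gram, PartialIsom.star_mk, PartialIsom.mk_mul_mk, trace_ind_mk,
    Bisection.inv_mul_inter_units, Complex.ofReal_re]

theorem trace_ind_star_mul (s t : 𝒢.PartialIsom) : trace (star s * t).ind = (gram s t : ℂ) := by
  obtain ⟨B, hB⟩ := (star s * t).exists_rep
  rw [gram, ← hB, trace_ind_mk, Complex.ofReal_re]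

theorem gram_comm (s t : 𝒢.PartialIsom) : gram s t = gram t s := by
  obtain ⟨B, rfl⟩ := s.exists_rep
  obtain ⟨C, rfl⟩ := t.exists_rep
  rw [gram_mk, gram_mk, inter_comm]

/-- Inversion replaces the sources of the intersection by its ranges, which have the same mass
because μ is invariant. -/
theorem gram_star (s t : 𝒢.PartialIsom) : gram (star s) (star t) = gram s t := by
  obtain ⟨B, rfl⟩ := s.exists_rep
  obtain ⟨C, rfl⟩ := t.exists_rep
  let D : 𝒢.Bisection := ⟨B.carrier ∩ C.carrier, B.measurableSet.inter C.measurableSet,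
    B.injOn_src.mono inter_subset_left, B.injOn_rng.mono inter_subset_left⟩
  have h := D.measure_src_eq_rng
  rw [PartialIsom.star_mk, PartialIsom.star_mk, gram_mk, gram_mk, measureReal_def,
    measureReal_def, show B.carrier ∩ C.carrier = D.carrier from rfl, h]
  congr 2
  ext u
  constructor
  · rintro ⟨z, hz, rfl⟩
    exact ⟨𝒢.inv z, hz, 𝒢.rng_inv z⟩
  · rintro ⟨z, hz, rfl⟩
    refine ⟨𝒢.inv z, ?_, 𝒢.src_inv z⟩
    change 𝒢.inv (𝒢.inv z) ∈ B.carrier ∧ 𝒢.inv (𝒢.inv z) ∈ C.carrier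
    rwa [inv_inv]

theorem hasSum_indicator_fiber {E : Set G} (hE : InjOn 𝒢.src E) (u : G) :
    HasSum (fun y : 𝒢.src ⁻¹' {u} => E.indicator (1 : G → ℝ) y)
      ((𝒢.src '' E).indicator 1 u) := by
  by_cases hu : u ∈ 𝒢.src '' E
  · obtain ⟨y, hy, rfl⟩ := hu
    rw [indicator_of_mem (mem_image_of_mem _ hy)]
    have := hasSum_single (f := fun y : 𝒢.src ⁻¹' {𝒢.src y} => E.indicator (1 : G → ℝ) y)
      ⟨y, rfl⟩ fun y' hy' => indicator_of_notMem
        (fun h => hy' (Subtype.ext (hE h hy y'.2))) _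
    simpa [hy] using this
  · rw [indicator_of_notMem hu]
    convert hasSum_zero using 2 with y
    exact indicator_of_notMem (fun h => hu ⟨y, h, y.2⟩) _

theorem hasSum_fiber_norm_sq {ι : Type*} (I : Finset ι) (c : ι → ℂ) (B : ι → 𝒢.Bisection)
    (u : G) :
    HasSum (fun y : 𝒢.src ⁻¹' {u} =>
      ‖∑ i ∈ I, c i * (B i).carrier.indicator (1 : G → ℂ) y‖ ^ 2)
      (∑ i ∈ I, ∑ j ∈ I, (star (c i) * c j).re *
        (𝒢.src '' ((B i).carrier ∩ (B j).carrier)).indicator (1 : G → ℝ) u) := by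
  have h1 : ∀ y : G, ‖∑ i ∈ I, c i * (B i).carrier.indicator (1 : G → ℂ) y‖ ^ 2 =
      ∑ i ∈ I, ∑ j ∈ I, (star (c i) * c j).re *
        ((B i).carrier ∩ (B j).carrier).indicator (1 : G → ℝ) y := by
    intro y
    set z := ∑ i ∈ I, c i * (B i).carrier.indicator (1 : G → ℂ) y with hz
    have h : ‖z‖ ^ 2 = (star z * z).re := by
      rw [RCLike.star_def, Complex.conj_mul', ← Complex.ofReal_pow, Complex.ofReal_re]
    rw [h, hz, star_sum, Finset.sum_mul_sum, Complex.re_sum]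
    refine Finset.sum_congr rfl fun i _ => ?_
    rw [Complex.re_sum]
    refine Finset.sum_congr rfl fun j _ => ?_
    by_cases hi : y ∈ (B i).carrier <;> by_cases hj : y ∈ (B j).carrier <;> simp [hi, hj]
  simp only [h1]
  exact hasSum_sum fun i _ => hasSum_sum fun j _ =>
    (hasSum_indicator_fiber ((B i).injOn_src.mono inter_subset_left) u).mul_left _

theorem tsum_fiber_enorm_sq {ι : Type*} (I : Finset ι) (c : ι → ℂ) (B : ι → 𝒢.Bisection) (u : G) :
    ∑' y : 𝒢.src ⁻¹' {u}, ‖∑ i ∈ I, c i * (B i).carrier.indicator (1 : G → ℂ) y‖ₑ ^ 2 =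
      ENNReal.ofReal (∑ i ∈ I, ∑ j ∈ I, (star (c i) * c j).re *
        (𝒢.src '' ((B i).carrier ∩ (B j).carrier)).indicator (1 : G → ℝ) u) := by
  have h2 := hasSum_fiber_norm_sq I c B u
  rw [← h2.tsum_eq, ENNReal.ofReal_tsum_of_nonneg (fun _ => by positivity) h2.summable]
  refine tsum_congr fun y => ?_
  rw [ENNReal.ofReal_pow (norm_nonneg _), ofReal_norm]

theorem Bisection.measurableSet_src_image_inter (B C : 𝒢.Bisection) :
    MeasurableSet (𝒢.src '' (B.carrier ∩ C.carrier)) :=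
  (B.measurableSet.inter C.measurableSet).image_of_measurable_injOn 𝒢.measurable_src
    (B.injOn_src.mono inter_subset_left)

theorem measurable_fiber_gram {ι : Type*} (I : Finset ι) (c : ι → ℂ) (B : ι → 𝒢.Bisection) :
    Measurable fun u => ∑ i ∈ I, ∑ j ∈ I, (star (c i) * c j).re *
        (𝒢.src '' ((B i).carrier ∩ (B j).carrier)).indicator (1 : G → ℝ) u :=
  Finset.measurable_sum _ fun _ _ => Finset.measurable_sum _ fun _ _ =>
    (measurable_one.indicator (Bisection.measurableSet_src_image_inter _ _)).const_mul _

theorem twoNorm_coe (f : G → ℂ) : twoNorm (f : 𝒢.Fun) =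
    (∫⁻ x, ∑' y : 𝒢.src ⁻¹' {x}, ‖f y‖ₑ ^ 2 ∂𝒢.μ) ^ (1 / 2 : ℝ) :=
  rfl

/-- The 2-norm on the span depends only on the numbers τ(s*t), which good models reproduce. The
source is injective on each intersection, so a fibre meets it at most once and every fibre sum is
finite. -/
theorem twoNorm_sum_sq {ι : Type*} (I : Finset ι) (c : ι → ℂ) (s : ι → 𝒢.PartialIsom) :
    twoNorm (∑ i ∈ I, c i • (s i).ind) ^ 2 =
      ENNReal.ofReal (∑ i ∈ I, ∑ j ∈ I, (star (c i) * c j).re * gram (s i) (s j)) := by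
  choose B hB using fun i => (s i).exists_rep
  obtain rfl : s = fun i => PartialIsom.mk (B i) := funext fun i => (hB i).symm
  rw [PartialIsom.sum_smul_ind, twoNorm_coe, ← ENNReal.rpow_natCast, ← ENNReal.rpow_mul]
  norm_num only [ENNReal.rpow_one]
  simp only [tsum_fiber_enorm_sq]
  have hint : ∀ i j, Integrable
      ((𝒢.src '' ((B i).carrier ∩ (B j).carrier)).indicator (1 : G → ℝ)) 𝒢.μ := fun i j =>
    (integrable_const (1 : ℝ)).indicator (Bisection.measurableSet_src_image_inter _ _)
  rw [← ofReal_integral_eq_lintegral_ofReal]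
  · congr 1
    rw [integral_finsetSum _ fun i _ => integrable_finsetSum _ fun j _ =>
      (hint i j).const_mul _]
    refine Finset.sum_congr rfl fun i _ => ?_
    rw [integral_finsetSum _ fun j _ => (hint i j).const_mul _]
    refine Finset.sum_congr rfl fun j _ => ?_
    rw [integral_const_mul, integral_indicator_one (Bisection.measurableSet_src_image_inter _ _),
      gram_mk]
  · exact integrable_finsetSum _ fun i _ => integrable_finsetSum _ fun j _ =>
      (hint i j).const_mul _
  · exact Eventually.of_forall fun u =>
      (hasSum_fiber_norm_sq I c B u).nonneg fun _ => by positivity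

/-- Minkowski's inequality is applied on each fibre with counting measure and then on the unit
space. Membership in the span supplies representatives whose fibre sums are measurable. -/
theorem twoNorm_add_le {x y : 𝒢.Fun} (hx : x ∈ 𝒢.Span) (hy : y ∈ 𝒢.Span) :
    twoNorm (x + y) ≤ twoNorm x + twoNorm y := by
  have key : ∀ x ∈ 𝒢.Span, ∃ f : G → ℂ, (f : 𝒢.Fun) = x ∧
      Measurable fun u => ∑' y : 𝒢.src ⁻¹' {u}, ‖f y‖ₑ ^ 2 := by
    intro x hx
    obtain ⟨n, c, s, rfl⟩ := Submodule.mem_span_set'.1 hx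
    choose t ht using fun i => (s i).2
    choose B hB using fun i => (t i).exists_rep
    refine ⟨_, (PartialIsom.sum_smul_ind Finset.univ c B).symm.trans ?_, ?_⟩
    · refine Finset.sum_congr rfl fun i _ => ?_
      rw [hB, ht]
    · simp only [tsum_fiber_enorm_sq]
      exact (measurable_fiber_gram _ _ _).ennreal_ofReal
  obtain ⟨f, rfl, hf⟩ := key x hx
  obtain ⟨g, rfl, hg⟩ := key y hy
  rw [← Germ.coe_add, twoNorm_coe, twoNorm_coe, twoNorm_coe]
  have hfib : ∀ u, (∑' y : 𝒢.src ⁻¹' {u}, ‖(f + g) y‖ₑ ^ 2) ^ (1 / 2 : ℝ) ≤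
      (∑' y : 𝒢.src ⁻¹' {u}, ‖f y‖ₑ ^ 2) ^ (1 / 2 : ℝ) +
        (∑' y : 𝒢.src ⁻¹' {u}, ‖g y‖ₑ ^ 2) ^ (1 / 2 : ℝ) := by
    intro u
    -- With the discrete σ-algebra every function on the fibre is measurable.
    let _ : MeasurableSpace (𝒢.src ⁻¹' {u}) := ⊤
    have h := ENNReal.lintegral_Lp_add_le (μ := Measure.count) (p := 2)
      (f := fun y : 𝒢.src ⁻¹' {u} => ‖f y‖ₑ) (g := fun y : 𝒢.src ⁻¹' {u} => ‖g y‖ₑ)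
      (measurable_from_top.aemeasurable) (measurable_from_top.aemeasurable) (by norm_num)
    simp only [lintegral_count' measurable_from_top, Pi.add_apply, ENNReal.rpow_two] at h
    refine le_trans ?_ h
    gcongr with y
    exact enorm_add_le _ _
  have h := ENNReal.lintegral_Lp_add_le (μ := 𝒢.μ) (p := 2)
    (hf.pow_const (1 / 2 : ℝ)).aemeasurable (hg.pow_const (1 / 2 : ℝ)).aemeasurable (by norm_num)
  have hsq : ∀ a : ℝ≥0∞, (a ^ (1 / 2 : ℝ)) ^ (2 : ℝ) = a := fun a => by
    rw [← ENNReal.rpow_mul]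
    norm_num
  simp only [hsq] at h
  refine le_trans ?_ h
  gcongr with u
  rw [← hsq (∑' y : 𝒢.src ⁻¹' {u}, ‖(f + g) y‖ₑ ^ 2)]
  gcongr
  exact hfib u

theorem twoNorm_sum_le {ι : Type*} (I : Finset ι) {x : ι → 𝒢.Fun} (hx : ∀ i, x i ∈ 𝒢.Span) :
    twoNorm (∑ i ∈ I, x i) ≤ ∑ i ∈ I, twoNorm (x i) := by
  classical
  induction I using Finset.induction_on with
  | empty =>
    have := twoNorm_sum_sq (𝒢 := 𝒢) (∅ : Finset Empty) (fun _ => 0) (fun _ => 1)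
    simpa using this
  | insert i I hi ih =>
    rw [Finset.sum_insert hi, Finset.sum_insert hi]
    exact (twoNorm_add_le (hx i) (Submodule.sum_mem _ fun j _ => hx j)).trans (by gcongr)

theorem PartialIsom.ind_mem_span (s : 𝒢.PartialIsom) : s.ind ∈ 𝒢.Span :=
  Submodule.subset_span (mem_range_self s)

theorem twoNorm_sub_sq (s t : 𝒢.PartialIsom) :
    twoNorm (s.ind - t.ind) ^ 2 = ENNReal.ofReal (gram s s - 2 * gram s t + gram t t) := by
  have := twoNorm_sum_sq (Finset.univ : Finset Bool) (fun b => if b then 1 else -1)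
    (fun b => if b then s else t)
  simp only [Fintype.sum_bool] at this
  simp only [if_true, one_smul, neg_smul, ← sub_eq_add_neg, Bool.false_eq_true, if_false] at this
  rw [this]
  congr 1
  simp [gram_comm t s]
  ring

theorem twoNorm_sub_comm (s t : 𝒢.PartialIsom) :
    twoNorm (s.ind - t.ind) = twoNorm (t.ind - s.ind) := by
  refine (ENNReal.pow_right_strictMono two_ne_zero).injective (?_ : _ ^ 2 = _ ^ 2)
  rw [twoNorm_sub_sq, twoNorm_sub_sq, gram_comm s t]
  ring_nf

theorem twoNorm_star_sub_star (s t : 𝒢.PartialIsom) :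
    twoNorm ((star s).ind - (star t).ind) = twoNorm (s.ind - t.ind) := by
  refine (ENNReal.pow_right_strictMono two_ne_zero).injective (?_ : _ ^ 2 = _ ^ 2)
  rw [twoNorm_sub_sq, twoNorm_sub_sq, gram_star, gram_star, gram_star]

/-- The mass of the sources of the symmetric difference. -/
theorem gram_sub (B C : 𝒢.Bisection) :
    gram (PartialIsom.mk B) (PartialIsom.mk B) - 2 * gram (PartialIsom.mk B) (PartialIsom.mk C) +
      gram (PartialIsom.mk C) (PartialIsom.mk C) =
    𝒢.μ.real (𝒢.src '' (B.carrier \ C.carrier)) + 𝒢.μ.real (𝒢.src '' (C.carrier \ B.carrier)) := by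
  have key : ∀ B C : 𝒢.Bisection, 𝒢.μ.real (𝒢.src '' (B.carrier ∩ B.carrier)) =
      𝒢.μ.real (𝒢.src '' (B.carrier ∩ C.carrier)) +
        𝒢.μ.real (𝒢.src '' (B.carrier \ C.carrier)) := by
    intro B C
    rw [← measureReal_union, ← image_union, inter_union_sdiff, inter_self]
    · rw [disjoint_left]
      rintro _ ⟨x, hx, rfl⟩ ⟨y, hy, hxy⟩
      obtain rfl := B.injOn_src hy.1 hx.1 hxy
      exact hy.2 hx.2
    · exact (B.measurableSet.diff C.measurableSet).image_of_measurable_injOn 𝒢.measurable_src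
        (B.injOn_src.mono sdiff_subset)
  have h1 := key B C
  have h2 := key C B
  rw [inter_comm C.carrier B.carrier] at h2
  rw [gram_mk, gram_mk, gram_mk]
  linarith

/-- The squared distance is the mass of the sources of the symmetric difference, and the sources of
BC \ BD lie among those of C \ D. -/
theorem twoNorm_mul_sub_mul_left_le (s t t' : 𝒢.PartialIsom) :
    twoNorm ((s * t).ind - (s * t').ind) ≤ twoNorm (t.ind - t'.ind) := by
  refine (ENNReal.pow_le_pow_left_iff two_ne_zero).1 ?_
  obtain ⟨B, rfl⟩ := s.exists_rep
  obtain ⟨C, rfl⟩ := t.exists_rep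
  obtain ⟨D, rfl⟩ := t'.exists_rep
  rw [twoNorm_sub_sq, twoNorm_sub_sq, PartialIsom.mk_mul_mk, PartialIsom.mk_mul_mk, gram_sub,
    gram_sub]
  have key : ∀ C D : 𝒢.Bisection, 𝒢.src '' ((B.mul C).carrier \ (B.mul D).carrier) ⊆
      𝒢.src '' (C.carrier \ D.carrier) := by
    rintro C D _ ⟨_, ⟨⟨x, hx, y, hy, h, rfl⟩, hD⟩, rfl⟩
    exact ⟨y, ⟨hy, fun hyD => hD ⟨x, hx, y, hyD, h, rfl⟩⟩, (𝒢.src_mul x y h).symm⟩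
  exact ENNReal.ofReal_le_ofReal
    (add_le_add (measureReal_mono (key C D)) (measureReal_mono (key D C)))

theorem twoNorm_mul_sub_mul_right_le (s s' t : 𝒢.PartialIsom) :
    twoNorm ((s * t).ind - (s' * t).ind) ≤ twoNorm (s.ind - s'.ind) := by
  rw [← twoNorm_star_sub_star, star_mul, star_mul, ← twoNorm_star_sub_star s]
  exact twoNorm_mul_sub_mul_left_le _ _ _

theorem twoNorm_mul_sub_mul_le (s s' t t' : 𝒢.PartialIsom) :
    twoNorm ((s * t).ind - (s' * t').ind) ≤ twoNorm (s.ind - s'.ind) + twoNorm (t.ind - t'.ind) := by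
  have h : (s * t).ind - (s' * t').ind =
      ((s * t).ind - (s' * t).ind) + ((s' * t).ind - (s' * t').ind) := by abel
  rw [h]
  refine (twoNorm_add_le (Submodule.sub_mem _ (PartialIsom.ind_mem_span _)
    (PartialIsom.ind_mem_span _)) (Submodule.sub_mem _ (PartialIsom.ind_mem_span _)
    (PartialIsom.ind_mem_span _))).trans ?_
  exact add_le_add (twoNorm_mul_sub_mul_right_le _ _ _) (twoNorm_mul_sub_mul_left_le _ _ _)

theorem trace_ind_eq_sum {ι : Type*} {I : Finset ι} {t : 𝒢.PartialIsom}
    {w : ι → 𝒢.PartialIsom} (h : t.ind = ∑ i ∈ I, (w i).ind) :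
    trace t.ind = ∑ i ∈ I, trace (w i).ind := by
  obtain ⟨C, rfl⟩ := t.exists_rep
  choose D hD using fun i => (w i).exists_rep
  obtain rfl : w = fun i => PartialIsom.mk (D i) := funext fun i => (hD i).symm
  have h' := ae_eq_of_eventuallyEq ((PartialIsom.ind_eq_sum_iff I C D).1 h)
  change ∫ x, C.carrier.indicator (1 : G → ℂ) x ∂𝒢.μ =
    ∑ i ∈ I, ∫ x, (D i).carrier.indicator (1 : G → ℂ) x ∂𝒢.μ
  rw [integral_congr_ae h', integral_finsetSum]
  exact fun i _ => (integrable_const (1 : ℂ)).indicator (D i).measurableSet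

/-- The units of B outside C are among the sources of B \ C, whose mass is part of the squared
distance. -/
theorem norm_trace_sub_le (s t : 𝒢.PartialIsom) :
    ENNReal.ofReal ‖trace s.ind - trace t.ind‖ ≤ twoNorm (s.ind - t.ind) ^ 2 := by
  obtain ⟨B, rfl⟩ := s.exists_rep
  obtain ⟨C, rfl⟩ := t.exists_rep
  rw [twoNorm_sub_sq, gram_sub, trace_ind_mk, trace_ind_mk, ← Complex.ofReal_sub,
    Complex.norm_real]
  refine ENNReal.ofReal_le_ofReal ?_
  have key : ∀ B C : 𝒢.Bisection, 𝒢.μ.real (B.carrier ∩ 𝒢.units) ≤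
      𝒢.μ.real (C.carrier ∩ 𝒢.units) + 𝒢.μ.real (𝒢.src '' (B.carrier \ C.carrier)) := by
    intro B C
    refine (measureReal_mono ?_).trans (measureReal_union_le _ _)
    rintro z ⟨hz, hu⟩
    by_cases hC : z ∈ C.carrier
    · exact Or.inl ⟨hC, hu⟩
    · exact Or.inr ⟨z, ⟨hz, hC⟩, hu⟩
  have h1 := key B C
  have h2 := key C B
  have h3 : 0 ≤ 𝒢.μ.real (𝒢.src '' (B.carrier \ C.carrier)) := measureReal_nonneg
  have h4 : 0 ≤ 𝒢.μ.real (𝒢.src '' (C.carrier \ B.carrier)) := measureReal_nonneg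
  rw [Real.norm_eq_abs, abs_le]
  constructor <;> linarith

end PMPGroupoid

/-! ### Rounding a nearly orthogonal sum to one partial permutation. -/

section Rounding

variable {d : ℕ}

theorem matrixTwoNorm_smul (c : ℂ) (A : Matrix (Fin d) (Fin d) ℂ) :
    matrixTwoNorm (c • A) = ‖c‖ * matrixTwoNorm A := by
  refine (pow_left_inj₀ (matrixTwoNorm_nonneg _)
    (mul_nonneg (norm_nonneg c) (matrixTwoNorm_nonneg _)) two_ne_zero).1 ?_
  rw [mul_pow, matrixTwoNorm_sq, matrixTwoNorm_sq, mul_div_assoc', Finset.mul_sum]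
  congr 1
  refine Finset.sum_congr rfl fun i _ => ?_
  rw [Finset.mul_sum]
  refine Finset.sum_congr rfl fun j _ => ?_
  rw [Matrix.smul_apply, smul_eq_mul, norm_mul, mul_pow]

/-- `exists_orthogonal_rounding` is used for all pairs of distinct indices, with γ the total of
their defects. The explicit bound tends to zero with the defects. -/
theorem exists_mem_partialPermMatrices_sum_sub_le {ι : Type*} [Fintype ι] [DecidableEq ι]
    {Q : ι → Matrix (Fin d) (Fin d) ℂ} (hQ : ∀ a, Q a ∈ partialPermMatrices d) :
    ∃ T ∈ partialPermMatrices d, matrixTwoNorm (∑ a, Q a - T) ≤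
      Fintype.card ι * √(2 * (Fintype.card ι) ^ 2 * ∑ p : ι × ι, if p.1 = p.2 then 0 else
        (matrixTwoNorm ((Q p.1)ᴴ * Q p.2) ^ 2 + matrixTwoNorm (Q p.1 * (Q p.2)ᴴ) ^ 2)) := by
  set f : ι × ι → ℝ := fun p => if p.1 = p.2 then 0 else
    (matrixTwoNorm ((Q p.1)ᴴ * Q p.2) ^ 2 + matrixTwoNorm (Q p.1 * (Q p.2)ᴴ) ^ 2) with hf
  have hf0 : ∀ p, 0 ≤ f p := fun p => by
    simp only [hf]
    split_ifs <;> positivity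
  have hle : ∀ a b, a ≠ b →
      matrixTwoNorm ((Q a)ᴴ * Q b) ^ 2 + matrixTwoNorm (Q a * (Q b)ᴴ) ^ 2 ≤ ∑ p, f p := by
    intro a b hab
    refine le_trans (le_of_eq ?_)
      (Finset.single_le_sum (fun p _ => hf0 p) (Finset.mem_univ (a, b)))
    simp [hf, hab]
  obtain ⟨P, hP, horth, hPQ⟩ := exists_orthogonal_rounding (fun a b => a ≠ b) hQ
    (fun a b hab => le_trans (le_add_of_nonneg_right (by positivity)) (hle a b hab))
    (fun a b hab => le_trans (le_add_of_nonneg_left (by positivity)) (hle a b hab))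
    (Finset.sum_nonneg fun p _ => hf0 p)
  refine ⟨∑ a, P a, sum_mem_partialPermMatrices (fun a _ => hP a)
    fun a _ b _ hab => horth a b hab, ?_⟩
  rw [← Finset.sum_sub_distrib]
  refine (matrixTwoNorm_sum_le _ _).trans ?_
  refine (Finset.sum_le_card_nsmul _ _ _ fun a _ => Real.le_sqrt_of_sq_le (hPQ a)).trans ?_
  rw [nsmul_eq_mul, Finset.card_univ]

end Rounding

/-! ### Words and their asymptotic behaviour along the filter of models. -/

namespace PMPGroupoid

variable {G : Type*} [MeasurableSpace G] [StandardBorelSpace G] {𝒢 : PMPGroupoid G}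

theorem PartialIsom.toSpan_eq_sum {ι : Type*} {I : Finset ι} {t : 𝒢.PartialIsom}
    {w : ι → 𝒢.PartialIsom} (h : t.ind = ∑ i ∈ I, (w i).ind) :
    t.toSpan = ∑ i ∈ I, (w i).toSpan := by
  apply Subtype.ext
  rw [AddSubmonoidClass.coe_finsetSum]
  exact h

theorem PartialIsom.toSpan_eq_zero {t : 𝒢.PartialIsom} (h : t.ind = 0) : t.toSpan = 0 :=
  Subtype.ext h

/-- The words in the letters of `Ω` and their adjoints. -/
def words (Ω : Set 𝒢.PartialIsom) : Set 𝒢.PartialIsom := ⋃ n ≥ 1, (Ω ∪ star Ω) ^ n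

theorem mem_words_iff {Ω : Set 𝒢.PartialIsom} {s : 𝒢.PartialIsom} :
    s ∈ words Ω ↔ ∃ n ≥ 1, s ∈ (Ω ∪ star Ω) ^ n := by
  simp [words]

theorem subset_words (Ω : Set 𝒢.PartialIsom) : Ω ⊆ words Ω := fun s hs =>
  mem_words_iff.2 ⟨1, le_rfl, by rw [pow_one]; exact Or.inl hs⟩

theorem mul_mem_words {Ω : Set 𝒢.PartialIsom} {s t : 𝒢.PartialIsom} (hs : s ∈ words Ω)
    (ht : t ∈ words Ω) : s * t ∈ words Ω := by
  obtain ⟨n, hn, hs⟩ := mem_words_iff.1 hs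
  obtain ⟨m, hm, ht⟩ := mem_words_iff.1 ht
  exact mem_words_iff.2 ⟨n + m, by omega, by rw [pow_add]; exact mul_mem_mul hs ht⟩

theorem star_mem_union_pow {Ω : Set 𝒢.PartialIsom} {n : ℕ} {s : 𝒢.PartialIsom}
    (hs : s ∈ (Ω ∪ star Ω) ^ n) : star s ∈ (Ω ∪ star Ω) ^ n := by
  induction n generalizing s with
  | zero =>
    rw [pow_zero, Set.mem_one] at hs ⊢
    rw [hs, star_one]
  | succ n ih =>
    rw [pow_succ] at hs
    obtain ⟨x, hx, y, hy, rfl⟩ := hs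
    rw [pow_succ']
    change star (x * y) ∈ _
    rw [star_mul]
    refine mul_mem_mul ?_ (ih hx)
    rcases hy with hy | hy
    · right
      rwa [mem_star, star_star]
    · exact Or.inl hy

theorem star_mem_words {Ω : Set 𝒢.PartialIsom} {s : 𝒢.PartialIsom} (hs : s ∈ words Ω) :
    star s ∈ words Ω := by
  obtain ⟨n, hn, hs⟩ := mem_words_iff.1 hs
  exact mem_words_iff.2 ⟨n, hn, star_mem_union_pow hs⟩

/-- A word is the product of a nonempty list of letters, which come from finitely many elements. -/
theorem exists_list_of_mem_words {Ω : Set 𝒢.PartialIsom} {s : 𝒢.PartialIsom} (hs : s ∈ words Ω) :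
    ∃ F : Set 𝒢.PartialIsom, F.Finite ∧ F ⊆ Ω ∧ ∃ l : List 𝒢.PartialIsom, l ≠ [] ∧
      (∀ x ∈ l, x ∈ F ∪ star F) ∧ l.prod = s := by
  obtain ⟨n, hn, hs⟩ := mem_words_iff.1 hs
  obtain ⟨f, rfl⟩ := Set.mem_pow.1 hs
  -- A letter may lie in Ω or only in Ω*. Adding the adjoints and intersecting with Ω keeps
  -- whichever of x and x* belongs to Ω.
  refine ⟨Ω ∩ (range (fun i => (f i).1) ∪ star (range fun i => (f i).1)), ?_, inter_subset_left,
    List.ofFn fun i => (f i).1, ?_, ?_, rfl⟩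
  · refine Finite.subset ?_ inter_subset_right
    refine (finite_range _).union ?_
    rw [← Set.image_star (s := range fun i => (f i).1)]
    exact (finite_range _).image _
  · intro h
    have := congrArg List.length h
    simp at this
    omega
  · intro x hx
    obtain ⟨i, rfl⟩ := List.mem_ofFn.1 hx
    rcases (f i).2 with h | h
    · exact Or.inl ⟨h, Or.inl (mem_range_self i)⟩
    · exact Or.inr ⟨h, Or.inr (by rw [mem_star, star_star]; exact mem_range_self i)⟩

theorem list_prod_mem_pow {F : Set 𝒢.PartialIsom} {l : List 𝒢.PartialIsom}
    (hl : ∀ x ∈ l, x ∈ F) : l.prod ∈ F ^ l.length := by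
  induction l with
  | nil => simp
  | cons a l ih =>
    rw [List.prod_cons, List.length_cons, pow_succ']
    exact mul_mem_mul (hl a (by simp)) (ih fun x hx => hl x (by simp [hx]))

theorem IsApproxMultiplicative.list_prod {F : Set 𝒢.PartialIsom} {n : ℕ} {δ : ℝ} {d : ℕ}
    {φ : 𝒢.Span →ₗ[ℂ] Matrix (Fin d) (Fin d) ℂ} (h : IsApproxMultiplicative F n δ φ)
    {l : List 𝒢.PartialIsom} (hl0 : l ≠ []) (hln : l.length ≤ n) (hl : ∀ x ∈ l, x ∈ F) :
    matrixTwoNorm (φ l.prod.toSpan - (l.map fun s => φ s.toSpan).prod) < δ := by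
  have := h l.length (List.length_pos_of_ne_nil hl0) hln l.get fun i => hl _ (List.get_mem l i)
  have e : (List.ofFn fun i => φ (l.get i).toSpan) = l.map fun s => φ s.toSpan := by
    conv_rhs => rw [← List.ofFn_get l, List.map_ofFn]
    rfl
  rwa [List.ofFn_get, e] at this

theorem SA_subset_SA {F F' : Set 𝒢.PartialIsom} {n n' : ℕ} {δ δ' : ℝ} (hF : F ⊆ F') (hn : n ≤ n')
    (hδ : δ' ≤ δ) (d : ℕ) : SA F' n' δ' d ⊆ SA F n δ d := by
  have hFF : F ∪ star F ⊆ F' ∪ star F' := union_subset_union hF fun x hx => hF hx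
  rintro φ ⟨h1, h2⟩
  refine ⟨fun k hk hkn s hs => (h1 k hk (hkn.trans hn) s fun i => hFF (hs i)).trans_le hδ,
    fun k hk hkn s hs => ?_⟩
  obtain ⟨h3, h4⟩ := h2 k hk (hkn.trans hn) s (Set.pow_subset_pow_left hFF hs)
  exact ⟨h3, h4.trans_le hδ⟩

variable (𝒢) in
/-- Linear maps from `[I_𝒢]` to matrix algebras. -/
abbrev MatrixModel : Type _ := Σ d : ℕ, 𝒢.Span →ₗ[ℂ] Matrix (Fin d) (Fin d) ℂ

/-- The filter generated by the sets `⋃ d, SA(F, n, δ, d)` with `F ⊆ Ω` finite. -/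
def modelFilter (Ω : Set 𝒢.PartialIsom) : Filter 𝒢.MatrixModel where
  sets := {U | ∃ F : Set 𝒢.PartialIsom, F.Finite ∧ F ⊆ Ω ∧ ∃ n : ℕ, 1 ≤ n ∧ ∃ δ : ℝ, 0 < δ ∧
    ∀ d, ∀ φ ∈ SA F n δ d, (⟨d, φ⟩ : 𝒢.MatrixModel) ∈ U}
  univ_sets := ⟨∅, finite_empty, empty_subset _, 1, le_rfl, 1, one_pos, fun _ _ _ => trivial⟩
  sets_of_superset := by
    rintro U V ⟨F, hF, hFΩ, n, hn, δ, hδ, h⟩ hUV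
    exact ⟨F, hF, hFΩ, n, hn, δ, hδ, fun d φ hφ => hUV (h d φ hφ)⟩
  inter_sets := by
    rintro U V ⟨F, hF, hFΩ, n, hn, δ, hδ, h⟩ ⟨F', hF', hFΩ', n', hn', δ', hδ', h'⟩
    refine ⟨F ∪ F', hF.union hF', union_subset hFΩ hFΩ', max n n', hn.trans (le_max_left _ _),
      min δ δ', lt_min hδ hδ', fun d φ hφ => ⟨?_, ?_⟩⟩
    · exact h d φ (SA_subset_SA subset_union_left (le_max_left _ _) (min_le_left _ _) d hφ)
    · exact h' d φ (SA_subset_SA subset_union_right (le_max_right _ _) (min_le_right _ _) d hφ)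

theorem eventually_modelFilter_iff {Ω : Set 𝒢.PartialIsom} {P : 𝒢.MatrixModel → Prop} :
    (∀ᶠ p in modelFilter Ω, P p) ↔ ∃ F : Set 𝒢.PartialIsom, F.Finite ∧ F ⊆ Ω ∧ ∃ n : ℕ, 1 ≤ n ∧
      ∃ δ : ℝ, 0 < δ ∧ ∀ d, ∀ φ ∈ SA F n δ d, P ⟨d, φ⟩ :=
  Iff.rfl

theorem eventually_mem_SA {Ω F : Set 𝒢.PartialIsom} (hF : F.Finite) (hFΩ : F ⊆ Ω) {n : ℕ}
    (hn : 1 ≤ n) {δ : ℝ} (hδ : 0 < δ) : ∀ᶠ p in modelFilter Ω, p.2 ∈ SA F n δ p.1 :=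
  eventually_modelFilter_iff.2 ⟨F, hF, hFΩ, n, hn, δ, hδ, fun _ _ h => h⟩

section Words

variable {Ω : Set 𝒢.PartialIsom}

theorem eventually_mem_partialPermMatrices {s : 𝒢.PartialIsom} (hs : s ∈ words Ω) :
    ∀ᶠ p in modelFilter Ω, p.2 s.toSpan ∈ partialPermMatrices p.1 := by
  obtain ⟨F, hF, hFΩ, l, hl0, hl, rfl⟩ := exists_list_of_mem_words hs
  have hlen := List.length_pos_of_ne_nil hl0
  filter_upwards [eventually_mem_SA hF hFΩ hlen one_pos] with p hp
  exact (hp.2 _ hlen le_rfl _ (list_prod_mem_pow hl)).1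

theorem tendsto_normalizedTrace_words {s : 𝒢.PartialIsom} (hs : s ∈ words Ω) :
    Tendsto (fun p : 𝒢.MatrixModel => normalizedTrace (p.2 s.toSpan)) (modelFilter Ω)
      (nhds (trace s.ind)) := by
  obtain ⟨F, hF, hFΩ, l, hl0, hl, rfl⟩ := exists_list_of_mem_words hs
  have hlen := List.length_pos_of_ne_nil hl0
  refine Metric.tendsto_nhds.2 fun ε hε => ?_
  filter_upwards [eventually_mem_SA hF hFΩ hlen hε] with p hp
  rw [dist_eq_norm]
  exact (hp.2 _ hlen le_rfl _ (list_prod_mem_pow hl)).2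

/-- Write s and t as lists of letters. Multiplicativity on each list and on their concatenation
compares φ(s), φ(t) and φ(st) with products of letter values, at a cost of ε/3 each. -/
theorem tendsto_matrixTwoNorm_mul_words {s t : 𝒢.PartialIsom} (hs : s ∈ words Ω)
    (ht : t ∈ words Ω) :
    Tendsto (fun p : 𝒢.MatrixModel =>
      matrixTwoNorm (p.2 (s * t).toSpan - p.2 s.toSpan * p.2 t.toSpan)) (modelFilter Ω)
      (nhds 0) := by
  have hsI := eventually_mem_partialPermMatrices hs
  obtain ⟨F, hF, hFΩ, l, hl0, hl, rfl⟩ := exists_list_of_mem_words hs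
  obtain ⟨F', hF', hFΩ', l', hl0', hl', rfl⟩ := exists_list_of_mem_words ht
  have hlen := List.length_pos_of_ne_nil hl0
  have hlen' := List.length_pos_of_ne_nil hl0'
  have hsub : F ∪ star F ⊆ (F ∪ F') ∪ star (F ∪ F') :=
    union_subset_union subset_union_left fun x hx => subset_union_left (show star x ∈ F from hx)
  have hsub' : F' ∪ star F' ⊆ (F ∪ F') ∪ star (F ∪ F') :=
    union_subset_union subset_union_right fun x hx =>
      subset_union_right (show star x ∈ F' from hx)
  refine Metric.tendsto_nhds.2 fun ε hε => ?_
  filter_upwards [hsI, eventually_mem_SA (hF.union hF') (union_subset hFΩ hFΩ')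
    (n := l.length + l'.length) (by omega) (δ := ε / 3) (by positivity)] with p hpI hp
  rw [Real.dist_0_eq_abs, abs_of_nonneg (matrixTwoNorm_nonneg _)]
  have h1 := hp.1.list_prod hl0 (by omega) fun x hx => hsub (hl x hx)
  have h2 := hp.1.list_prod hl0' (by omega) fun x hx => hsub' (hl' x hx)
  have h3 := hp.1.list_prod (l := l ++ l') (by simp [hl0]) (by simp) fun x hx =>
    (List.mem_append.1 hx).elim (fun hx => hsub (hl x hx)) fun hx => hsub' (hl' x hx)
  rw [List.prod_append, List.map_append, List.prod_append] at h3
  have hI' : (l'.map fun s => p.2 s.toSpan).prod ∈ partialPermMatrices p.1 := by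
    refine list_prod_mem_partialPermMatrices fun A hA => ?_
    obtain ⟨x, hx, rfl⟩ := List.mem_map.1 hA
    exact (hp.2 1 le_rfl (by omega) x (by rw [pow_one]; exact hsub' (hl' x hx))).1
  have h4 := matrixTwoNorm_mul_sub_mul_le (Q := p.2 l'.prod.toSpan)
    (P' := (l.map fun s => p.2 s.toSpan).prod) hpI hI'
  have h5 := matrixTwoNorm_sub_le (p.2 (l.prod * l'.prod).toSpan)
    ((l.map fun s => p.2 s.toSpan).prod * (l'.map fun s => p.2 s.toSpan).prod)
    (p.2 l.prod.toSpan * p.2 l'.prod.toSpan)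
  rw [matrixTwoNorm_sub_comm (_ * _) (p.2 l.prod.toSpan * _)] at h5
  linarith

/-- Models are not assumed to respect adjoints. The relations s s* s = s and s* s s* = s* hold
approximately for the values, and `matrixTwoNorm_sub_conjTranspose_sq_le` applies. -/
theorem tendsto_matrixTwoNorm_star_words {s : 𝒢.PartialIsom} (hs : s ∈ words Ω) :
    Tendsto (fun p : 𝒢.MatrixModel =>
      matrixTwoNorm (p.2 (star s).toSpan - (p.2 s.toSpan)ᴴ)) (modelFilter Ω) (nhds 0) := by
  have key : ∀ s ∈ words Ω, Tendsto (fun p : 𝒢.MatrixModel => matrixTwoNorm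
      (p.2 s.toSpan * p.2 (star s).toSpan * p.2 s.toSpan - p.2 s.toSpan)) (modelFilter Ω)
      (nhds 0) := by
    intro s hs
    have h1 := tendsto_matrixTwoNorm_mul_words hs (star_mem_words hs)
    have h2 := tendsto_matrixTwoNorm_mul_words (mul_mem_words hs (star_mem_words hs)) hs
    rw [PartialIsom.mul_star_mul] at h2
    refine squeeze_zero' (Eventually.of_forall fun p => matrixTwoNorm_nonneg _) ?_
      (by simpa using h1.add h2)
    filter_upwards [eventually_mem_partialPermMatrices hs] with p hp
    have h3 := matrixTwoNorm_sub_le (p.2 s.toSpan * p.2 (star s).toSpan * p.2 s.toSpan)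
      (p.2 (s * star s).toSpan * p.2 s.toSpan) (p.2 s.toSpan)
    have h4 := matrixTwoNorm_mul_le_left hp
      (p.2 s.toSpan * p.2 (star s).toSpan - p.2 (s * star s).toSpan)
    rw [Matrix.sub_mul] at h4
    rw [matrixTwoNorm_sub_comm (p.2 (s * star s).toSpan)]
    rw [matrixTwoNorm_sub_comm (p.2 s.toSpan) (p.2 (s * star s).toSpan * p.2 s.toSpan)]
    linarith
  have h1 := key s hs
  have h2 := key (star s) (star_mem_words hs)
  rw [star_star] at h2
  have h3 := (h1.add h2).sqrt
  rw [add_zero, Real.sqrt_zero] at h3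
  refine squeeze_zero' (Eventually.of_forall fun p => matrixTwoNorm_nonneg _) ?_ h3
  filter_upwards [eventually_mem_partialPermMatrices hs,
    eventually_mem_partialPermMatrices (star_mem_words hs)] with p hp hp'
  exact Real.le_sqrt_of_sq_le (matrixTwoNorm_sub_conjTranspose_sq_le hp hp')

end Words

end PMPGroupoid

/-! ### Sums of words and asymptotic models by partial permutations. -/

namespace PMPGroupoid

variable {G : Type*} [MeasurableSpace G] [StandardBorelSpace G] {𝒢 : PMPGroupoid G}

theorem mem_finiteSums_of_eq_sum {S : Set 𝒢.PartialIsom} {ι : Type*} {I : Finset ι}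
    {t : 𝒢.PartialIsom} {w : ι → 𝒢.PartialIsom} (hw : ∀ i ∈ I, w i ∈ S)
    (h : t.ind = ∑ i ∈ I, (w i).ind) : t ∈ finiteSums S := by
  change t.ind ∈ AddSubmonoid.closure (PartialIsom.ind '' S)
  rw [h]
  exact sum_mem fun i hi => AddSubmonoid.subset_closure (mem_image_of_mem _ (hw i hi))

theorem exists_of_mem_finiteSums {S : Set 𝒢.PartialIsom} {t : 𝒢.PartialIsom}
    (ht : t ∈ finiteSums S) : ∃ (m : ℕ) (w : Fin m → 𝒢.PartialIsom), (∀ i, w i ∈ S) ∧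
      t.ind = ∑ i, (w i).ind := by
  have key : ∀ x ∈ AddSubmonoid.closure (PartialIsom.ind '' S), ∃ l : List 𝒢.PartialIsom,
      (∀ w ∈ l, w ∈ S) ∧ x = (l.map PartialIsom.ind).sum := by
    intro x hx
    induction hx using AddSubmonoid.closure_induction with
    | mem x hx =>
      obtain ⟨s, hs, rfl⟩ := hx
      exact ⟨[s], by simpa using hs, by simp⟩
    | zero => exact ⟨[], by simp, by simp⟩
    | add x y _ _ hx hy =>
      obtain ⟨l, hl, rfl⟩ := hx
      obtain ⟨l', hl', rfl⟩ := hy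
      exact ⟨l ++ l', fun w hw => (List.mem_append.1 hw).elim (hl w) (hl' w), by simp⟩
  obtain ⟨l, hl, h⟩ := key _ ht
  refine ⟨l.length, l.get, fun i => hl _ (List.get_mem l i), ?_⟩
  rw [h]
  conv_lhs => rw [← List.ofFn_get l, List.map_ofFn, List.sum_ofFn]
  rfl

theorem subset_finiteSums (S : Set 𝒢.PartialIsom) : S ⊆ finiteSums S := fun _ hs =>
  AddSubmonoid.subset_closure (mem_image_of_mem _ hs)

theorem mul_mem_finiteSums_words {Ω : Set 𝒢.PartialIsom} {s t : 𝒢.PartialIsom}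
    (hs : s ∈ finiteSums (words Ω)) (ht : t ∈ finiteSums (words Ω)) :
    s * t ∈ finiteSums (words Ω) := by
  obtain ⟨m, v, hv, hs⟩ := exists_of_mem_finiteSums hs
  obtain ⟨k, w, hw, ht⟩ := exists_of_mem_finiteSums ht
  have h := PartialIsom.ind_mul_eq_sum_sum hs ht
  rw [← Finset.sum_product'] at h
  exact mem_finiteSums_of_eq_sum (fun p _ => mul_mem_words (hv p.1) (hw p.2)) h

theorem star_mem_finiteSums_words {Ω : Set 𝒢.PartialIsom} {s : 𝒢.PartialIsom}
    (hs : s ∈ finiteSums (words Ω)) : star s ∈ finiteSums (words Ω) := by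
  obtain ⟨m, v, hv, hs⟩ := exists_of_mem_finiteSums hs
  exact mem_finiteSums_of_eq_sum (fun i _ => star_mem_words (hv i))
    (PartialIsom.ind_star_eq_sum hs)

section Sums

variable {Ω : Set 𝒢.PartialIsom}

theorem map_toSpan_eq_sum {ι : Type*} {I : Finset ι} {t : 𝒢.PartialIsom}
    {w : ι → 𝒢.PartialIsom} (h : t.ind = ∑ i ∈ I, (w i).ind) (p : 𝒢.MatrixModel) :
    p.2 t.toSpan = ∑ i ∈ I, p.2 (w i).toSpan := by
  rw [PartialIsom.toSpan_eq_sum h, map_sum]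

theorem tendsto_matrixTwoNorm_star_mul_words {s t : 𝒢.PartialIsom} (hs : s ∈ words Ω)
    (ht : t ∈ words Ω) (h : (star s * t).ind = 0) :
    Tendsto (fun p : 𝒢.MatrixModel => matrixTwoNorm ((p.2 s.toSpan)ᴴ * p.2 t.toSpan))
      (modelFilter Ω) (nhds 0) := by
  have h1 := tendsto_matrixTwoNorm_mul_words (star_mem_words hs) ht
  have h2 := tendsto_matrixTwoNorm_star_words hs
  refine squeeze_zero' (Eventually.of_forall fun p => matrixTwoNorm_nonneg _) ?_
    (by simpa using h1.add h2)
  filter_upwards [eventually_mem_partialPermMatrices ht] with p hp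
  have h3 := matrixTwoNorm_mul_le_left hp (p.2 (star s).toSpan - (p.2 s.toSpan)ᴴ)
  have h4 := matrixTwoNorm_le_add_sub ((p.2 s.toSpan)ᴴ * p.2 t.toSpan)
    (p.2 (star s).toSpan * p.2 t.toSpan)
  rw [PartialIsom.toSpan_eq_zero h, map_zero, zero_sub, matrixTwoNorm_neg]
  rw [Matrix.sub_mul, matrixTwoNorm_sub_comm] at h3
  linarith

theorem tendsto_matrixTwoNorm_mul_star_words {s t : 𝒢.PartialIsom} (hs : s ∈ words Ω)
    (ht : t ∈ words Ω) (h : (s * star t).ind = 0) :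
    Tendsto (fun p : 𝒢.MatrixModel => matrixTwoNorm (p.2 s.toSpan * (p.2 t.toSpan)ᴴ))
      (modelFilter Ω) (nhds 0) := by
  have h1 := tendsto_matrixTwoNorm_mul_words hs (star_mem_words ht)
  have h2 := tendsto_matrixTwoNorm_star_words ht
  refine squeeze_zero' (Eventually.of_forall fun p => matrixTwoNorm_nonneg _) ?_
    (by simpa using h1.add h2)
  filter_upwards [eventually_mem_partialPermMatrices hs] with p hp
  have h3 := matrixTwoNorm_mul_le_right hp (p.2 (star t).toSpan - (p.2 t.toSpan)ᴴ)
  have h4 := matrixTwoNorm_le_add_sub (p.2 s.toSpan * (p.2 t.toSpan)ᴴ)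
    (p.2 s.toSpan * p.2 (star t).toSpan)
  rw [PartialIsom.toSpan_eq_zero h, map_zero, zero_sub, matrixTwoNorm_neg]
  rw [Matrix.mul_sub, matrixTwoNorm_sub_comm] at h3
  linarith

/-- The values of approximate models at sums of words are close to partial permutations. -/
theorem exists_tendsto_matrixTwoNorm_sub {t : 𝒢.PartialIsom} (ht : t ∈ finiteSums (words Ω)) :
    ∃ T : (p : 𝒢.MatrixModel) → Matrix (Fin p.1) (Fin p.1) ℂ,
      (∀ p, T p ∈ partialPermMatrices p.1) ∧
      Tendsto (fun p : 𝒢.MatrixModel => matrixTwoNorm (p.2 t.toSpan - T p)) (modelFilter Ω)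
        (nhds 0) := by
  obtain ⟨m, w, hw, ht⟩ := exists_of_mem_finiteSums ht
  -- This rounding error tends to zero because distinct summands of t are orthogonal on both sides
  -- and models respect products and adjoints.
  let e : 𝒢.MatrixModel → ℝ := fun p => Fintype.card (Fin m) *
    √(2 * (Fintype.card (Fin m)) ^ 2 * ∑ q : Fin m × Fin m, if q.1 = q.2 then 0 else
      (matrixTwoNorm ((p.2 (w q.1).toSpan)ᴴ * p.2 (w q.2).toSpan) ^ 2 +
        matrixTwoNorm (p.2 (w q.1).toSpan * (p.2 (w q.2).toSpan)ᴴ) ^ 2))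
  have he : Tendsto e (modelFilter Ω) (nhds 0) := by
    have h1 : Tendsto (fun p : 𝒢.MatrixModel => ∑ q : Fin m × Fin m, if q.1 = q.2 then 0 else
      (matrixTwoNorm ((p.2 (w q.1).toSpan)ᴴ * p.2 (w q.2).toSpan) ^ 2 +
        matrixTwoNorm (p.2 (w q.1).toSpan * (p.2 (w q.2).toSpan)ᴴ) ^ 2)) (modelFilter Ω)
        (nhds (∑ q : Fin m × Fin m, 0)) := by
      refine tendsto_finsetSum _ fun q _ => ?_
      by_cases hq : q.1 = q.2
      · simpa [hq] using tendsto_const_nhds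
      · simp only [hq, if_false]
        have h2 := tendsto_matrixTwoNorm_star_mul_words (hw q.1) (hw q.2)
          (PartialIsom.ind_star_mul_eq_zero ht (Finset.mem_univ _) (Finset.mem_univ _) hq)
        have h3 := tendsto_matrixTwoNorm_mul_star_words (hw q.1) (hw q.2)
          (PartialIsom.ind_mul_star_eq_zero ht (Finset.mem_univ _) (Finset.mem_univ _) hq)
        simpa using (h2.pow 2).add (h3.pow 2)
    have h4 := ((h1.const_mul (2 * (Fintype.card (Fin m) : ℝ) ^ 2)).sqrt).const_mul
      (Fintype.card (Fin m) : ℝ)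
    simp only [Finset.sum_const_zero, mul_zero, Real.sqrt_zero] at h4
    exact h4
  have hex : ∀ p : 𝒢.MatrixModel, ∃ T ∈ partialPermMatrices p.1,
      (∀ i, p.2 (w i).toSpan ∈ partialPermMatrices p.1) →
        matrixTwoNorm (p.2 t.toSpan - T) ≤ e p := by
    intro p
    by_cases h : ∀ i, p.2 (w i).toSpan ∈ partialPermMatrices p.1
    · obtain ⟨T, hT, hle⟩ := exists_mem_partialPermMatrices_sum_sub_le h
      refine ⟨T, hT, fun _ => ?_⟩
      rw [map_toSpan_eq_sum ht]
      exact hle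
    -- The value 0 is a default; this case does not occur eventually along the filter.
    · exact ⟨0, zero_mem_partialPermMatrices, fun h' => absurd h' h⟩
  choose T hT hle using hex
  refine ⟨T, hT, squeeze_zero' (Eventually.of_forall fun p => matrixTwoNorm_nonneg _) ?_ he⟩
  filter_upwards [eventually_all.2 fun i => eventually_mem_partialPermMatrices (hw i)] with p hp
  exact hle p hp

/-- The value at t need not be a contraction, but it is a sum of m of them, where m is the number of
words in t. -/
theorem exists_eventually_matrixTwoNorm_mul_le {t : 𝒢.PartialIsom}
    (ht : t ∈ finiteSums (words Ω)) : ∃ K : ℝ, ∀ᶠ p in modelFilter Ω,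
      ∀ A : Matrix (Fin p.1) (Fin p.1) ℂ,
        matrixTwoNorm (p.2 t.toSpan * A) ≤ K * matrixTwoNorm A := by
  obtain ⟨m, w, hw, ht⟩ := exists_of_mem_finiteSums ht
  refine ⟨m, ?_⟩
  filter_upwards [eventually_all.2 fun i => eventually_mem_partialPermMatrices (hw i)] with p hp
  intro A
  rw [map_toSpan_eq_sum ht, Finset.sum_mul]
  refine (matrixTwoNorm_sum_le _ _).trans ?_
  refine (Finset.sum_le_card_nsmul _ _ _ fun i _ => matrixTwoNorm_mul_le_right (hp i) A).trans ?_
  rw [nsmul_eq_mul, Finset.card_univ, Fintype.card_fin]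

theorem tendsto_matrixTwoNorm_mul_sums {s t : 𝒢.PartialIsom} (hs : s ∈ finiteSums (words Ω))
    (ht : t ∈ finiteSums (words Ω)) :
    Tendsto (fun p : 𝒢.MatrixModel =>
      matrixTwoNorm (p.2 (s * t).toSpan - p.2 s.toSpan * p.2 t.toSpan)) (modelFilter Ω)
      (nhds 0) := by
  obtain ⟨m, v, hv, hs⟩ := exists_of_mem_finiteSums hs
  obtain ⟨k, w, hw, ht⟩ := exists_of_mem_finiteSums ht
  have hst := PartialIsom.ind_mul_eq_sum_sum hs ht
  rw [← Finset.sum_product'] at hst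
  have h : Tendsto (fun p : 𝒢.MatrixModel => ∑ q ∈ (Finset.univ : Finset (Fin m)) ×ˢ
      (Finset.univ : Finset (Fin k)), matrixTwoNorm
      (p.2 (v q.1 * w q.2).toSpan - p.2 (v q.1).toSpan * p.2 (w q.2).toSpan)) (modelFilter Ω)
      (nhds (∑ q ∈ (Finset.univ : Finset (Fin m)) ×ˢ (Finset.univ : Finset (Fin k)), 0)) :=
    tendsto_finsetSum _ fun q _ => tendsto_matrixTwoNorm_mul_words (hv q.1) (hw q.2)
  rw [Finset.sum_const_zero] at h
  refine squeeze_zero (fun p => matrixTwoNorm_nonneg _) (fun p => ?_) h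
  rw [map_toSpan_eq_sum hst, map_toSpan_eq_sum hs, map_toSpan_eq_sum ht, Finset.sum_mul_sum,
    ← Finset.sum_product', ← Finset.sum_sub_distrib]
  exact matrixTwoNorm_sum_le _ _

theorem tendsto_matrixTwoNorm_star_sums {s : 𝒢.PartialIsom} (hs : s ∈ finiteSums (words Ω)) :
    Tendsto (fun p : 𝒢.MatrixModel =>
      matrixTwoNorm (p.2 (star s).toSpan - (p.2 s.toSpan)ᴴ)) (modelFilter Ω) (nhds 0) := by
  obtain ⟨m, v, hv, hs⟩ := exists_of_mem_finiteSums hs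
  have h : Tendsto (fun p : 𝒢.MatrixModel => ∑ i, matrixTwoNorm
      (p.2 (star (v i)).toSpan - (p.2 (v i).toSpan)ᴴ)) (modelFilter Ω)
      (nhds (∑ i : Fin m, 0)) :=
    tendsto_finsetSum _ fun i _ => tendsto_matrixTwoNorm_star_words (hv i)
  rw [Finset.sum_const_zero] at h
  refine squeeze_zero (fun p => matrixTwoNorm_nonneg _) (fun p => ?_) h
  rw [map_toSpan_eq_sum (PartialIsom.ind_star_eq_sum hs), map_toSpan_eq_sum hs,
    Matrix.conjTranspose_sum, ← Finset.sum_sub_distrib]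
  exact matrixTwoNorm_sum_le _ _

theorem tendsto_normalizedTrace_sums {s : 𝒢.PartialIsom} (hs : s ∈ finiteSums (words Ω)) :
    Tendsto (fun p : 𝒢.MatrixModel => normalizedTrace (p.2 s.toSpan)) (modelFilter Ω)
      (nhds (trace s.ind)) := by
  obtain ⟨m, v, hv, hs⟩ := exists_of_mem_finiteSums hs
  rw [trace_ind_eq_sum hs]
  simp only [map_toSpan_eq_sum hs, normalizedTrace_sum]
  exact tendsto_finsetSum _ fun i _ => tendsto_normalizedTrace_words (hv i)

end Sums

/-- Partial permutation matrices `T s p` that asymptotically model the sums `s` of words in `Ω` as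
the approximate model `p` runs along the filter of approximate models. -/
structure AsymptoticModel (Ω : Set 𝒢.PartialIsom) where
  T : 𝒢.PartialIsom → (p : 𝒢.MatrixModel) → Matrix (Fin p.1) (Fin p.1) ℂ
  mem : ∀ s p, T s p ∈ partialPermMatrices p.1
  tendsto_sub : ∀ s ∈ finiteSums (words Ω),
    Tendsto (fun p : 𝒢.MatrixModel => matrixTwoNorm (p.2 s.toSpan - T s p)) (modelFilter Ω)
      (nhds 0)

namespace AsymptoticModel

variable {Ω : Set 𝒢.PartialIsom}

instance : Nonempty (AsymptoticModel Ω) := by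
  classical
  have h : ∀ s : 𝒢.PartialIsom, ∃ T : (p : 𝒢.MatrixModel) → Matrix (Fin p.1) (Fin p.1) ℂ,
      (∀ p, T p ∈ partialPermMatrices p.1) ∧ (s ∈ finiteSums (words Ω) →
      Tendsto (fun p : 𝒢.MatrixModel => matrixTwoNorm (p.2 s.toSpan - T p)) (modelFilter Ω)
        (nhds 0)) := by
    intro s
    by_cases hs : s ∈ finiteSums (words Ω)
    · obtain ⟨T, hT, h⟩ := exists_tendsto_matrixTwoNorm_sub hs
      exact ⟨T, hT, fun _ => h⟩
    · exact ⟨fun _ => 0, fun _ => zero_mem_partialPermMatrices, fun h => absurd h hs⟩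
  choose T hT h using h
  exact ⟨⟨T, hT, h⟩⟩

variable (M : AsymptoticModel Ω)

/-- The chain is φ(st), φ(s)φ(t), φ(s)T_t, T_sT_t. The middle comparison needs the uniform bound K
on multiplication by φ(s), the last one that T_t is a contraction. -/
theorem tendsto_mul {s t : 𝒢.PartialIsom} (hs : s ∈ finiteSums (words Ω))
    (ht : t ∈ finiteSums (words Ω)) :
    Tendsto (fun p => matrixTwoNorm (p.2 (s * t).toSpan - M.T s p * M.T t p)) (modelFilter Ω)
      (nhds 0) := by
  obtain ⟨K, hK⟩ := exists_eventually_matrixTwoNorm_mul_le hs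
  have h1 := tendsto_matrixTwoNorm_mul_sums hs ht
  have h2 := M.tendsto_sub s hs
  have h3 := (M.tendsto_sub t ht).const_mul K
  have h := (h1.add h2).add h3
  simp only [mul_zero, add_zero] at h
  refine squeeze_zero' (Eventually.of_forall fun p => matrixTwoNorm_nonneg _) ?_ h
  filter_upwards [hK] with p hp
  have h4 := matrixTwoNorm_sub_le (p.2 (s * t).toSpan) (p.2 s.toSpan * p.2 t.toSpan)
    (M.T s p * M.T t p)
  have h5 := matrixTwoNorm_sub_le (p.2 s.toSpan * p.2 t.toSpan) (p.2 s.toSpan * M.T t p)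
    (M.T s p * M.T t p)
  rw [← Matrix.mul_sub, ← Matrix.sub_mul] at h5
  have h6 := hp (p.2 t.toSpan - M.T t p)
  have h7 := matrixTwoNorm_mul_le_left (M.mem t p) (p.2 s.toSpan - M.T s p)
  linarith

theorem tendsto_star {s : 𝒢.PartialIsom} (hs : s ∈ finiteSums (words Ω)) :
    Tendsto (fun p => matrixTwoNorm (p.2 (star s).toSpan - (M.T s p)ᴴ)) (modelFilter Ω)
      (nhds 0) := by
  have h := (tendsto_matrixTwoNorm_star_sums hs).add (M.tendsto_sub s hs)
  rw [add_zero] at h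
  refine squeeze_zero (fun p => matrixTwoNorm_nonneg _) (fun p => ?_) h
  have h1 := matrixTwoNorm_sub_le (p.2 (star s).toSpan) (p.2 s.toSpan)ᴴ (M.T s p)ᴴ
  rw [← Matrix.conjTranspose_sub, matrixTwoNorm_conjTranspose] at h1
  exact h1

theorem tendsto_trace {s : 𝒢.PartialIsom} (hs : s ∈ finiteSums (words Ω)) :
    Tendsto (fun p => normalizedTrace (M.T s p)) (modelFilter Ω) (nhds (trace s.ind)) := by
  refine tendsto_of_tendsto_of_dist (tendsto_normalizedTrace_sums hs) ?_
  refine squeeze_zero (fun p => dist_nonneg) (fun p => ?_) (M.tendsto_sub s hs)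
  rw [dist_eq_norm, ← normalizedTrace_sub]
  exact norm_normalizedTrace_le _

theorem tendsto_star_mul {s t : 𝒢.PartialIsom} (hs : s ∈ finiteSums (words Ω))
    (ht : t ∈ finiteSums (words Ω)) :
    Tendsto (fun p => matrixTwoNorm (p.2 (star s * t).toSpan - (M.T s p)ᴴ * M.T t p))
      (modelFilter Ω) (nhds 0) := by
  have hs' := star_mem_finiteSums_words hs
  have h := ((M.tendsto_mul hs' ht).add (M.tendsto_sub _ hs')).add (M.tendsto_star hs)
  simp only [add_zero] at h
  refine squeeze_zero (fun p => matrixTwoNorm_nonneg _) (fun p => ?_) h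
  have h1 := matrixTwoNorm_sub_le (p.2 (star s * t).toSpan) (M.T (star s) p * M.T t p)
    ((M.T s p)ᴴ * M.T t p)
  rw [← Matrix.sub_mul] at h1
  have h2 := matrixTwoNorm_mul_le_left (M.mem t p) (M.T (star s) p - (M.T s p)ᴴ)
  have h3 := matrixTwoNorm_sub_le (M.T (star s) p) (p.2 (star s).toSpan) (M.T s p)ᴴ
  rw [matrixTwoNorm_sub_comm (M.T (star s) p) (p.2 (star s).toSpan)] at h3
  linarith

theorem tendsto_mul_star {s t : 𝒢.PartialIsom} (hs : s ∈ finiteSums (words Ω))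
    (ht : t ∈ finiteSums (words Ω)) :
    Tendsto (fun p => matrixTwoNorm (p.2 (s * star t).toSpan - M.T s p * (M.T t p)ᴴ))
      (modelFilter Ω) (nhds 0) := by
  have ht' := star_mem_finiteSums_words ht
  have h := ((M.tendsto_mul hs ht').add (M.tendsto_sub _ ht')).add (M.tendsto_star ht)
  simp only [add_zero] at h
  refine squeeze_zero (fun p => matrixTwoNorm_nonneg _) (fun p => ?_) h
  have h1 := matrixTwoNorm_sub_le (p.2 (s * star t).toSpan) (M.T s p * M.T (star t) p)
    (M.T s p * (M.T t p)ᴴ)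
  rw [← Matrix.mul_sub] at h1
  have h2 := matrixTwoNorm_mul_le_right (M.mem s p) (M.T (star t) p - (M.T t p)ᴴ)
  have h3 := matrixTwoNorm_sub_le (M.T (star t) p) (p.2 (star t).toSpan) (M.T t p)ᴴ
  rw [matrixTwoNorm_sub_comm (M.T (star t) p) (p.2 (star t).toSpan)] at h3
  linarith

theorem tendsto_trace_star_mul {s t : 𝒢.PartialIsom} (hs : s ∈ finiteSums (words Ω))
    (ht : t ∈ finiteSums (words Ω)) :
    Tendsto (fun p => normalizedTrace ((M.T s p)ᴴ * M.T t p)) (modelFilter Ω)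
      (nhds (gram s t : ℂ)) := by
  rw [← trace_ind_star_mul]
  refine tendsto_of_tendsto_of_dist (tendsto_normalizedTrace_sums
    (mul_mem_finiteSums_words (star_mem_finiteSums_words hs) ht)) ?_
  refine squeeze_zero (fun p => dist_nonneg) (fun p => ?_) (M.tendsto_star_mul hs ht)
  rw [dist_eq_norm, ← normalizedTrace_sub]
  exact norm_normalizedTrace_le _

/-- Approximate models asymptotically do not increase the `2`-norm on the span of the sums of
words. -/
theorem eventually_matrixTwoNorm_lt (M : AsymptoticModel Ω) {x : 𝒢.Span}
    (hx : x ∈ Submodule.span ℂ (PartialIsom.toSpan '' finiteSums (words Ω)))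
    {β : ℝ} (hβ : twoNorm x.1 < ENNReal.ofReal β) :
    ∀ᶠ p in modelFilter Ω, matrixTwoNorm (p.2 x) < β := by
  have hβ0 : 0 < β := ENNReal.ofReal_pos.1 (zero_le.trans_lt hβ)
  obtain ⟨n, c, g, rfl⟩ := Submodule.mem_span_set'.1 hx
  choose s hs hsg using fun i => (g i).2
  have hx' : (∑ i, c i • ((g i : 𝒢.Span)) : 𝒢.Span).1 = ∑ i, c i • (s i).ind := by
    rw [AddSubmonoidClass.coe_finsetSum]
    refine Finset.sum_congr rfl fun i _ => ?_
    rw [← hsg]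
    rfl
  rw [hx', ← ENNReal.pow_lt_pow_left_iff two_ne_zero, twoNorm_sum_sq,
    ← ENNReal.ofReal_pow hβ0.le, ENNReal.ofReal_lt_ofReal_iff (by positivity)] at hβ
  -- The Gram matrix of the T (s i) converges to that of the s i, so the squared norm of the
  -- combination converges to the squared 2-norm of x.
  have h1 : Tendsto (fun p : 𝒢.MatrixModel => matrixTwoNorm (∑ i, c i • M.T (s i) p) ^ 2)
      (modelFilter Ω) (nhds (∑ i, ∑ j, (star (c i) * c j).re * gram (s i) (s j))) := by
    have h2 : Tendsto (fun p : 𝒢.MatrixModel => ∑ i, ∑ j,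
        (star (c i) * c j * normalizedTrace ((M.T (s i) p)ᴴ * M.T (s j) p)).re) (modelFilter Ω)
        (nhds (∑ i, ∑ j, (star (c i) * c j * (gram (s i) (s j) : ℂ)).re)) :=
      tendsto_finsetSum _ fun i _ => tendsto_finsetSum _ fun j _ =>
        (Complex.continuous_re.tendsto _).comp
          ((M.tendsto_trace_star_mul (hs i) (hs j)).const_mul _)
    refine (h2.congr fun p => ?_).trans (le_of_eq ?_)
    · rw [matrixTwoNorm_sq_eq_trace, Matrix.conjTranspose_sum, Finset.sum_mul_sum,
        normalizedTrace_sum, Complex.re_sum]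
      refine Finset.sum_congr rfl fun i _ => ?_
      rw [normalizedTrace_sum, Complex.re_sum]
      refine Finset.sum_congr rfl fun j _ => ?_
      rw [Matrix.conjTranspose_smul, Matrix.smul_mul, Matrix.mul_smul, normalizedTrace_smul,
        normalizedTrace_smul, mul_assoc]
    · congr 1
      refine Finset.sum_congr rfl fun i _ => Finset.sum_congr rfl fun j _ => ?_
      rw [Complex.re_mul_ofReal]
  have h3 : Tendsto (fun p : 𝒢.MatrixModel => ∑ i, ‖c i‖ *
      matrixTwoNorm (p.2 (s i).toSpan - M.T (s i) p)) (modelFilter Ω) (nhds 0) := by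
    have := tendsto_finsetSum (Finset.univ : Finset (Fin n))
      fun i _ => (M.tendsto_sub (s i) (hs i)).const_mul ‖c i‖
    simpa using this
  have h4 := (h1.sqrt).add h3
  rw [add_zero] at h4
  have h5 : √(∑ i, ∑ j, (star (c i) * c j).re * gram (s i) (s j)) < β :=
    (Real.sqrt_lt' hβ0).2 hβ
  filter_upwards [h4.eventually_lt_const h5] with p hp
  refine lt_of_le_of_lt ?_ hp
  rw [Real.sqrt_sq (matrixTwoNorm_nonneg _)]
  refine (matrixTwoNorm_le_add_sub _ (∑ i, c i • M.T (s i) p)).trans ?_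
  gcongr
  rw [map_sum, ← Finset.sum_sub_distrib]
  refine (matrixTwoNorm_sum_le _ _).trans (le_of_eq ?_)
  refine Finset.sum_congr rfl fun i _ => ?_
  rw [map_smul, ← smul_sub, matrixTwoNorm_smul, hsg]

end AsymptoticModel

end PMPGroupoid

/-! ### From cardinality estimates to inequalities of dimensions. -/

/-- The case of infinite Y needs M ≠ 0, since ∞ · 0 = 0. -/
theorem Set.encard_le_encard_mul {α β : Type*} {X : Set α} {Y : Set β} (r : α → β → Prop) {M : ℕ}
    (hM : M ≠ 0) (hXY : ∀ x ∈ X, ∃ y ∈ Y, r x y)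
    (hY : ∀ y ∈ Y, {x ∈ X | r x y}.encard ≤ M) : X.encard ≤ Y.encard * M := by
  rcases Y.finite_or_infinite with hfin | hinf
  · have hsub : X ⊆ ⋃ y ∈ hfin.toFinset, {x ∈ X | r x y} := by
      intro x hx
      obtain ⟨y, hy, hxy⟩ := hXY x hx
      simp only [mem_iUnion]
      exact ⟨y, hfin.mem_toFinset.2 hy, hx, hxy⟩
    refine (encard_le_encard hsub).trans ((Finset.set_encard_biUnion_le _ _).trans ?_)
    refine (Finset.sum_le_card_nsmul _ _ (M : ℕ∞) fun y hy => hY y (hfin.mem_toFinset.1 hy)).trans ?_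
    rw [nsmul_eq_mul, hfin.encard_eq_coe_toFinset_card]
  · rw [hinf.encard_eq, ENat.top_mul (by exact_mod_cast hM)]
    exact le_top

theorem EReal.le_of_forall_pos_le_add_coe {x y : EReal} (h : ∀ κ : ℝ, 0 < κ → x ≤ y + κ) :
    x ≤ y := by
  refine EReal.le_of_forall_lt_iff_le.1 fun z hz => ?_
  induction y with
  | bot =>
    have := h 1 one_pos
    rw [EReal.bot_add] at this
    exact this.trans bot_le
  | top => exact absurd hz not_top_lt
  | coe r =>
    have hr : r < z := EReal.coe_lt_coe_iff.1 hz
    have := h (z - r) (_root_.sub_pos.2 hr)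
    rwa [← EReal.coe_add, add_sub_cancel] at this

theorem EReal.limsup_le_limsup_add_coe {u v : ℕ → EReal} {κ : ℝ}
    (h : ∀ᶠ d in atTop, u d ≤ v d + κ) : limsup u atTop ≤ limsup v atTop + κ := by
  have hc : limsup (fun _ : ℕ => (κ : EReal)) atTop = κ := limsup_const _
  refine (limsup_le_limsup h).trans ?_
  have := EReal.limsup_add_le (u := v) (v := fun _ : ℕ => (κ : EReal)) (f := atTop)
    (Or.inr (by rw [hc]; exact EReal.coe_ne_top κ)) (Or.inr (by rw [hc]; exact EReal.coe_ne_bot κ))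
  rwa [hc] at this

theorem EReal.liminf_le_liminf_add_coe {u v : ℕ → EReal} {κ : ℝ}
    (h : ∀ᶠ d in atTop, u d ≤ v d + κ) : liminf u atTop ≤ liminf v atTop + κ := by
  have hc : limsup (fun _ : ℕ => (κ : EReal)) atTop = κ := limsup_const _
  refine (liminf_le_liminf h).trans ?_
  have := EReal.liminf_add_le (u := fun _ : ℕ => (κ : EReal)) (v := v) (f := atTop)
    (Or.inl (by rw [hc]; exact EReal.coe_ne_bot κ)) (Or.inl (by rw [hc]; exact EReal.coe_ne_top κ))
  rw [hc] at this
  rw [_root_.add_comm (liminf v atTop)]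
  refine le_trans (le_of_eq ?_) this
  congr 1
  ext d
  exact _root_.add_comm _ _

namespace PMPGroupoid

variable {G : Type*} [MeasurableSpace G] [StandardBorelSpace G] {𝒢 : PMPGroupoid G}

theorem eventually_rate_le {E E' F F' : Set 𝒢.PartialIsom} {n n' : ℕ} {δ δ' ε : ℝ} {c : ℕ}
    (h : ∀ d, cardSA E F n δ d ≤
      cardSA E' F' n' δ' d * (((d ^ 2 + 1) ^ (⌊ε ^ 2 * d⌋₊ * c) : ℕ) : ℕ∞)) :
    ∀ᶠ d in atTop, rate E F n δ d ≤ rate E' F' n' δ' d + (3 * ε ^ 2 * c : ℝ) := by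
  filter_upwards [eventually_ge_atTop 2] with d hd
  have hd' : (2 : ℝ) ≤ d := by exact_mod_cast hd
  have hlog : 0 < Real.log d := Real.log_pos (by linarith)
  have hdl : 0 < d * Real.log d := by positivity
  set M : ℕ := (d ^ 2 + 1) ^ (⌊ε ^ 2 * d⌋₊ * c) with hM
  have hM0 : (0 : ℝ) < M := by
    rw [hM]
    positivity
  have h1 : ENNReal.log (cardSA E F n δ d) ≤
      ENNReal.log (cardSA E' F' n' δ' d) + (Real.log M : EReal) := by
    have e : ENNReal.log ((M : ℕ) : ℝ≥0∞) = (Real.log M : EReal) := by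
      rw [ENNReal.log_pos_real (by exact_mod_cast hM0.ne') (ENNReal.natCast_ne_top M),
        ENNReal.toReal_natCast]
    rw [← e, ← ENNReal.log_mul_add]
    refine ENNReal.log_monotone ?_
    have := ENat.toENNReal_le.2 (h d)
    rwa [ENat.toENNReal_mul, ENat.toENNReal_coe] at this
  have h2 : Real.log M / (d * Real.log d) ≤ 3 * ε ^ 2 * c := by
    rw [div_le_iff₀ hdl, hM]
    push_cast
    rw [Real.log_pow]
    push_cast
    -- For d ≥ 2 one has d² + 1 ≤ d³; this is the origin of the factor 3.
    have h3 : Real.log ((d : ℝ) ^ 2 + 1) ≤ 3 * Real.log d := by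
      rw [show (3 : ℝ) * Real.log d = Real.log ((d : ℝ) ^ 3) by rw [Real.log_pow]; norm_num]
      refine Real.log_le_log (by positivity) ?_
      nlinarith [sq_nonneg ((d : ℝ))]
    have h4 : (⌊ε ^ 2 * d⌋₊ : ℝ) ≤ ε ^ 2 * d := Nat.floor_le (by positivity)
    calc (⌊ε ^ 2 * d⌋₊ : ℝ) * c * Real.log ((d : ℝ) ^ 2 + 1)
        ≤ (ε ^ 2 * d) * c * (3 * Real.log d) := by
          gcongr
          exact Real.log_nonneg (by nlinarith)
      _ = 3 * ε ^ 2 * c * (d * Real.log d) := by ring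
  have hnn : (0 : EReal) ≤ ((d * Real.log d : ℝ) : EReal) := EReal.coe_nonneg.2 hdl.le
  refine (EReal.div_le_div_right_of_nonneg hnn h1).trans ?_
  rw [EReal.add_div_of_nonneg_right hnn]
  refine add_le_add le_rfl ?_
  rw [← EReal.coe_div]
  exact EReal.coe_le_coe_iff.2 h2

theorem exists_pos_three_mul_sq_mul_le (c : ℕ) {κ : ℝ} (hκ : 0 < κ) :
    ∃ ε : ℝ, 0 < ε ∧ 3 * ε ^ 2 * c ≤ κ := by
  refine ⟨√(κ / (3 * (c + 1))), by positivity, ?_⟩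
  rw [Real.sq_sqrt (by positivity)]
  have : 3 * (κ / (3 * (c + 1))) * c = κ * (c / (c + 1)) := by field_simp
  rw [this]
  refine mul_le_of_le_one_right hκ.le ?_
  rw [div_le_one (by positivity)]
  linarith

/-- Every approximate model on `Ω` is close on `E` to an approximate model on `Ω'`. -/
def ModelsLift (Ω Ω' : Set 𝒢.PartialIsom) : Prop :=
  ∀ E : Set 𝒢.PartialIsom, E.Finite → E ⊆ Ω → ∀ ε : ℝ, 0 < ε → ∃ E' : Set 𝒢.PartialIsom,
    E'.Finite ∧ E' ⊆ Ω' ∧ ∀ F' : Set 𝒢.PartialIsom, F'.Finite → F' ⊆ Ω' → ∀ n' ≥ 1, ∀ δ' > 0,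
      ∃ F : Set 𝒢.PartialIsom, F.Finite ∧ F ⊆ Ω ∧ ∃ n ≥ 1, ∃ δ > 0, ∀ d,
        cardSA E F n δ d ≤ cardSA E' F' n' δ' d *
          (((d ^ 2 + 1) ^ (⌊ε ^ 2 * d⌋₊ * E.ncard) : ℕ) : ℕ∞)

/-- An abstract `Lim` that tolerates additive constants treats limsup and liminf at once. The radius
ε is chosen from the size of E so that the counting factor costs at most κ. -/
theorem iSup_iInf_le_of_modelsLift {Ω Ω' : Set 𝒢.PartialIsom} (h : ModelsLift Ω Ω')
    (Lim : (ℕ → EReal) → EReal)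
    (hLim : ∀ (u v : ℕ → EReal) (κ : ℝ), (∀ᶠ d in atTop, u d ≤ v d + κ) → Lim u ≤ Lim v + κ) :
    (⨆ (E : Set 𝒢.PartialIsom) (_ : E.Finite ∧ E ⊆ Ω),
      ⨅ (F : Set 𝒢.PartialIsom) (_ : F.Finite ∧ F ⊆ Ω),
        ⨅ (n : ℕ) (_ : 1 ≤ n), ⨅ (δ : ℝ) (_ : 0 < δ), Lim (rate E F n δ)) ≤
    ⨆ (E : Set 𝒢.PartialIsom) (_ : E.Finite ∧ E ⊆ Ω'),
      ⨅ (F : Set 𝒢.PartialIsom) (_ : F.Finite ∧ F ⊆ Ω'),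
        ⨅ (n : ℕ) (_ : 1 ≤ n), ⨅ (δ : ℝ) (_ : 0 < δ), Lim (rate E F n δ) := by
  refine iSup₂_le fun E hE => EReal.le_of_forall_pos_le_add_coe fun κ hκ => ?_
  obtain ⟨ε, hε, hεκ⟩ := exists_pos_three_mul_sq_mul_le E.ncard hκ
  obtain ⟨E', hE', hE'Ω, h⟩ := h E hE.1 hE.2 ε hε
  refine le_trans ?_ (add_le_add (le_iSup₂_of_le E' ⟨hE', hE'Ω⟩ le_rfl) le_rfl)
  -- The constant is moved to the left so that the infima on the right can be opened.
  rw [← EReal.sub_le_iff_le_add (Or.inl (EReal.coe_ne_bot κ)) (Or.inl (EReal.coe_ne_top κ))]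
  refine le_iInf₂ fun F' hF' => le_iInf₂ fun n' hn' => le_iInf₂ fun δ' hδ' => ?_
  rw [EReal.sub_le_iff_le_add (Or.inl (EReal.coe_ne_bot κ)) (Or.inl (EReal.coe_ne_top κ))]
  obtain ⟨F, hF, hFΩ, n, hn, δ, hδ, hcard⟩ := h F' hF'.1 hF'.2 n' hn' δ' hδ'
  refine (iInf₂_le_of_le F ⟨hF, hFΩ⟩ (iInf₂_le_of_le n hn (iInf₂_le δ hδ))).trans ?_
  refine hLim _ _ _ ?_
  filter_upwards [eventually_rate_le hcard] with d hd
  exact hd.trans (add_le_add le_rfl (EReal.coe_le_coe_iff.2 hεκ))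

end PMPGroupoid

/-! ### Models of the groupoid are nearly determined by their values on the generating set. -/

namespace PMPGroupoid

variable {G : Type*} [MeasurableSpace G] [StandardBorelSpace G] {𝒢 : PMPGroupoid G}

theorem encard_fiber_le {E : Set 𝒢.PartialIsom} (hE : E.Finite) {d : ℕ} {ε : ℝ}
    {X : Set (E → Matrix (Fin d) (Fin d) ℂ)} (hX : ∀ x ∈ X, ∀ a, x a ∈ partialPermMatrices d)
    (hXε : ∀ x ∈ X, ∀ y ∈ X, ∀ a, matrixTwoNorm (x a - y a) ≤ ε) :
    X.encard ≤ (((d ^ 2 + 1) ^ (⌊ε ^ 2 * d⌋₊ * E.ncard) : ℕ) : ℕ∞) := by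
  have := hE.fintype
  have h := encard_le_of_matrixTwoNorm_sub_le hX hXε
  rwa [Fintype.card_eq_nat_card, Nat.card_coe_set_eq] at h

/-- The values at `x` of good approximate models of `𝒢` are asymptotically determined by the values
on `E`. -/
def IsDetermined (E : Set 𝒢.PartialIsom) (x : 𝒢.Span) : Prop :=
  ∀ ε : ℝ, 0 < ε → ∃ U ∈ modelFilter (univ : Set 𝒢.PartialIsom),
    ∀ (d : ℕ) (φ φ' : 𝒢.Span →ₗ[ℂ] Matrix (Fin d) (Fin d) ℂ), (⟨d, φ⟩ : 𝒢.MatrixModel) ∈ U →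
      (⟨d, φ'⟩ : 𝒢.MatrixModel) ∈ U → (∀ s ∈ E, φ s.toSpan = φ' s.toSpan) →
        matrixTwoNorm (φ x - φ' x) < ε

theorem words_univ : words (univ : Set 𝒢.PartialIsom) = univ :=
  univ_subset_iff.1 (subset_words _)

theorem mem_finiteSums_words_univ (s : 𝒢.PartialIsom) :
    s ∈ finiteSums (words (univ : Set 𝒢.PartialIsom)) :=
  subset_finiteSums _ (by rw [words_univ]; exact mem_univ s)

theorem mem_words_univ (s : 𝒢.PartialIsom) : s ∈ words (univ : Set 𝒢.PartialIsom) := by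
  rw [words_univ]
  exact mem_univ s

variable {E : Set 𝒢.PartialIsom}

theorem isDetermined_of_mem {s : 𝒢.PartialIsom} (hs : s ∈ E) : IsDetermined E s.toSpan :=
  fun ε hε => ⟨univ, univ_mem, fun d φ φ' _ _ h => by
    rw [h s hs, sub_self, matrixTwoNorm_zero]
    exact hε⟩

theorem IsDetermined.star {s : 𝒢.PartialIsom} (hs : IsDetermined E s.toSpan) :
    IsDetermined E (star s).toSpan := by
  intro ε hε
  obtain ⟨U, hU, h⟩ := hs (ε / 3) (by positivity)
  have h1 := (tendsto_matrixTwoNorm_star_words (mem_words_univ s)).eventually_lt_const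
    (show 0 < ε / 3 by positivity)
  refine ⟨_, inter_mem hU h1, fun d φ φ' hφ hφ' hE => ?_⟩
  have h2 : matrixTwoNorm (φ (Star.star s).toSpan - (φ s.toSpan)ᴴ) < ε / 3 := hφ.2
  have h3 : matrixTwoNorm (φ' (Star.star s).toSpan - (φ' s.toSpan)ᴴ) < ε / 3 := hφ'.2
  have h4 := h d φ φ' hφ.1 hφ'.1 hE
  rw [← matrixTwoNorm_conjTranspose, Matrix.conjTranspose_sub] at h4
  rw [matrixTwoNorm_sub_comm] at h3
  have h5 := matrixTwoNorm_sub_le (φ (Star.star s).toSpan) (φ s.toSpan)ᴴ (φ' (Star.star s).toSpan)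
  have h6 := matrixTwoNorm_sub_le (φ s.toSpan)ᴴ (φ' s.toSpan)ᴴ (φ' (Star.star s).toSpan)
  linarith

theorem IsDetermined.mul {s t : 𝒢.PartialIsom} (hs : IsDetermined E s.toSpan)
    (ht : IsDetermined E t.toSpan) : IsDetermined E (s * t).toSpan := by
  intro ε hε
  obtain ⟨U, hU, h⟩ := hs (ε / 4) (by positivity)
  obtain ⟨V, hV, h'⟩ := ht (ε / 4) (by positivity)
  have h1 := (tendsto_matrixTwoNorm_mul_words (mem_words_univ s)
    (mem_words_univ t)).eventually_lt_const (show 0 < ε / 4 by positivity)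
  refine ⟨_, inter_mem (inter_mem hU hV) (inter_mem h1 (inter_mem
    (eventually_mem_partialPermMatrices (mem_words_univ s))
    (eventually_mem_partialPermMatrices (mem_words_univ t)))), fun d φ φ' hφ hφ' hE => ?_⟩
  have h2 : matrixTwoNorm (φ (s * t).toSpan - φ s.toSpan * φ t.toSpan) < ε / 4 := hφ.2.1
  have h3 : matrixTwoNorm (φ' (s * t).toSpan - φ' s.toSpan * φ' t.toSpan) < ε / 4 := hφ'.2.1
  have h4 := h d φ φ' hφ.1.1 hφ'.1.1 hE
  have h5 := h' d φ φ' hφ.1.2 hφ'.1.2 hE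
  rw [matrixTwoNorm_sub_comm] at h3
  have h6 := matrixTwoNorm_mul_sub_mul_le (P := φ s.toSpan) (Q := φ t.toSpan)
    (P' := φ' s.toSpan) (Q' := φ' t.toSpan) hφ.2.2.1 hφ'.2.2.2
  have h7 := matrixTwoNorm_sub_le (φ (s * t).toSpan) (φ s.toSpan * φ t.toSpan)
    (φ' (s * t).toSpan)
  have h8 := matrixTwoNorm_sub_le (φ s.toSpan * φ t.toSpan) (φ' s.toSpan * φ' t.toSpan)
    (φ' (s * t).toSpan)
  linarith

theorem IsDetermined.add {x y : 𝒢.Span} (hx : IsDetermined E x) (hy : IsDetermined E y) :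
    IsDetermined E (x + y) := by
  intro ε hε
  obtain ⟨U, hU, h⟩ := hx (ε / 2) (by positivity)
  obtain ⟨V, hV, h'⟩ := hy (ε / 2) (by positivity)
  refine ⟨_, inter_mem hU hV, fun d φ φ' hφ hφ' hE => ?_⟩
  have h1 := h d φ φ' hφ.1 hφ'.1 hE
  have h2 := h' d φ φ' hφ.2 hφ'.2 hE
  rw [map_add, map_add, add_sub_add_comm]
  have h3 := matrixTwoNorm_add_le (φ x - φ' x) (φ y - φ' y)
  linarith

theorem isDetermined_sum {ι : Type*} (I : Finset ι) {x : ι → 𝒢.Span}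
    (hx : ∀ i, IsDetermined E (x i)) : IsDetermined E (∑ i ∈ I, x i) := by
  classical
  induction I using Finset.induction_on with
  | empty =>
    refine fun ε hε => ⟨univ, univ_mem, fun d φ φ' _ _ h => ?_⟩
    rw [Finset.sum_empty, map_zero, map_zero, sub_self, matrixTwoNorm_zero]
    exact hε
  | insert i I hi ih =>
    rw [Finset.sum_insert hi]
    exact (hx i).add ih

theorem isDetermined_list_prod {l : List 𝒢.PartialIsom} (hl0 : l ≠ [])
    (hl : ∀ x ∈ l, x ∈ E ∪ star E) : IsDetermined E l.prod.toSpan := by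
  have hletter : ∀ x ∈ E ∪ star E, IsDetermined E x.toSpan := by
    rintro x (hx | hx)
    · exact isDetermined_of_mem hx
    · have := (isDetermined_of_mem (s := star x) hx).star
      rwa [star_star] at this
  induction l with
  | nil => exact absurd rfl hl0
  | cons a l ih =>
    by_cases h : l = []
    · subst h
      rw [List.prod_singleton]
      exact hletter a (hl a (by simp))
    · rw [List.prod_cons]
      exact (hletter a (hl a (by simp))).mul (ih h fun x hx => hl x (by simp [hx]))

/-- The letters occurring in t suffice. Supersets are allowed so that one finite set can later serve
several t. -/
theorem exists_isDetermined_of_mem_finiteSums {Ω : Set 𝒢.PartialIsom} {t : 𝒢.PartialIsom}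
    (ht : t ∈ finiteSums (words Ω)) : ∃ E : Set 𝒢.PartialIsom, E.Finite ∧ E ⊆ Ω ∧
      ∀ E', E ⊆ E' → IsDetermined E' t.toSpan := by
  obtain ⟨m, w, hw, ht⟩ := exists_of_mem_finiteSums ht
  choose F hF hFΩ l hl0 hl hlw using fun i => exists_list_of_mem_words (hw i)
  refine ⟨⋃ i, F i, finite_iUnion hF, iUnion_subset hFΩ, fun E' hE' => ?_⟩
  rw [PartialIsom.toSpan_eq_sum ht]
  refine isDetermined_sum _ fun i => ?_
  rw [← hlw i]
  have hFE : F i ⊆ E' := (subset_iUnion F i).trans hE'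
  exact isDetermined_list_prod (hl0 i) fun x hx =>
    (hl i x hx).imp (fun h => hFE h) fun h => hFE h

/-- E' collects the letters of sums of words t(s) within ε/3 of each s in E. Two good models that
agree on E' satisfy φ(s) ≈ φ(t(s)) ≈ φ'(t(s)) ≈ φ'(s), with error ε/3 at each step, so the fibres of
restriction from E to E' are small. -/
theorem modelsLift_univ_left {Ω : Set 𝒢.PartialIsom} (hΩ : IsGenerating Ω) :
    ModelsLift univ Ω := by
  intro E hE _ ε hε
  obtain ⟨M⟩ : Nonempty (AsymptoticModel (univ : Set 𝒢.PartialIsom)) := inferInstance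
  choose t ht hts using fun s : 𝒢.PartialIsom =>
    hΩ.1 s (ENNReal.ofReal (ε / 3)) (ENNReal.ofReal_pos.2 (by positivity))
  choose D hD hDΩ hDt using fun s : 𝒢.PartialIsom => exists_isDetermined_of_mem_finiteSums (ht s)
  let E' : Set 𝒢.PartialIsom := ⋃ s ∈ E, D s
  refine ⟨E', hE.biUnion fun s _ => hD s, iUnion₂_subset fun s _ => hDΩ s,
    fun F' hF' hF'Ω n' hn' δ' hδ' => ?_⟩
  have hdet : ∀ s ∈ E, ∃ U ∈ modelFilter (univ : Set 𝒢.PartialIsom),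
      ∀ (d : ℕ) (φ φ' : 𝒢.Span →ₗ[ℂ] Matrix (Fin d) (Fin d) ℂ), (⟨d, φ⟩ : 𝒢.MatrixModel) ∈ U →
        (⟨d, φ'⟩ : 𝒢.MatrixModel) ∈ U → (∀ s ∈ E', φ s.toSpan = φ' s.toSpan) →
          φ s.toSpan ∈ partialPermMatrices d ∧ matrixTwoNorm (φ s.toSpan - φ' s.toSpan) ≤ ε := by
    intro s hs
    obtain ⟨U, hU, h⟩ := hDt s E' (subset_biUnion_of_mem (u := D) hs) (ε / 3) (by positivity)
    have h1 := M.eventually_matrixTwoNorm_lt (x := s.toSpan - (t s).toSpan) (β := ε / 3)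
      (Submodule.sub_mem _
        (Submodule.subset_span (mem_image_of_mem _ (mem_finiteSums_words_univ s)))
        (Submodule.subset_span (mem_image_of_mem _ (mem_finiteSums_words_univ (t s)))))
      (hts s)
    refine ⟨_, inter_mem hU (inter_mem h1
      (eventually_mem_partialPermMatrices (mem_words_univ s))), fun d φ φ' hφ hφ' hE' => ?_⟩
    refine ⟨hφ.2.2, ?_⟩
    have h2 : matrixTwoNorm (φ (s.toSpan - (t s).toSpan)) < ε / 3 := hφ.2.1
    have h3 : matrixTwoNorm (φ' (s.toSpan - (t s).toSpan)) < ε / 3 := hφ'.2.1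
    have h4 := h d φ φ' hφ.1 hφ'.1 hE'
    rw [map_sub] at h2 h3
    rw [matrixTwoNorm_sub_comm] at h3
    have h5 := matrixTwoNorm_sub_le (φ s.toSpan) (φ (t s).toSpan) (φ' s.toSpan)
    have h6 := matrixTwoNorm_sub_le (φ (t s).toSpan) (φ' (t s).toSpan) (φ' s.toSpan)
    linarith
  choose! U hU hUdet using hdet
  -- The finitely many filter sets for s in E have a common choice of parameters, which is then
  -- merged with the prescribed F', n', δ'.
  obtain ⟨F, hF, -, n, hn, δ, hδ, hSA⟩ := (biInter_mem hE).2 hU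
  refine ⟨F ∪ F', hF.union hF', subset_univ _, max n n', hn.trans (le_max_left _ _), min δ δ',
    lt_min hδ hδ', fun d => ?_⟩
  have hsub : SA (F ∪ F') (max n n') (min δ δ') d ⊆ SA F n δ d :=
    SA_subset_SA subset_union_left (le_max_left _ _) (min_le_left _ _) d
  have hsub' : SA (F ∪ F') (max n n') (min δ δ') d ⊆ SA F' n' δ' d :=
    SA_subset_SA subset_union_right (le_max_right _ _) (min_le_right _ _) d
  have hmem : ∀ φ ∈ SA (F ∪ F') (max n n') (min δ δ') d, ∀ s ∈ E,
      (⟨d, φ⟩ : 𝒢.MatrixModel) ∈ U s := fun φ hφ s hs =>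
    mem_iInter₂.1 (hSA d φ (hsub hφ)) s hs
  refine Set.encard_le_encard_mul (fun x y => ∃ φ ∈ SA (F ∪ F') (max n n') (min δ δ') d,
    x = (fun s : E => φ s.1.toSpan) ∧ y = (fun s : E' => φ s.1.toSpan)) (by positivity) ?_ ?_
  · rintro _ ⟨φ, hφ, rfl⟩
    exact ⟨_, ⟨φ, hsub' hφ, rfl⟩, φ, hφ, rfl, rfl⟩
  · intro y _
    refine encard_fiber_le hE ?_ ?_
    · rintro _ ⟨-, φ, hφ, rfl, -⟩ s
      exact (hUdet s.1 s.2 d φ φ (hmem φ hφ _ s.2) (hmem φ hφ _ s.2) fun _ _ => rfl).1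
    · rintro _ ⟨-, φ, hφ, rfl, rfl⟩ _ ⟨-, φ', hφ', rfl, h⟩ s
      exact (hUdet s.1 s.2 d φ φ' (hmem φ hφ _ s.2) (hmem φ' hφ' _ s.2) fun r hr =>
        congrFun h ⟨r, hr⟩).2

end PMPGroupoid

/-! ### Error estimates for rebuilding a model from approximated atoms. -/

namespace PMPGroupoid

variable {G : Type*} [MeasurableSpace G] [StandardBorelSpace G] {𝒢 : PMPGroupoid G}

/-- Splitting off the first letter costs β each time. The accumulated error does not grow, because
the letter acts as a contraction. -/
theorem IsApproxMultiplicative.of_pairs {F : Set 𝒢.PartialIsom} {n d : ℕ} {β δ : ℝ}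
    {φ : 𝒢.Span →ₗ[ℂ] Matrix (Fin d) (Fin d) ℂ} (hβ : 0 ≤ β)
    (hI : ∀ k, 1 ≤ k → k ≤ n → ∀ s ∈ F ^ k, φ s.toSpan ∈ partialPermMatrices d)
    (hpair : ∀ s ∈ F, ∀ k, 1 ≤ k → k + 1 ≤ n → ∀ t ∈ F ^ k,
      matrixTwoNorm (φ (s * t).toSpan - φ s.toSpan * φ t.toSpan) ≤ β) (hδ : n * β < δ) :
    IsApproxMultiplicative F n δ φ := by
  have key : ∀ l : List 𝒢.PartialIsom, l ≠ [] → l.length ≤ n → (∀ x ∈ l, x ∈ F) →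
      matrixTwoNorm (φ l.prod.toSpan - (l.map fun s => φ s.toSpan).prod) ≤ l.length * β := by
    intro l hl0 hln hl
    induction l with
    | nil => exact absurd rfl hl0
    | cons a l ih =>
      by_cases h : l = []
      · subst h
        simp [matrixTwoNorm_zero, hβ]
      · have hlen := List.length_pos_of_ne_nil h
        rw [List.length_cons] at hln
        rw [List.prod_cons, List.map_cons, List.prod_cons, List.length_cons]
        have h1 := ih h (by omega) fun x hx => hl x (by simp [hx])
        have h2 := hpair a (hl a (by simp)) l.length hlen hln l.prod
          (list_prod_mem_pow fun x hx => hl x (by simp [hx]))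
        have h3 := matrixTwoNorm_mul_le_right
          (hI 1 le_rfl (by omega) a (by rw [pow_one]; exact hl a (by simp)))
          (φ l.prod.toSpan - (l.map fun s => φ s.toSpan).prod)
        have h4 := matrixTwoNorm_sub_le (φ (a * l.prod).toSpan) (φ a.toSpan * φ l.prod.toSpan)
          (φ a.toSpan * (l.map fun s => φ s.toSpan).prod)
        rw [← Matrix.mul_sub] at h4
        push_cast
        linarith
  intro k hk hkn s hs
  have h := key (List.ofFn s) (by rw [Ne, List.ofFn_eq_nil_iff]; omega) (by simpa using hkn)
    fun x hx => by
      obtain ⟨i, rfl⟩ := List.mem_ofFn.1 hx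
      exact hs i
  rw [List.map_ofFn, List.length_ofFn] at h
  have hkn' : (k : ℝ) * β ≤ n * β := mul_le_mul_of_nonneg_right (Nat.cast_le.2 hkn) hβ
  exact h.trans_lt (hkn'.trans_lt hδ)

theorem twoNorm_sum_le_card_mul {ι : Type*} {I : Finset ι} {x : ι → 𝒢.Fun}
    (hx : ∀ i, x i ∈ 𝒢.Span) {b : ℝ} (hb : ∀ i ∈ I, twoNorm (x i) ≤ ENNReal.ofReal b) :
    twoNorm (∑ i ∈ I, x i) ≤ ENNReal.ofReal (I.card * b) := by
  refine (twoNorm_sum_le I hx).trans ((Finset.sum_le_card_nsmul _ _ _ hb).trans ?_)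
  rw [nsmul_eq_mul, ENNReal.ofReal_mul (Nat.cast_nonneg _), ENNReal.ofReal_natCast]

theorem PartialIsom.ind_sub_mem_span (s t : 𝒢.PartialIsom) : s.ind - t.ind ∈ 𝒢.Span :=
  Submodule.sub_mem _ s.ind_mem_span t.ind_mem_span

theorem toSpan_mem_span_finiteSums {Ω : Set 𝒢.PartialIsom} {s : 𝒢.PartialIsom}
    (hs : s ∈ finiteSums (words Ω)) :
    s.toSpan ∈ Submodule.span ℂ (PartialIsom.toSpan '' finiteSums (words Ω)) :=
  Submodule.subset_span (mem_image_of_mem _ hs)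

section Approximation

variable {ι : Type*} [Fintype ι] {A t : ι → 𝒢.PartialIsom} {η : ℝ}

theorem twoNorm_mul_sub_mul_lt (hη : 0 < η)
    (hA : ∀ i, twoNorm ((A i).ind - (t i).ind) < ENNReal.ofReal η) (i k : ι) :
    twoNorm ((t i * t k).ind - (A i * A k).ind) < ENNReal.ofReal (2 * η) := by
  refine (twoNorm_mul_sub_mul_le _ _ _ _).trans_lt ?_
  rw [two_mul, ENNReal.ofReal_add hη.le hη.le, twoNorm_sub_comm, twoNorm_sub_comm (t k)]
  exact ENNReal.add_lt_add (hA i) (hA k)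

theorem twoNorm_star_mul_lt (hη : 0 < η)
    (hA : ∀ i, twoNorm ((A i).ind - (t i).ind) < ENNReal.ofReal η) {i k : ι}
    (h0 : (star (A i) * A k).ind = 0) :
    twoNorm (star (t i) * t k).ind < ENNReal.ofReal (2 * η) := by
  have h := twoNorm_mul_sub_mul_le (star (t i)) (star (A i)) (t k) (A k)
  rw [h0, sub_zero, twoNorm_star_sub_star, twoNorm_sub_comm, twoNorm_sub_comm (t k)] at h
  refine h.trans_lt ?_
  rw [two_mul, ENNReal.ofReal_add hη.le hη.le]
  exact ENNReal.add_lt_add (hA i) (hA k)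

theorem twoNorm_mul_star_lt (hη : 0 < η)
    (hA : ∀ i, twoNorm ((A i).ind - (t i).ind) < ENNReal.ofReal η) {i k : ι}
    (h0 : (A i * star (A k)).ind = 0) :
    twoNorm (t i * star (t k)).ind < ENNReal.ofReal (2 * η) := by
  have h := twoNorm_mul_sub_mul_le (t i) (A i) (star (t k)) (star (A k))
  rw [h0, sub_zero, twoNorm_star_sub_star, twoNorm_sub_comm, twoNorm_sub_comm (t k)] at h
  refine h.trans_lt ?_
  rw [two_mul, ENNReal.ofReal_add hη.le hη.le]
  exact ENNReal.add_lt_add (hA i) (hA k)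

theorem twoNorm_sub_sum_lt (hη : 0 < η)
    (hA : ∀ i, twoNorm ((A i).ind - (t i).ind) < ENNReal.ofReal η) {I : Finset ι}
    {s : 𝒢.PartialIsom} (hs : s.ind = ∑ i ∈ I, (A i).ind) :
    twoNorm (s.toSpan - ∑ i ∈ I, (t i).toSpan).1 <
      ENNReal.ofReal ((Fintype.card ι + 1) * η) := by
  have h : (s.toSpan - ∑ i ∈ I, (t i).toSpan).1 = ∑ i ∈ I, ((A i).ind - (t i).ind) := by
    rw [Finset.sum_sub_distrib, ← hs, AddSubgroupClass.coe_sub, AddSubmonoidClass.coe_finsetSum]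
    rfl
  rw [h]
  refine (twoNorm_sum_le_card_mul (fun i => PartialIsom.ind_sub_mem_span _ _)
    fun i _ => (hA i).le).trans_lt ?_
  rw [ENNReal.ofReal_lt_ofReal_iff (by positivity)]
  have : (I.card : ℝ) ≤ Fintype.card ι := Nat.cast_le.2 (Finset.card_le_univ I)
  nlinarith

/-- For the atoms themselves the two sums agree, both being s s'. Replacing A by t costs 2η for each
product and η for each single term; the final 1 makes the inequality strict. -/
theorem twoNorm_sum_mul_sub_sum_lt (hη : 0 < η)
    (hA : ∀ i, twoNorm ((A i).ind - (t i).ind) < ENNReal.ofReal η) {I J K : Finset ι}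
    {s s' : 𝒢.PartialIsom} (hs : s.ind = ∑ i ∈ I, (A i).ind) (hs' : s'.ind = ∑ i ∈ J, (A i).ind)
    (hss' : (s * s').ind = ∑ i ∈ K, (A i).ind) :
    twoNorm (∑ q ∈ I ×ˢ J, (t q.1 * t q.2).toSpan - ∑ i ∈ K, (t i).toSpan).1 <
      ENNReal.ofReal ((2 * (Fintype.card ι) ^ 2 + Fintype.card ι + 1) * η) := by
  have h : (∑ q ∈ I ×ˢ J, (t q.1 * t q.2).toSpan - ∑ i ∈ K, (t i).toSpan).1 =
      ∑ q ∈ I ×ˢ J, ((t q.1 * t q.2).ind - (A q.1 * A q.2).ind) +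
        ∑ i ∈ K, ((A i).ind - (t i).ind) := by
    have h1 := PartialIsom.ind_mul_eq_sum_sum hs hs'
    rw [← Finset.sum_product', hss'] at h1
    rw [Finset.sum_sub_distrib, Finset.sum_sub_distrib, ← h1, AddSubgroupClass.coe_sub,
      AddSubmonoidClass.coe_finsetSum, AddSubmonoidClass.coe_finsetSum]
    simp only [PartialIsom.toSpan]
    abel
  rw [h]
  refine (twoNorm_add_le (Submodule.sum_mem _ fun q _ => PartialIsom.ind_sub_mem_span _ _)
    (Submodule.sum_mem _ fun i _ => PartialIsom.ind_sub_mem_span _ _)).trans_lt ?_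
  refine (add_le_add (twoNorm_sum_le_card_mul (fun q => PartialIsom.ind_sub_mem_span _ _)
    fun q _ => (twoNorm_mul_sub_mul_lt hη hA q.1 q.2).le)
    (twoNorm_sum_le_card_mul (fun i => PartialIsom.ind_sub_mem_span _ _)
      fun i _ => (hA i).le)).trans_lt ?_
  rw [← ENNReal.ofReal_add (by positivity) (by positivity),
    ENNReal.ofReal_lt_ofReal_iff (by positivity), Finset.card_product]
  have hI : (I.card : ℝ) ≤ Fintype.card ι := Nat.cast_le.2 (Finset.card_le_univ I)
  have hJ : (J.card : ℝ) ≤ Fintype.card ι := Nat.cast_le.2 (Finset.card_le_univ J)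
  have hK : (K.card : ℝ) ≤ Fintype.card ι := Nat.cast_le.2 (Finset.card_le_univ K)
  have hIJ : (I.card : ℝ) * J.card ≤ Fintype.card ι * Fintype.card ι := by gcongr
  push_cast
  nlinarith

theorem norm_trace_sub_le_of_twoNorm_lt (hη : 0 < η) (hη1 : η ≤ 1) {s t : 𝒢.PartialIsom}
    (h : twoNorm (s.ind - t.ind) < ENNReal.ofReal η) : ‖trace s.ind - trace t.ind‖ ≤ η := by
  have h1 := (norm_trace_sub_le s t).trans (pow_le_pow_left' h.le 2)
  rw [← ENNReal.ofReal_pow hη.le, ENNReal.ofReal_le_ofReal_iff (by positivity)] at h1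
  nlinarith

/-- The asymptotic relations between the matrices that model approximations of the `A i`. -/
theorem eventually_model_estimates {Ω : Set 𝒢.PartialIsom} (M : AsymptoticModel Ω)
    (ht : ∀ i, t i ∈ finiteSums (words Ω)) (hη : 0 < η)
    (hA : ∀ i, twoNorm ((A i).ind - (t i).ind) < ENNReal.ofReal η) :
    ∀ᶠ p in modelFilter Ω,
      (∀ i, matrixTwoNorm (p.2 (t i).toSpan - M.T (t i) p) < η) ∧
      (∀ i, ‖normalizedTrace (M.T (t i) p) - trace (t i).ind‖ < η) ∧
      (∀ i k, matrixTwoNorm (p.2 (t i * t k).toSpan - M.T (t i) p * M.T (t k) p) < η) ∧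
      (∀ i k, (star (A i) * A k).ind = 0 →
        matrixTwoNorm ((M.T (t i) p)ᴴ * M.T (t k) p) ≤ 3 * η) ∧
      (∀ i k, (A i * star (A k)).ind = 0 →
        matrixTwoNorm (M.T (t i) p * (M.T (t k) p)ᴴ) ≤ 3 * η) := by
  refine (eventually_all.2 fun i => ?_).and ((eventually_all.2 fun i => ?_).and
    ((eventually_all.2 fun i => eventually_all.2 fun k => ?_).and
    ((eventually_all.2 fun i => eventually_all.2 fun k => ?_).and
    (eventually_all.2 fun i => eventually_all.2 fun k => ?_))))
  · exact (M.tendsto_sub _ (ht i)).eventually_lt_const hη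
  · filter_upwards [Metric.tendsto_nhds.1 (M.tendsto_trace (ht i)) η hη] with p hp
    rwa [dist_eq_norm] at hp
  · exact (M.tendsto_mul (ht i) (ht k)).eventually_lt_const hη
  · by_cases h0 : (star (A i) * A k).ind = 0
    · filter_upwards [(M.tendsto_star_mul (ht i) (ht k)).eventually_lt_const hη,
        M.eventually_matrixTwoNorm_lt (toSpan_mem_span_finiteSums (mul_mem_finiteSums_words
          (star_mem_finiteSums_words (ht i)) (ht k))) (twoNorm_star_mul_lt hη hA h0)] with p h1 h2
      intro _
      rw [matrixTwoNorm_sub_comm] at h1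
      -- The bound 3η is 2η from the 2-norm of t_i* t_k plus η from modelling it by matrices.
      have h3 := matrixTwoNorm_le_add_sub ((M.T (t i) p)ᴴ * M.T (t k) p)
        (p.2 (star (t i) * t k).toSpan)
      linarith
    · exact Eventually.of_forall fun p h => absurd h h0
  · by_cases h0 : (A i * star (A k)).ind = 0
    · filter_upwards [(M.tendsto_mul_star (ht i) (ht k)).eventually_lt_const hη,
        M.eventually_matrixTwoNorm_lt (toSpan_mem_span_finiteSums (mul_mem_finiteSums_words
          (ht i) (star_mem_finiteSums_words (ht k)))) (twoNorm_mul_star_lt hη hA h0)] with p h1 h2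
      intro _
      rw [matrixTwoNorm_sub_comm] at h1
      have h3 := matrixTwoNorm_le_add_sub (M.T (t i) p * (M.T (t k) p)ᴴ)
        (p.2 (t i * star (t k)).toSpan)
      linarith
    · exact Eventually.of_forall fun p h => absurd h h0

theorem matrixTwoNorm_sum_sub_sum_le {d : ℕ} {κ : Type*} {I : Finset κ}
    {P Q : κ → Matrix (Fin d) (Fin d) ℂ} {b : ℝ} (h : ∀ i, matrixTwoNorm (P i - Q i) ≤ b) :
    matrixTwoNorm (∑ i ∈ I, P i - ∑ i ∈ I, Q i) ≤ I.card * b := by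
  rw [← Finset.sum_sub_distrib]
  refine (matrixTwoNorm_sum_le _ _).trans ((Finset.sum_le_card_nsmul _ _ _ fun i _ => h i).trans ?_)
  rw [nsmul_eq_mul]

end Approximation

/-- Models are only required to be linear on the span, so any values may be prescribed on
independent atoms. -/
theorem exists_linearMap_toSpan_eq {ι : Type*} {A : ι → 𝒢.PartialIsom}
    (hA : LinearIndependent ℂ fun i => (A i).toSpan) {d : ℕ}
    (P : ι → Matrix (Fin d) (Fin d) ℂ) :
    ∃ φ : 𝒢.Span →ₗ[ℂ] Matrix (Fin d) (Fin d) ℂ, ∀ i, φ (A i).toSpan = P i := by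
  obtain ⟨φ, hφ⟩ := LinearMap.exists_extend ((Module.Basis.span hA).constr ℂ P)
  refine ⟨φ, fun i => ?_⟩
  have h := (Module.Basis.span hA).constr_basis ℂ P i
  rw [← hφ, LinearMap.comp_apply, Submodule.subtype_apply, Module.Basis.span_apply] at h
  exact h

end PMPGroupoid

namespace PMPGroupoid

variable {G : Type*} [MeasurableSpace G] [StandardBorelSpace G] {𝒢 : PMPGroupoid G}

theorem matrixTwoNorm_sum_sub_sum_le_card {d : ℕ} {κ : Type*} [Fintype κ] (I : Finset κ)
    {P Q : κ → Matrix (Fin d) (Fin d) ℂ} {b : ℝ} (hb : 0 ≤ b)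
    (h : ∀ i, matrixTwoNorm (P i - Q i) ≤ b) :
    matrixTwoNorm (∑ i ∈ I, P i - ∑ i ∈ I, Q i) ≤ Fintype.card κ * b :=
  (matrixTwoNorm_sum_sub_sum_le h).trans
    (mul_le_mul_of_nonneg_right (Nat.cast_le.2 (Finset.card_le_univ I)) hb)

section Rounding

variable {ι : Type*} [Fintype ι] {t : ι → 𝒢.PartialIsom} {η : ℝ} {d : ℕ}
  {φ : 𝒢.Span →ₗ[ℂ] Matrix (Fin d) (Fin d) ℂ} {T P : ι → Matrix (Fin d) (Fin d) ℂ}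

/-- With m atoms, the chain ΣP, ΣT, Σφ(t), Σφ(tt), ΣTT, ΣPP costs 5m², m, 2m² + m + 1, m² and 10m³
times η. -/
theorem matrixTwoNorm_sum_sub_sum_mul_sum_le (hη : 0 < η)
    (hT : ∀ i, T i ∈ partialPermMatrices d) (hP : ∀ i, P i ∈ partialPermMatrices d)
    (hTP : ∀ i, matrixTwoNorm (T i - P i) ≤ 5 * Fintype.card ι * η)
    (hφT : ∀ i, matrixTwoNorm (φ (t i).toSpan - T i) < η)
    (hφTT : ∀ i k, matrixTwoNorm (φ (t i * t k).toSpan - T i * T k) < η) {I J K : Finset ι}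
    (hIJK : matrixTwoNorm (φ (∑ q ∈ I ×ˢ J, (t q.1 * t q.2).toSpan - ∑ i ∈ K, (t i).toSpan)) <
      (2 * (Fintype.card ι) ^ 2 + Fintype.card ι + 1) * η) :
    matrixTwoNorm (∑ i ∈ K, P i - (∑ i ∈ I, P i) * ∑ i ∈ J, P i) ≤
      (10 * (Fintype.card ι) ^ 3 + 8 * (Fintype.card ι) ^ 2 + 2 * Fintype.card ι + 1) * η := by
  rw [Finset.sum_mul_sum, ← Finset.sum_product']
  rw [map_sub, map_sum, map_sum, matrixTwoNorm_sub_comm] at hIJK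
  have h1 := matrixTwoNorm_sum_sub_sum_le_card K (P := P) (Q := T) (by positivity)
    fun i => (matrixTwoNorm_sub_comm (P i) (T i)).trans_le (hTP i)
  have h2 := matrixTwoNorm_sum_sub_sum_le_card K (P := T) (Q := fun i => φ (t i).toSpan) hη.le
    fun i => (matrixTwoNorm_sub_comm _ _).trans_le (hφT i).le
  have h3 := matrixTwoNorm_sum_sub_sum_le_card (I ×ˢ J)
    (P := fun q => φ (t q.1 * t q.2).toSpan) (Q := fun q => T q.1 * T q.2) hη.le
    fun q => (hφTT q.1 q.2).le
  have h4 := matrixTwoNorm_sum_sub_sum_le_card (I ×ˢ J)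
    (P := fun q => T q.1 * T q.2) (Q := fun q => P q.1 * P q.2)
    (b := 5 * Fintype.card ι * η + 5 * Fintype.card ι * η) (by positivity)
    fun q => (matrixTwoNorm_mul_sub_mul_le (hT q.1) (hP q.2)).trans
      (add_le_add (hTP q.1) (hTP q.2))
  rw [Fintype.card_prod] at h3 h4
  push_cast at h3 h4
  have h5 := matrixTwoNorm_sub_le (∑ i ∈ K, P i) (∑ i ∈ K, T i)
    (∑ q ∈ I ×ˢ J, P q.1 * P q.2)
  have h6 := matrixTwoNorm_sub_le (∑ i ∈ K, T i) (∑ i ∈ K, φ (t i).toSpan)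
    (∑ q ∈ I ×ˢ J, P q.1 * P q.2)
  have h7 := matrixTwoNorm_sub_le (∑ i ∈ K, φ (t i).toSpan)
    (∑ q ∈ I ×ˢ J, φ (t q.1 * t q.2).toSpan) (∑ q ∈ I ×ˢ J, P q.1 * P q.2)
  have h8 := matrixTwoNorm_sub_le (∑ q ∈ I ×ˢ J, φ (t q.1 * t q.2).toSpan)
    (∑ q ∈ I ×ˢ J, T q.1 * T q.2) (∑ q ∈ I ×ˢ J, P q.1 * P q.2)
  nlinarith

/-- Each atom contributes 5mη for rounding, η for the trace of T and η for replacing A by t. -/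
theorem norm_normalizedTrace_sum_sub_trace_le {A : ι → 𝒢.PartialIsom} (hη : 0 < η) (hη1 : η ≤ 1)
    (hA : ∀ i, twoNorm ((A i).ind - (t i).ind) < ENNReal.ofReal η)
    (hTP : ∀ i, matrixTwoNorm (T i - P i) ≤ 5 * Fintype.card ι * η)
    (hTt : ∀ i, ‖normalizedTrace (T i) - trace (t i).ind‖ < η) {I : Finset ι}
    {s : 𝒢.PartialIsom} (hs : s.ind = ∑ i ∈ I, (A i).ind) :
    ‖normalizedTrace (∑ i ∈ I, P i) - trace s.ind‖ ≤
      (5 * (Fintype.card ι) ^ 2 + 2 * Fintype.card ι) * η := by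
  rw [trace_ind_eq_sum hs, normalizedTrace_sum, ← Finset.sum_sub_distrib]
  have hi : ∀ i, ‖normalizedTrace (P i) - trace (A i).ind‖ ≤
      (5 * Fintype.card ι + 2) * η := by
    intro i
    have h1 := norm_normalizedTrace_le (P i - T i)
    rw [normalizedTrace_sub, matrixTwoNorm_sub_comm] at h1
    have h2 := norm_trace_sub_le_of_twoNorm_lt hη hη1 (hA i)
    rw [norm_sub_rev] at h2
    have h3 := norm_sub_le_norm_sub_add_norm_sub (normalizedTrace (P i)) (normalizedTrace (T i))
      (trace (A i).ind)
    have h4 := norm_sub_le_norm_sub_add_norm_sub (normalizedTrace (T i)) (trace (t i).ind)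
      (trace (A i).ind)
    have h5 := hTt i
    have h6 := hTP i
    linarith
  refine (norm_sum_le _ _).trans ((Finset.sum_le_card_nsmul _ _ _ fun i _ => hi i).trans ?_)
  rw [nsmul_eq_mul]
  have : (I.card : ℝ) ≤ Fintype.card ι := Nat.cast_le.2 (Finset.card_le_univ I)
  calc (I.card : ℝ) * ((5 * Fintype.card ι + 2) * η)
      ≤ Fintype.card ι * ((5 * Fintype.card ι + 2) * η) := by gcongr
    _ = _ := by ring

theorem matrixTwoNorm_map_sub_sum_le (hη : 0 < η)
    (hTP : ∀ i, matrixTwoNorm (T i - P i) ≤ 5 * Fintype.card ι * η)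
    (hφT : ∀ i, matrixTwoNorm (φ (t i).toSpan - T i) < η) {I : Finset ι} {x : 𝒢.Span}
    (hx : matrixTwoNorm (φ (x - ∑ i ∈ I, (t i).toSpan)) < (Fintype.card ι + 1) * η) :
    matrixTwoNorm (φ x - ∑ i ∈ I, P i) ≤
      (5 * (Fintype.card ι) ^ 2 + 2 * Fintype.card ι + 1) * η := by
  rw [map_sub, map_sum] at hx
  have h1 := matrixTwoNorm_sum_sub_sum_le_card I (P := fun i => φ (t i).toSpan) (Q := T) hη.le
    fun i => (hφT i).le
  have h2 := matrixTwoNorm_sum_sub_sum_le_card I (by positivity) hTP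
  have h3 := matrixTwoNorm_sub_le (φ x) (∑ i ∈ I, φ (t i).toSpan) (∑ i ∈ I, P i)
  have h4 := matrixTwoNorm_sub_le (∑ i ∈ I, φ (t i).toSpan) (∑ i ∈ I, T i) (∑ i ∈ I, P i)
  nlinarith

end Rounding

end PMPGroupoid

theorem Set.Finite.npow {M : Type*} [Monoid M] {s : Set M} (hs : s.Finite) (n : ℕ) :
    (s ^ n).Finite := by
  induction n with
  | zero => simp
  | succ n ih =>
    rw [pow_succ]
    exact ih.mul hs

/-! ### Models on a generating set come from models of the groupoid. -/

namespace PMPGroupoid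

variable {G : Type*} [MeasurableSpace G] [StandardBorelSpace G] {𝒢 : PMPGroupoid G}

/-- If `Ω` is generating, then good approximate models on `Ω` are close on a finite set of words to
approximate models of `𝒢`. -/
theorem eventually_exists_mem_SA {Ω : Set 𝒢.PartialIsom} (hΩ : IsGenerating Ω)
    {E F : Set 𝒢.PartialIsom} (hF : F.Finite) (hEF : E ⊆ F) (hE : E ⊆ words Ω) {n : ℕ}
    (hn : 1 ≤ n) {δ ε : ℝ} (hδ : 0 < δ) (hε : 0 < ε) :
    ∀ᶠ p in modelFilter Ω, ∃ φ : 𝒢.Span →ₗ[ℂ] Matrix (Fin p.1) (Fin p.1) ℂ,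
      φ ∈ SA F n δ p.1 ∧ ∀ s ∈ E,
      p.2 s.toSpan ∈ partialPermMatrices p.1 ∧
        matrixTwoNorm (p.2 s.toSpan - φ s.toSpan) ≤ ε := by
  classical
  obtain ⟨M⟩ : Nonempty (AsymptoticModel Ω) := inferInstance
  have hFs : (F ∪ star F).Finite := hF.union hF.star
  -- W has to contain every product of at most n letters, since the new model must be a partial
  -- permutation with correct trace on each of them.
  have hWfin : (⋃ k ∈ Finset.Icc 1 n, (F ∪ star F) ^ k).Finite :=
    (Finset.finite_toSet _).biUnion fun k _ => hFs.npow k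
  set W : Finset 𝒢.PartialIsom := hWfin.toFinset with hW
  have hmemW : ∀ k, 1 ≤ k → k ≤ n → ∀ s ∈ (F ∪ star F) ^ k, s ∈ W := by
    intro k hk hkn s hs
    rw [hW, Finite.mem_toFinset]
    exact mem_iUnion₂.2 ⟨k, Finset.mem_Icc.2 ⟨hk, hkn⟩, hs⟩
  have hFW : ∀ s ∈ F ∪ star F, s ∈ W := fun s hs => hmemW 1 le_rfl hn s (by rwa [pow_one])
  obtain ⟨ι, _, A, inc, hli, hinc⟩ := exists_atoms W
  set m : ℝ := (Fintype.card ι : ℝ) with hm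
  have hm0 : 0 ≤ m := Nat.cast_nonneg _
  -- The first summand is n times the defect for one product; the second dominates the trace error
  -- and the distance on E. The 1 added to K below also forces η ≤ 1.
  set K : ℝ := n * (10 * m ^ 3 + 8 * m ^ 2 + 2 * m + 1) + (5 * m ^ 2 + 2 * m + 1) with hK
  obtain ⟨η, hη, hKη⟩ : ∃ η : ℝ, 0 < η ∧ (K + 1) * η < min 1 (min δ ε) :=
    exists_pos_mul_lt (by positivity) _
  have hK0 : 0 ≤ K := by positivity
  have hη1 : η ≤ 1 := by nlinarith [min_le_left (1 : ℝ) (min δ ε)]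
  have hKδ : (K + 1) * η < δ :=
    hKη.trans_le ((min_le_right _ _).trans (min_le_left _ _))
  have hKε : (K + 1) * η < ε :=
    hKη.trans_le ((min_le_right _ _).trans (min_le_right _ _))
  choose t ht hA using fun i => hΩ.1 (A i) (ENNReal.ofReal η) (ENNReal.ofReal_pos.2 hη)
  have hpairs : ∀ᶠ p in modelFilter Ω, ∀ s ∈ W, ∀ s' ∈ W, s * s' ∈ W →
      matrixTwoNorm (p.2 (∑ q ∈ inc s ×ˢ inc s', (t q.1 * t q.2).toSpan -
        ∑ i ∈ inc (s * s'), (t i).toSpan)) < (2 * m ^ 2 + m + 1) * η := by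
    refine (Finset.eventually_all _).2 fun s hs => (Finset.eventually_all _).2 fun s' hs' => ?_
    by_cases hss' : s * s' ∈ W
    · have h := M.eventually_matrixTwoNorm_lt
        (Submodule.sub_mem _
          (Submodule.sum_mem _ fun q _ => toSpan_mem_span_finiteSums
            (mul_mem_finiteSums_words (ht q.1) (ht q.2)))
          (Submodule.sum_mem _ fun i _ => toSpan_mem_span_finiteSums (ht i)))
        (twoNorm_sum_mul_sub_sum_lt hη hA (hinc s hs) (hinc s' hs') (hinc _ hss'))
      exact h.mono fun p hp _ => hp
    · exact Eventually.of_forall fun p h => absurd h hss'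
  have hclose : ∀ᶠ p in modelFilter Ω, ∀ s ∈ E, p.2 s.toSpan ∈ partialPermMatrices p.1 ∧
      matrixTwoNorm (p.2 (s.toSpan - ∑ i ∈ inc s, (t i).toSpan)) < (m + 1) * η := by
    refine (eventually_all_finite (hF.subset hEF)).2 fun s hs => ?_
    exact (eventually_mem_partialPermMatrices (hE hs)).and
      (M.eventually_matrixTwoNorm_lt
        (Submodule.sub_mem _ (toSpan_mem_span_finiteSums (subset_finiteSums _ (hE hs)))
          (Submodule.sum_mem _ fun i _ => toSpan_mem_span_finiteSums (ht i)))
        (twoNorm_sub_sum_lt hη hA (hinc s (hFW s (Or.inl (hEF hs))))))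
  filter_upwards [eventually_model_estimates M ht hη hA, hpairs, hclose] with p
    ⟨hφT, hTt, hφTT, hrow, hcol⟩ hp hpE
  -- Distinct atoms inside a common s in W are orthogonal, being summands of one partial isometry.
  -- Only for such pairs are the defects known to be small.
  obtain ⟨P, hP, horth, hTP⟩ := exists_orthogonal_rounding
    (fun i k => i ≠ k ∧ ∃ s ∈ W, i ∈ inc s ∧ k ∈ inc s) (Q := fun i => M.T (t i) p)
    (fun i => M.mem (t i) p) (γ := (3 * η) ^ 2)
    (by
      rintro i k ⟨hik, s, hs, hi, hk⟩
      exact pow_le_pow_left₀ (matrixTwoNorm_nonneg _)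
        (hrow i k (PartialIsom.ind_star_mul_eq_zero (hinc s hs) hi hk hik)) 2)
    (by
      rintro i k ⟨hik, s, hs, hi, hk⟩
      exact pow_le_pow_left₀ (matrixTwoNorm_nonneg _)
        (hcol i k (PartialIsom.ind_mul_star_eq_zero (hinc s hs) hi hk hik)) 2)
    (by positivity)
  -- The rounding bound is 2m²(3η)² = 18m²η², which is at most (5mη)².
  replace hTP : ∀ i, matrixTwoNorm (M.T (t i) p - P i) ≤ 5 * m * η := fun i =>
    le_of_sq_le_sq ((hTP i).trans (by nlinarith [mul_nonneg (sq_nonneg m) (sq_nonneg η)]))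
      (by positivity)
  obtain ⟨φ, hφ⟩ := exists_linearMap_toSpan_eq hli P
  have hφs : ∀ s ∈ W, φ s.toSpan = ∑ i ∈ inc s, P i := by
    intro s hs
    rw [PartialIsom.toSpan_eq_sum (hinc s hs), map_sum]
    exact Finset.sum_congr rfl fun i _ => hφ i
  have hφI : ∀ s ∈ W, φ s.toSpan ∈ partialPermMatrices p.1 := by
    intro s hs
    rw [hφs s hs]
    exact sum_mem_partialPermMatrices (fun i _ => hP i)
      fun i hi k hk hik => horth i k ⟨hik, s, hs, hi, hk⟩
  have hn0 : (0 : ℝ) ≤ n := Nat.cast_nonneg _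
  refine ⟨φ, ⟨?_, fun k hk hkn s hs => ⟨hφI s (hmemW k hk hkn s hs), ?_⟩⟩,
    fun s hs => ⟨(hpE s hs).1, ?_⟩⟩
  · refine IsApproxMultiplicative.of_pairs
      (β := (10 * m ^ 3 + 8 * m ^ 2 + 2 * m + 1) * η) (by positivity)
      (fun k hk hkn s hs => hφI s (hmemW k hk hkn s hs)) ?_ ?_
    · intro s hs k hk hkn s' hs'
      have hs'W := hmemW k hk (by omega) s' hs'
      have hss' : s * s' ∈ W := hmemW (k + 1) (by omega) hkn _ (by
        rw [pow_succ']
        exact Set.mul_mem_mul hs hs')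
      rw [hφs _ hss', hφs s (hFW s hs), hφs s' hs'W]
      exact matrixTwoNorm_sum_sub_sum_mul_sum_le hη (fun i => M.mem (t i) p) hP hTP hφT hφTT
        (hp s (hFW s hs) s' hs'W hss')
    · refine lt_of_le_of_lt ?_ hKδ
      rw [← mul_assoc]
      refine mul_le_mul_of_nonneg_right ?_ hη.le
      rw [hK]
      nlinarith [sq_nonneg m]
  · have hsW := hmemW k hk hkn s hs
    rw [hφs s hsW]
    refine (norm_normalizedTrace_sum_sub_trace_le hη hη1 hA hTP hTt (hinc s hsW)).trans_lt
      (lt_of_le_of_lt (mul_le_mul_of_nonneg_right ?_ hη.le) hKδ)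
    have : 0 ≤ n * (10 * m ^ 3 + 8 * m ^ 2 + 2 * m + 1) := by positivity
    rw [hK]
    linarith
  · rw [hφs s (hFW s (Or.inl (hEF hs)))]
    refine (matrixTwoNorm_map_sub_sum_le hη hTP hφT (hpE s hs).2).trans
      ((mul_le_mul_of_nonneg_right ?_ hη.le).trans hKε.le)
    have : 0 ≤ n * (10 * m ^ 3 + 8 * m ^ 2 + 2 * m + 1) := by positivity
    rw [hK]
    linarith

/-- E' = E works: the new model is built for F' ∪ E and stays within ε/2 on E. Restrictions assigned
to the same new model are then within ε of each other. -/
theorem modelsLift_univ_right {Ω : Set 𝒢.PartialIsom} (hΩ : IsGenerating Ω) :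
    ModelsLift Ω univ := by
  intro E hE hEΩ ε hε
  refine ⟨E, hE, subset_univ _, fun F' hF' _ n' hn' δ' hδ' => ?_⟩
  obtain ⟨F, hF, hFΩ, n, hn, δ, hδ, h⟩ := eventually_modelFilter_iff.1
    (eventually_exists_mem_SA hΩ (hF'.union hE) subset_union_right
      (hEΩ.trans (subset_words Ω)) hn' hδ' (half_pos hε))
  refine ⟨F, hF, hFΩ, n, hn, δ, hδ, fun d => ?_⟩
  refine Set.encard_le_encard_mul (fun x y => (∀ s, x s ∈ partialPermMatrices d) ∧
    ∀ s, matrixTwoNorm (x s - y s) ≤ ε / 2) (by positivity) ?_ ?_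
  · rintro _ ⟨φ, hφ, rfl⟩
    obtain ⟨φ', hφ', hE'⟩ := h d φ hφ
    exact ⟨_, ⟨φ', SA_subset_SA subset_union_left le_rfl le_rfl d hφ', rfl⟩,
      fun s => (hE' s.1 s.2).1, fun s => (hE' s.1 s.2).2⟩
  · intro y _
    refine encard_fiber_le hE (fun x hx => hx.2.1) fun x hx x' hx' s => ?_
    have h1 := hx.2.2 s
    have h2 := hx'.2.2 s
    rw [matrixTwoNorm_sub_comm] at h2
    have h3 := matrixTwoNorm_sub_le (x s) (y s) (x' s)
    linarith

end PMPGroupoid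

theorem mainTheorem3 {G : Type*} [MeasurableSpace G] [StandardBorelSpace G] (𝒢 : PMPGroupoid G)
    (Ω : Set 𝒢.PartialIsom) (hΩ : PMPGroupoid.IsGenerating Ω) :
    𝒢.soficDim = PMPGroupoid.soficDimOn Ω ∧ 𝒢.lowerSoficDim = PMPGroupoid.lowerSoficDimOn Ω :=
  ⟨le_antisymm
    (PMPGroupoid.iSup_iInf_le_of_modelsLift (PMPGroupoid.modelsLift_univ_left hΩ)
      (fun u => limsup u atTop) fun _ _ _ => EReal.limsup_le_limsup_add_coe)
    (PMPGroupoid.iSup_iInf_le_of_modelsLift (PMPGroupoid.modelsLift_univ_right hΩ)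
      (fun u => limsup u atTop) fun _ _ _ => EReal.limsup_le_limsup_add_coe),
  le_antisymm
    (PMPGroupoid.iSup_iInf_le_of_modelsLift (PMPGroupoid.modelsLift_univ_left hΩ)
      (fun u => liminf u atTop) fun _ _ _ => EReal.liminf_le_liminf_add_coe)
    (PMPGroupoid.iSup_iInf_le_of_modelsLift (PMPGroupoid.modelsLift_univ_right hΩ)
      (fun u => liminf u atTop) fun _ _ _ => EReal.liminf_le_liminf_add_coe)⟩
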